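/- **Setting.** Let $K$ be an algebraically closed field and $\Lambda=KQ/I$ a (finite-dimensional) gentle algebra: $Q$ is a finite quiver, $I$ is an admissible ideal generated by paths of length two, at most two arrows start and at most two arrows end at each vertex, and for each arrow $a$ there is at most one arrow $b$ with $ba$ a path not in $I$, at most one arrow $c$ with $ac$ a path not in $I$, at most one arrow $b$ with $ba$ a path in $I$, and at most one arrow $c$ with $ac$ a path in $I$. Paths are read from right to left, $s$ and $e$ denote start and end, modules are left modules, and $P(x)=\Lambda e_x$. A *walk* is a sequence of letters (arrows $a$ and formal inverses $\bar a$) $\cdots w_2w_1$, possibly infinite, with $s(w_{i+1})=e(w_i)$ and no subword $a\bar a$ or $\bar a a$; there is also a trivial walk $1_x$ for each vertex $x$. A *string* is a finite walk no subwalk of which, and no inverse of a subwalk of which, is a path in $I$. A *band* is a nontrivial string $w$ such that $ww$ is a string and $w$ is not a proper power. For a string $w=w_n\cdots w_1$ the string module $M(w)$ has a $K$-basis $z_0,\dots,z_n$, with $az_{i-1}=z_i$ if $w_i=a$ and $az_i=z_{i-1}$ if $w_i=\bar a$, all other arrow actions being zero. For a band $w$, a scalar $\lambda\in K^*$ and a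 direct letter $w_k$ of $w$, the (quasi-simple) band module $B(w,\lambda)$ is defined likewise with basis $z_i$, $i\in\mathbb Z/n$, except that $w_k z_{k-1}=\lambda z_k$. **Complexes.** A walk $\sigma$ is cut into *homotopy letters*: it is cut at its ends, at changes of orientation, and at consecutive letters $ba$ or $\bar a\bar b$ with $ba\in I$. A (possibly infinite) *homotopy string* is a walk which, if infinite to the left, is there eventually a direct antipath (arrows, every two consecutive ones composing to an element of $I$), and, if infinite to the right, is there eventually an inverse antipath. The string complex $P_\sigma$ of a homotopy string has one summand $P(x)$ for each cutting point, $x$ being its vertex, and a homotopy letter which, up to inversion, is a path $p$ from $x$ to $y$ gives the component $P(y)\to P(x)$, $m\mapsto mp$, of the differential, of cohomological degree $1$. A *homotopy band* is, up to rotation, a finite closed walk, cyclically reduced and not a proper power, with equal numbers of direct and inverse homotopy letters (read cyclically); its band complex $B^\bullet_{\sigma,\mu}$, $\mu\in K^*$, is defined in the same way from the cyclic walk, with the component of the direct homotopy letter containing a chosen direct letter multiplied by $\mu$. **The homotopy string $\pi(w)$.** For an arrow $b$ let $\mathrm{dir}(b)=\cdots b_2b_1$ be the maximal (possibly infinite)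 direct antipath with $b_1=b$; for an inverse arrow $a=\bar c$ let $\mathrm{inv}(a)=\bar c_1\bar c_2\cdots$ be the maximal inverse antipath with $c_1=c$. For a string $w$ choose an arrow $b$ or $b=\emptyset$ (absent), and an inverse arrow $a$ or $a=\emptyset$, such that $bwa$ is a string and the choice is maximal: an absent $b$ (resp. $a$) cannot be replaced by an arrow (resp. an inverse arrow), keeping the other one, such that $bwa$ is still a string. Such a choice always exists. Put $\pi(w)=\mathrm{dir}(b)\,w'\,\mathrm{inv}(a)$, where $\mathrm{dir}(\emptyset)$ and $\mathrm{inv}(\emptyset)$ are empty and $w'$ is obtained from $w$ by removing the maximal direct suffix $w_n\cdots w_{j+1}$ if $b=\emptyset$, and by removing the maximal inverse prefix $w_{i-1}\cdots w_1$ if $a=\emptyset$. If $w$ is a band, put $\pi(w)=w$. **Claim.** 1. For every string $w$ and every such choice, $\pi(w)$ is a homotopy string, it has a peak (a vertex at which no adjacent homotopy letter gives a component of the differential starting there), and $P_{\pi(w)}$, graded so that any given peak lies in degree $0$, is a projective resolution of $M(w)$: its terms are finitely generated projective and zero in positive degrees, and there is a quasi-isomorphism from it to $M(w)$ placed in degree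 $0$. 2. For every band $w$, $\pi(w)=w$ is a homotopy band, it has a peak, and for every $\lambda\in K^*$ the band complex $B^\bullet_{w,\mu}$ with $\mu=(-1)^r\lambda^{-1}$, where $r$ is the number of direct homotopy letters of $w$ (read cyclically) and both scalars are placed at the same direct letter of $w$, graded so that any given peak lies in degree $0$, is a projective resolution of $B(w,\lambda)$. -/

import Mathlib

open CategoryTheory
open scoped DirectSum

universe u

/-- A bound quiver `(Q, I)` whose ideal of relations is generated by paths of length two.
`V` is the set of vertices, `E` the set of arrows, an arrow `a` runs from `s a` to `t a`.
Paths are read from right to left: `rel b a` says that the path `b a` (first `a`, then `b`) is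
one of the generating relations. -/
structure BoundQuiver (V E : Type u) where
  s : E → V
  t : E → V
  rel : E → E → Prop
  rel_comp : ∀ {b a : E}, rel b a → s b = t a

namespace BoundQuiver

noncomputable section

variable {V E : Type u} (Q : BoundQuiver V E)

/-! ### Paths and the path algebra -/

/-- `l` lists, in the order in which they are traversed, the arrows of a path starting at `x`. -/
def IsPathFrom : V → List E → Prop
  | _, [] => True
  | x, a :: l => Q.s a = x ∧ IsPathFrom (Q.t a) l

/-- The end vertex of the path that starts at `x` and traverses the arrows in `l`. -/
def endVertex : V → List E → V
  | x, [] => x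
  | _, a :: l => endVertex (Q.t a) l

theorem isPathFrom_append {l m : List E} : ∀ {x : V}, Q.IsPathFrom x (l ++ m) ↔
    Q.IsPathFrom x l ∧ Q.IsPathFrom (Q.endVertex x l) m := by
  induction l with
  | nil => intro x; simp [IsPathFrom, endVertex]
  | cons a l ih => intro x; simp [IsPathFrom, endVertex, ih, and_assoc]

theorem endVertex_append {l m : List E} : ∀ {x : V},
    Q.endVertex x (l ++ m) = Q.endVertex (Q.endVertex x l) m := by
  induction l with
  | nil => intro x; simp [endVertex]
  | cons a l ih => intro x; simp [endVertex, ih]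

/-- Paths in the quiver; the trivial path at `x` has an empty list of arrows. -/
@[ext]
structure Path where
  start : V
  arrows : List E
  isPath : Q.IsPathFrom start arrows

variable {Q}

/-- The end vertex of a path. -/
def Path.finish (p : Q.Path) : V := Q.endVertex p.start p.arrows

/-- The length of a path. -/
def Path.length (p : Q.Path) : ℕ := p.arrows.length

/-- The composite path `q p` (first `p`, then `q`). -/
def Path.comp (q p : Q.Path) (h : p.finish = q.start) : Q.Path where
  start := p.start
  arrows := p.arrows ++ q.arrows
  isPath := Q.isPathFrom_append.2 ⟨p.isPath, by
    have := q.isPath; rw [← h] at this; exact this⟩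

theorem Path.finish_comp (q p : Q.Path) (h : p.finish = q.start) :
    (q.comp p h).finish = q.finish := by
  have h' : Q.endVertex p.start p.arrows = q.start := h
  simp [Path.finish, Path.comp, endVertex_append, h']

variable (Q)

/-- The trivial path at a vertex. -/
def trivialPath (x : V) : Q.Path := ⟨x, [], trivial⟩

/-- An arrow, as a path of length one. -/
def arrowPath (a : E) : Q.Path := ⟨Q.s a, [a], rfl, trivial⟩

/-- The path algebra `K Q`: the vector space on the set of all paths. -/
def PathAlgebra (K : Type u) [Field K] (Q : BoundQuiver V E) : Type u := Q.Path →₀ K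

variable (K : Type u) [Field K]

instance : AddCommGroup (PathAlgebra K Q) := inferInstanceAs (AddCommGroup (Q.Path →₀ K))
instance : Module K (PathAlgebra K Q) := inferInstanceAs (Module K (Q.Path →₀ K))

variable {Q}

/-- A path, as an element of the path algebra. -/
def ofPath (p : Q.Path) : PathAlgebra K Q := Finsupp.single p (1 : K)

open scoped Classical in
/-- The product of two paths: their composite if it exists, and zero otherwise. -/
def mulPath (q p : Q.Path) : PathAlgebra K Q :=
  if h : p.finish = q.start then ofPath K (q.comp p h) else 0

variable {K} in
@[elab_as_elim]
theorem pathAlgebra_induction {P : PathAlgebra K Q → Prop} (x : PathAlgebra K Q) (h0 : P 0)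
    (hadd : ∀ x y, P x → P y → P (x + y)) (hs : ∀ (c : K) (p : Q.Path), P (c • ofPath K p)) :
    P x := by
  refine Finsupp.induction_linear (motive := P) x h0 hadd fun p c => ?_
  have h : (c • ofPath K p : PathAlgebra K Q) = Finsupp.single p c := by
    change c • Finsupp.single p (1 : K) = _
    simp
  rw [← h]; exact hs c p

/-- The linear extension of a function on paths. -/
def extendLin {M : Type*} [AddCommGroup M] [Module K M] (f : Q.Path → M) :
    PathAlgebra K Q →ₗ[K] M :=
  (Finsupp.linearCombination K f : (Q.Path →₀ K) →ₗ[K] M)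

theorem extendLin_ofPath {M : Type*} [AddCommGroup M] [Module K M] (f : Q.Path → M)
    (p : Q.Path) : extendLin K f (ofPath K p) = f p :=
  (Finsupp.linearCombination_single K (1 : K) p).trans (one_smul _ _)

variable (Q) in
/-- The bilinear extension of the product of paths. -/
def mulLin : PathAlgebra K Q →ₗ[K] PathAlgebra K Q →ₗ[K] PathAlgebra K Q :=
  extendLin K fun q => extendLin K fun p => mulPath K q p

instance : Mul (PathAlgebra K Q) := ⟨fun x y => mulLin Q K x y⟩

theorem pathAlgebra_mul_def (x y : PathAlgebra K Q) : x * y = mulLin Q K x y := rfl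

theorem ofPath_mul (q p : Q.Path) : ofPath K q * ofPath K p = mulPath K q p := by
  rw [pathAlgebra_mul_def, mulLin, extendLin_ofPath, extendLin_ofPath]

theorem ofPath_mul_of_eq {q p : Q.Path} (h : p.finish = q.start) :
    ofPath K q * ofPath K p = ofPath K (q.comp p h) := by
  rw [ofPath_mul, mulPath, dif_pos h]

theorem ofPath_mul_of_ne {q p : Q.Path} (h : p.finish ≠ q.start) :
    ofPath K q * ofPath K p = 0 := by
  rw [ofPath_mul, mulPath, dif_neg h]

instance : NonUnitalNonAssocRing (PathAlgebra K Q) where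
  left_distrib x y z := by simp [pathAlgebra_mul_def]
  right_distrib x y z := by simp [pathAlgebra_mul_def]
  zero_mul x := by simp [pathAlgebra_mul_def]
  mul_zero x := by simp [pathAlgebra_mul_def]

instance : IsScalarTower K (PathAlgebra K Q) (PathAlgebra K Q) :=
  ⟨fun c x y => by simp [pathAlgebra_mul_def, smul_eq_mul]⟩

instance : SMulCommClass K (PathAlgebra K Q) (PathAlgebra K Q) :=
  ⟨fun c x y => by simp [pathAlgebra_mul_def, smul_eq_mul]⟩

theorem ofPath_mul_assoc (r q p : Q.Path) :
    ofPath K r * ofPath K q * ofPath K p = ofPath K r * (ofPath K q * ofPath K p) := by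
  by_cases h1 : p.finish = q.start
  · by_cases h2 : q.finish = r.start
    · rw [ofPath_mul_of_eq K h1, ofPath_mul_of_eq K h2, ofPath_mul_of_eq K (q := r.comp q h2) h1,
        ofPath_mul_of_eq K (p := q.comp p h1) ((Path.finish_comp q p h1).trans h2)]
      congr 1
      ext1
      · rfl
      · simp [Path.comp]
    · rw [ofPath_mul_of_ne K h2, zero_mul, ofPath_mul_of_eq K h1, ofPath_mul_of_ne]
      rwa [Path.finish_comp]
  · rw [ofPath_mul_of_ne K h1, mul_zero]
    by_cases h2 : q.finish = r.start
    · rw [ofPath_mul_of_eq K h2, ofPath_mul_of_ne]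
      exact h1
    · rw [ofPath_mul_of_ne K h2, zero_mul]

instance : NonUnitalRing (PathAlgebra K Q) where
  mul_assoc x y z := by
    induction x using pathAlgebra_induction with
    | h0 => simp
    | hadd x x' hx hx' => simp [add_mul, hx, hx']
    | hs c r =>
      induction y using pathAlgebra_induction with
      | h0 => simp
      | hadd y y' hy hy' => simp only [add_mul, mul_add, hy, hy']
      | hs c' q =>
        induction z using pathAlgebra_induction with
        | h0 => simp
        | hadd z z' hz hz' => simp only [mul_add, hz, hz']
        | hs c'' p =>
          simp only [smul_mul_assoc, mul_smul_comm, ofPath_mul_assoc]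

theorem trivialPath_mul (x : V) (p : Q.Path) [Decidable (p.finish = x)] :
    ofPath K (Q.trivialPath x) * ofPath K p = if p.finish = x then ofPath K p else 0 := by
  split_ifs with h
  · rw [ofPath_mul_of_eq K (q := Q.trivialPath x) h]
    congr 1
    ext1
    · rfl
    · simp [Path.comp, trivialPath]
  · exact ofPath_mul_of_ne K h

theorem mul_trivialPath (x : V) (p : Q.Path) [Decidable (x = p.start)] :
    ofPath K p * ofPath K (Q.trivialPath x) = if x = p.start then ofPath K p else 0 := by
  split_ifs with h
  · rw [ofPath_mul_of_eq K (p := Q.trivialPath x) h]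
    congr 1
    ext1
    · exact h
    · simp [Path.comp, trivialPath]
  · exact ofPath_mul_of_ne K h

variable [Fintype V]

instance : One (PathAlgebra K Q) := ⟨∑ x : V, ofPath K (Q.trivialPath x)⟩

theorem pathAlgebra_one_def :
    (1 : PathAlgebra K Q) = ∑ x : V, ofPath K (Q.trivialPath x) := rfl

instance : Ring (PathAlgebra K Q) where
  __ := (inferInstance : NonUnitalRing (PathAlgebra K Q))
  one_mul x := by
    classical
    induction x using pathAlgebra_induction with
    | h0 => exact mul_zero _
    | hadd x y hx hy => rw [mul_add, hx, hy]
    | hs c p =>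
      rw [mul_smul_comm, pathAlgebra_one_def, Finset.sum_mul]
      simp [trivialPath_mul]
  mul_one x := by
    classical
    induction x using pathAlgebra_induction with
    | h0 => exact zero_mul _
    | hadd x y hx hy => rw [add_mul, hx, hy]
    | hs c p =>
      rw [smul_mul_assoc, pathAlgebra_one_def, Finset.mul_sum]
      simp [mul_trivialPath]

instance : Algebra K (PathAlgebra K Q) :=
  Algebra.ofModule (fun c x y => smul_mul_assoc c x y) (fun c x y => mul_smul_comm c x y)

/-! ### The bound path algebra -/

variable (Q)

/-- The ideal `I` of `K Q` generated by the relations `b a` of length two. -/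
def relIdeal : TwoSidedIdeal (PathAlgebra K Q) :=
  TwoSidedIdeal.span {x | ∃ b a, Q.rel b a ∧
    x = ofPath K (Q.arrowPath b) * ofPath K (Q.arrowPath a)}

/-- The bound path algebra `Λ = K Q / I`. -/
def BoundPathAlgebra : Type u := (Q.relIdeal K).ringCon.Quotient

instance : Ring (Q.BoundPathAlgebra K) := inferInstanceAs (Ring (Q.relIdeal K).ringCon.Quotient)
instance : Algebra K (Q.BoundPathAlgebra K) :=
  inferInstanceAs (Algebra K (Q.relIdeal K).ringCon.Quotient)

/-- The projection `K Q → Λ`. -/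
def toBound : PathAlgebra K Q →+* Q.BoundPathAlgebra K := (Q.relIdeal K).ringCon.mk'

/-- The idempotent `e_x` of `Λ`. -/
def idem (x : V) : Q.BoundPathAlgebra K :=
  Q.toBound K (ofPath K (Q.trivialPath x))

/-- The class of an arrow in `Λ`. -/
def arrow (a : E) : Q.BoundPathAlgebra K :=
  Q.toBound K (ofPath K (Q.arrowPath a))

variable {Q}

theorem arrow_mul_arrow_of_rel {b a : E} (h : Q.rel b a) : Q.arrow K b * Q.arrow K a = 0 := by
  rw [arrow, arrow, ← map_mul]
  rw [← map_zero (Q.toBound K)]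
  refine Quotient.sound' ?_
  exact TwoSidedIdeal.subset_span ⟨b, a, h, rfl⟩

theorem arrow_mul_arrow_of_ne {b a : E} (h : Q.s b ≠ Q.t a) : Q.arrow K b * Q.arrow K a = 0 := by
  rw [arrow, arrow, ← map_mul, ofPath_mul_of_ne, map_zero]
  exact fun h' => h h'.symm

theorem arrow_mul_idem (a : E) (x : V) [Decidable (x = Q.s a)] :
    Q.arrow K a * Q.idem K x = if x = Q.s a then Q.arrow K a else 0 := by
  classical
  rw [arrow, idem, ← map_mul, mul_trivialPath]
  by_cases h : x = Q.s a
  · rw [if_pos h, if_pos (show x = (Q.arrowPath a).start from h)]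
  · rw [if_neg h, if_neg (show ¬ x = (Q.arrowPath a).start from h), map_zero]

theorem idem_mul_idem (x : V) : Q.idem K x * Q.idem K x = Q.idem K x := by
  classical
  rw [idem, ← map_mul, mul_trivialPath]
  exact congrArg _ (if_pos rfl)

/-- The conditions for `K Q / I` to be a gentle algebra. Together with finiteness of the quiver,
`admissible` says that `I` is an admissible ideal (`I` is contained in the square of the arrow
ideal, being generated by paths of length two). -/
structure IsGentle (Q : BoundQuiver V E) (K : Type u) [Field K] : Prop where
  card_start : ∀ x : V, {a | Q.s a = x}.encard ≤ 2
  card_end : ∀ x : V, {a | Q.t a = x}.encard ≤ 2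
  nonrel_left : ∀ a : E, {b | Q.s b = Q.t a ∧ ¬ Q.rel b a}.Subsingleton
  nonrel_right : ∀ a : E, {c | Q.s a = Q.t c ∧ ¬ Q.rel a c}.Subsingleton
  rel_left : ∀ a : E, {b | Q.rel b a}.Subsingleton
  rel_right : ∀ a : E, {c | Q.rel a c}.Subsingleton
  admissible : ∃ m : ℕ, ∀ p : Q.Path, p.length = m → ofPath K p ∈ Q.relIdeal K

/-! ### The universal property of `Λ` -/

/-- A system of elements of an algebra `A` satisfying the defining relations of `Λ`. -/
structure RelSystem (Q : BoundQuiver V E) (A : Type*) [Ring A] where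
  e : V → A
  f : E → A
  e_mul_self : ∀ x, e x * e x = e x
  e_mul_ne : ∀ x y, x ≠ y → e x * e y = 0
  sum_e : ∑ x, e x = 1
  e_mul_f : ∀ a, e (Q.t a) * f a = f a
  f_mul_e : ∀ a, f a * e (Q.s a) = f a
  rel : ∀ b a, Q.rel b a → f b * f a = 0

namespace RelSystem

variable {A : Type*} [Ring A] (S : RelSystem Q A)

/-- The value of a path: arrows are multiplied from right to left. -/
def value : V → List E → A
  | x, [] => S.e x
  | _, a :: l => value (Q.t a) l * S.f a

theorem value_mul_e (l : List E) (x : V) (h : Q.IsPathFrom x l) :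
    S.value x l * S.e x = S.value x l := by
  cases l with
  | nil => exact S.e_mul_self x
  | cons a l =>
    obtain ⟨rfl, _⟩ := h
    rw [value, mul_assoc, S.f_mul_e]

theorem value_append (l m : List E) : ∀ x : V, Q.IsPathFrom x l →
    Q.IsPathFrom (Q.endVertex x l) m →
    S.value x (l ++ m) = S.value (Q.endVertex x l) m * S.value x l := by
  induction l with
  | nil => intro x _ h; exact (S.value_mul_e m x h).symm
  | cons a l ih =>
    intro x h h'
    rw [List.cons_append, value, value, ih _ h.2 h', mul_assoc]
    rfl

theorem e_mul_value (l : List E) (x : V) (h : Q.IsPathFrom x l) :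
    S.e (Q.endVertex x l) * S.value x l = S.value x l := by
  have h' := S.value_append l [] x h trivial
  rw [List.append_nil] at h'
  exact h'.symm

theorem value_mul_ne (l m : List E) (x y : V) (hl : Q.IsPathFrom x l) (hm : Q.IsPathFrom y m)
    (h : Q.endVertex x l ≠ y) : S.value y m * S.value x l = 0 := by
  rw [← S.e_mul_value l x hl, ← S.value_mul_e m y hm, mul_assoc, ← mul_assoc (S.e y),
    S.e_mul_ne _ _ h.symm, zero_mul, mul_zero]

/-- The induced linear map on the path algebra. -/
def liftLin [Algebra K A] : PathAlgebra K Q →ₗ[K] A :=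
  extendLin K fun p : Q.Path => S.value p.start p.arrows

theorem liftLin_ofPath [Algebra K A] (p : Q.Path) :
    S.liftLin K (ofPath K p) = S.value p.start p.arrows := extendLin_ofPath K _ p

theorem liftLin_mul_path [Algebra K A] (q p : Q.Path) : S.liftLin K (ofPath K q * ofPath K p) =
    S.liftLin K (ofPath K q) * S.liftLin K (ofPath K p) := by
  rw [liftLin_ofPath, liftLin_ofPath]
  by_cases h : p.finish = q.start
  · rw [ofPath_mul_of_eq K h, liftLin_ofPath]
    have h' : Q.endVertex p.start p.arrows = q.start := h
    have := S.value_append p.arrows q.arrows p.start p.isPath (by rw [h']; exact q.isPath)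
    rw [h'] at this
    exact this
  · rw [ofPath_mul_of_ne K h, map_zero, S.value_mul_ne _ _ _ _ p.isPath q.isPath h]

/-- The induced ring homomorphism on the path algebra. -/
def liftHom [Algebra K A] : PathAlgebra K Q →+* A where
  __ := S.liftLin K
  map_zero' := map_zero (S.liftLin K)
  map_add' := map_add (S.liftLin K)
  map_one' := by
    change S.liftLin K 1 = 1
    rw [pathAlgebra_one_def, map_sum, ← S.sum_e]
    exact Finset.sum_congr rfl fun x _ => S.liftLin_ofPath K _
  map_mul' x y := by
    change S.liftLin K (x * y) = S.liftLin K x * S.liftLin K y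
    induction x using pathAlgebra_induction with
    | h0 => rw [zero_mul, map_zero, zero_mul]
    | hadd x x' hx hx' => rw [add_mul, map_add, hx, hx', map_add, add_mul]
    | hs c q =>
      induction y using pathAlgebra_induction with
      | h0 => rw [mul_zero, map_zero, mul_zero]
      | hadd y y' hy hy' => rw [mul_add, map_add, hy, hy', map_add, mul_add]
      | hs c' p => simp only [smul_mul_assoc, mul_smul_comm, map_smul, liftLin_mul_path]

theorem liftHom_arrow [Algebra K A] (a : E) : S.liftHom K (ofPath K (Q.arrowPath a)) = S.f a :=
  (S.liftLin_ofPath K _).trans (S.e_mul_f a)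

/-- The induced ring homomorphism on `Λ = K Q / I`. -/
def toHom [Algebra K A] : Q.BoundPathAlgebra K →+* A :=
  (Q.relIdeal K).ringCon.lift (S.liftHom K) (by
    have h : Q.relIdeal K ≤ TwoSidedIdeal.ker (S.liftHom K) := by
      refine TwoSidedIdeal.span_le.2 ?_
      rintro _ ⟨b, a, hba, rfl⟩
      refine (TwoSidedIdeal.mem_ker _).2 ?_
      rw [map_mul, liftHom_arrow, liftHom_arrow, S.rel b a hba]
    intro x y hxy
    exact TwoSidedIdeal.ringCon_le_iff.1 h hxy)

end RelSystem

/-! ### Modules given by matrices -/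

/-- A representation of `(Q, I)` with a basis indexed by a finite type `P`: the basis vector `z i`
lives at the vertex `vert i`, and the arrow `a` maps `z i` to `∑ j, coef a i j • z j`. -/
structure MatrixRep (Q : BoundQuiver V E) (K : Type u) [Field K] (P : Type) where
  vert : P → V
  coef : E → P → P → K
  coef_start : ∀ a i j, coef a i j ≠ 0 → vert i = Q.s a
  coef_end : ∀ a i j, coef a i j ≠ 0 → vert j = Q.t a
  coef_rel : ∀ b a, Q.rel b a → ∀ i j k, coef a i j * coef b j k = 0

namespace MatrixRep

variable {K} {P : Type} [Fintype P] [DecidableEq P] (R : MatrixRep Q K P)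

open scoped Classical in
/-- The matrices by which the vertices and the arrows act on column vectors. -/
def relSystem : RelSystem Q (Matrix P P K) where
  e x := Matrix.diagonal fun i => if R.vert i = x then 1 else 0
  f a := Matrix.of fun j i => R.coef a i j
  e_mul_self x := by simp [Matrix.diagonal_mul_diagonal]
  e_mul_ne x y h := by
    rw [Matrix.diagonal_mul_diagonal, ← Matrix.diagonal_zero]
    congr 1
    funext i
    by_cases hx : R.vert i = x
    · simp [hx, h]
    · simp [hx]
  sum_e := by
    ext i j
    rw [Matrix.sum_apply]
    by_cases h : i = j
    · subst h; simp
    · simp [Matrix.diagonal_apply_ne _ h, Matrix.one_apply_ne h]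
  e_mul_f a := by
    ext j i
    rw [Matrix.diagonal_mul, Matrix.of_apply]
    by_cases h : R.coef a i j = 0
    · simp [h]
    · simp [R.coef_end a i j h]
  f_mul_e a := by
    ext j i
    rw [Matrix.mul_diagonal, Matrix.of_apply]
    by_cases h : R.coef a i j = 0
    · simp [h]
    · simp [R.coef_start a i j h]
  rel b a h := by
    ext k i
    rw [Matrix.mul_apply]
    refine Finset.sum_eq_zero fun j _ => ?_
    rw [Matrix.of_apply, Matrix.of_apply, mul_comm, R.coef_rel b a h]

/-- The `Λ`-module with underlying vector space `K ^ P`. -/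
def toModule : ModuleCat.{u} (Q.BoundPathAlgebra K) :=
  letI : Module (Q.BoundPathAlgebra K) (P → K) := Module.compHom (P → K)
    ((Matrix.toLinAlgEquiv' : Matrix P P K ≃ₐ[K] Module.End K (P → K)).toRingEquiv.toRingHom.comp
      (R.relSystem.toHom K))
  ModuleCat.of (Q.BoundPathAlgebra K) (P → K)

end MatrixRep

end

/-! ### Letters, strings and bands -/

/-- Letters: arrows and formal inverses of arrows. -/
inductive Letter (E : Type u) : Type u
  | direct (a : E)
  | inverse (a : E)

namespace Letter

variable {V E : Type u} (Q : BoundQuiver V E)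

/-- The formal inverse of a letter. -/
def bar : Letter E → Letter E
  | direct a => inverse a
  | inverse a => direct a

/-- The underlying arrow of a letter. -/
def arrow : Letter E → E
  | direct a => a
  | inverse a => a

/-- Whether a letter is an arrow. -/
def isDirect : Letter E → Bool
  | direct _ => true
  | inverse _ => false

/-- The start of a letter. -/
def src : Letter E → V
  | direct a => Q.s a
  | inverse a => Q.t a

/-- The end of a letter. -/
def tgt : Letter E → V
  | direct a => Q.t a
  | inverse a => Q.s a

/-- `v u` is a walk: the letter `v` may be written to the left of the letter `u`. -/
def Adjacent (u v : Letter E) : Prop := src Q v = tgt Q u ∧ v ≠ u.bar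

/-- Neither `v u` nor its inverse is a relation. -/
def NonRel : Letter E → Letter E → Prop
  | direct a, direct b => ¬ Q.rel b a
  | inverse a, inverse b => ¬ Q.rel a b
  | _, _ => True

/-- `v u` is a string: the letter `v` may be written to the left of the letter `u` in a string. -/
def Compatible (u v : Letter E) : Prop := Adjacent Q u v ∧ NonRel Q u v

/-- `v u` or its inverse is a path of length two which is not a relation. -/
def Straight : Letter E → Letter E → Prop
  | direct a, direct b => Q.s b = Q.t a ∧ ¬ Q.rel b a
  | inverse a, inverse b => Q.s a = Q.t b ∧ ¬ Q.rel a b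
  | _, _ => False

end Letter

variable {V E : Type u}

/-- A string `w = w_n ⋯ w_1`. The list `letters` is `[w_1, …, w_n]`, so its head is the
rightmost letter. If it is empty, then `w` is the trivial string at `start`. -/
structure GString (Q : BoundQuiver V E) where
  start : V
  letters : List (Letter E)
  src_eq : ∀ u ∈ letters.head?, u.src Q = start
  chain : letters.IsChain (Letter.Compatible Q)

namespace GString

variable {Q : BoundQuiver V E} (w : Q.GString)

/-- The vertex `e(w_i) = s(w_{i+1})` of `w`; the vertex with index `0` is the start of `w`. -/
def vertex : ℕ → V
  | 0 => w.start
  | i + 1 => (w.letters[i]?).elim w.start (Letter.tgt Q)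

theorem src_getElem {i : ℕ} {u : Letter E} (h : w.letters[i]? = some u) :
    u.src Q = w.vertex i := by
  cases i with
  | zero => exact w.src_eq u (by rw [List.head?_eq_getElem?]; exact h)
  | succ i =>
    obtain ⟨hi, rfl⟩ := List.getElem?_eq_some_iff.1 h
    have := (List.isChain_iff_getElem.1 w.chain i hi).1.1
    rw [this, vertex, List.getElem?_eq_getElem (by omega)]
    rfl

theorem tgt_getElem {i : ℕ} {u : Letter E} (h : w.letters[i]? = some u) :
    u.tgt Q = w.vertex (i + 1) := by
  rw [vertex, h]; rfl

theorem compatible_getElem {i : ℕ} {u v : Letter E} (h : w.letters[i]? = some u)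
    (h' : w.letters[i + 1]? = some v) : Letter.Compatible Q u v := by
  obtain ⟨hi, rfl⟩ := List.getElem?_eq_some_iff.1 h
  obtain ⟨hi', rfl⟩ := List.getElem?_eq_some_iff.1 h'
  exact List.isChain_iff_getElem.1 w.chain i hi'

open scoped Classical in
/-- The representation of a string `w = w_n ⋯ w_1`: it has a basis `z_0, …, z_n`; if
`w_{i+1} = a` is an arrow then `a z_i = z_{i+1}`, if `w_{i+1}` is the inverse of the arrow `a` then
`a z_{i+1} = z_i`, and all other products of an arrow and a basis vector vanish. -/
noncomputable def rep (K : Type u) [Field K] : MatrixRep Q K (Fin (w.letters.length + 1)) where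
  vert i := w.vertex i
  coef a i j :=
    if ((j : ℕ) = i + 1 ∧ w.letters[(i : ℕ)]? = some (.direct a)) ∨
      ((i : ℕ) = j + 1 ∧ w.letters[(j : ℕ)]? = some (.inverse a)) then 1 else 0
  coef_start a i j h := by
    simp only [ne_eq, ite_eq_right_iff, one_ne_zero, imp_false, not_not] at h
    rcases h with ⟨_, h⟩ | ⟨h', h⟩
    · exact (w.src_getElem h).symm
    · rw [h']; exact (w.tgt_getElem h).symm
  coef_end a i j h := by
    simp only [ne_eq, ite_eq_right_iff, one_ne_zero, imp_false, not_not] at h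
    rcases h with ⟨h', h⟩ | ⟨_, h⟩
    · rw [h']; exact (w.tgt_getElem h).symm
    · exact (w.src_getElem h).symm
  coef_rel b a hba i j k := by
    rw [mul_eq_zero]
    by_contra! h
    simp only [ne_eq, ite_eq_right_iff, one_ne_zero, imp_false, not_not] at h
    obtain ⟨⟨h1, h2⟩ | ⟨h1, h2⟩, ⟨h3, h4⟩ | ⟨h3, h4⟩⟩ := h
    · rw [h1] at h4
      exact (w.compatible_getElem h2 h4).2 hba
    · have h5 : (k : ℕ) = i := by omega
      rw [h5, h2] at h4
      simp at h4
    · rw [h2] at h4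
      simp at h4
    · rw [h3] at h2
      exact (w.compatible_getElem h4 h2).2 hba

/-- The string module `M(w)`. -/
noncomputable def module (K : Type u) [Field K] [Fintype V] :
    ModuleCat.{u} (Q.BoundPathAlgebra K) := (w.rep K).toModule

/-- `w` is a band: it is not trivial, `w w` is a string, and `w` is not a proper power. -/
structure IsBand (w : Q.GString) : Prop where
  ne_nil : w.letters ≠ []
  square : (w.letters ++ w.letters).IsChain (Letter.Compatible Q)
  primitive : ∀ (v : List (Letter E)) (m : ℕ), 1 < m → w.letters ≠ (List.replicate m v).flatten

namespace IsBand

variable {w}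

theorem compatible_getElem (hw : w.IsBand) {i j : ℕ} (hi : i < w.letters.length)
    (hj : j = (i + 1) % w.letters.length) {u v : Letter E} (h : w.letters[i]? = some u)
    (h' : w.letters[j]? = some v) : Letter.Compatible Q u v := by
  have hs := List.isChain_iff_getElem.1 hw.square i (by simp; omega)
  obtain ⟨hi, rfl⟩ := List.getElem?_eq_some_iff.1 h
  obtain ⟨hj', rfl⟩ := List.getElem?_eq_some_iff.1 h'
  rw [List.getElem_append_left hi] at hs
  by_cases hn : i + 1 < w.letters.length
  · rw [List.getElem_append_left hn] at hs
    rw [Nat.mod_eq_of_lt hn] at hj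
    subst hj
    exact hs
  · have hn' : i + 1 = w.letters.length := by omega
    rw [List.getElem_append_right (by omega)] at hs
    rw [hn', Nat.mod_self] at hj
    subst hj
    simpa [hn'] using hs

theorem tgt_getElem (hw : w.IsBand) {i j : ℕ} (hi : i < w.letters.length)
    (hj : j = (i + 1) % w.letters.length) {u : Letter E} (h : w.letters[i]? = some u) :
    u.tgt Q = w.vertex j := by
  have hj' : j < w.letters.length := hj ▸ Nat.mod_lt _ (by omega)
  have h' := List.getElem?_eq_getElem hj'
  rw [← w.src_getElem h', (hw.compatible_getElem hi hj h h').1.1]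

theorem succ_injective {n i k : ℕ} (hi : i < n) (hk : k < n) (h : (i + 1) % n = (k + 1) % n) :
    i = k :=
  Nat.ModEq.eq_of_lt_of_lt (Nat.ModEq.add_right_cancel' 1 h) hi hk

open scoped Classical in
/-- The representation of a band `w = w_n ⋯ w_1` with the scalar `c` placed on the letter with
index `l` (a direct letter): it has a basis `z_i` indexed by `i` modulo `n`; if `w_{i+1} = a` is an
arrow then `a z_i = z_{i+1}`, respectively `a z_i = c z_{i+1}` if `i = l`; if `w_{i+1}` is the
inverse of the arrow `a` then `a z_{i+1} = z_i`; all other products vanish. -/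
noncomputable def rep (hw : w.IsBand) (K : Type u) [Field K] (l : ℕ) (c : K) :
    MatrixRep Q K (Fin w.letters.length) where
  vert i := w.vertex i
  coef a i j :=
    if (j : ℕ) = (i + 1) % w.letters.length ∧ w.letters[(i : ℕ)]? = some (.direct a) then
      (if (i : ℕ) = l then c else 1)
    else if (i : ℕ) = (j + 1) % w.letters.length ∧ w.letters[(j : ℕ)]? = some (.inverse a) then 1
    else 0
  coef_start a i j h := by
    split_ifs at h with h1 _ h2
    · exact (w.src_getElem h1.2).symm
    · exact (w.src_getElem h1.2).symm
    · exact (hw.tgt_getElem j.2 h2.1 h2.2).symm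
    · exact absurd rfl h
  coef_end a i j h := by
    split_ifs at h with h1 _ h2
    · exact (hw.tgt_getElem i.2 h1.1 h1.2).symm
    · exact (hw.tgt_getElem i.2 h1.1 h1.2).symm
    · exact (w.src_getElem h2.2).symm
    · exact absurd rfl h
  coef_rel b a hba i j k := by
    rw [mul_eq_zero]
    by_contra! h
    have key : ∀ {d : E} {i j : Fin w.letters.length},
        (if (j : ℕ) = (i + 1) % w.letters.length ∧ w.letters[(i : ℕ)]? = some (.direct d) then
          (if (i : ℕ) = l then c else 1)
        else if (i : ℕ) = (j + 1) % w.letters.length ∧ w.letters[(j : ℕ)]? = some (.inverse d)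
        then (1 : K) else 0) ≠ 0 →
        ((j : ℕ) = (i + 1) % w.letters.length ∧ w.letters[(i : ℕ)]? = some (.direct d)) ∨
        ((i : ℕ) = (j + 1) % w.letters.length ∧ w.letters[(j : ℕ)]? = some (.inverse d)) := by
      intro d i j h
      by_contra! h'
      exact h (by rw [if_neg (by tauto), if_neg (by tauto)])
    obtain ⟨⟨h1, h2⟩ | ⟨h1, h2⟩, ⟨h3, h4⟩ | ⟨h3, h4⟩⟩ := And.intro (key h.1) (key h.2)
    · exact (hw.compatible_getElem i.2 h1 h2 h4).2 hba
    · have h5 : (k : ℕ) = i := succ_injective k.2 i.2 (by rw [← h3, ← h1])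
      rw [h5, h2] at h4
      simp at h4
    · rw [h2] at h4
      simp at h4
    · exact (hw.compatible_getElem k.2 h3 h4 h2).2 hba

/-- The band module `B(w, c)`, with the scalar placed on the letter with index `l`. -/
noncomputable def module (hw : w.IsBand) (K : Type u) [Field K] [Fintype V] (l : ℕ) (c : K) :
    ModuleCat.{u} (Q.BoundPathAlgebra K) := (hw.rep K l c).toModule

end IsBand

end GString

/-! ### Complexes of projective modules -/

noncomputable section

variable (Q : BoundQuiver V E) (K : Type u) [Field K] [Fintype V]

/-- The indecomposable projective module `P(x) = Λ e_x`. -/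
def proj (x : V) : Submodule (Q.BoundPathAlgebra K) (Q.BoundPathAlgebra K) :=
  Submodule.span _ {Q.idem K x}

variable {Q K}

/-- The map `P(x) → P(y)` given by right multiplication with the component `d e_y` of `d`. -/
def mulRight (x y : V) (d : Q.BoundPathAlgebra K) :
    Q.proj K x →ₗ[Q.BoundPathAlgebra K] Q.proj K y where
  toFun m := ⟨m * d * Q.idem K y,
    Submodule.smul_mem _ (m * d) (Submodule.mem_span_singleton_self _)⟩
  map_add' m m' := by ext; simp [add_mul]
  map_smul' c m := by ext; simp [mul_assoc]

variable (Q K) in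
/-- Data for a complex whose terms are direct sums of projectives `P(x)`: the summand with index
`i` is `P(vert i)` in cohomological degree `deg i`, and the component of the differential from the
summand `i` to the summand `j` is right multiplication with `coef i j`. -/
structure ProjSystem where
  ι : Type
  vert : ι → V
  deg : ι → ℤ
  coef : ι → ι → Q.BoundPathAlgebra K
  sq : ∀ i j k, coef i j * Q.idem K (vert j) * coef j k = 0

namespace ProjSystem

variable (S : ProjSystem Q K)

/-- The indices of the summands in degree `n`. -/
abbrev Idx (n : ℤ) : Type := {i : S.ι // S.deg i = n}

/-- The term of degree `n`. -/
abbrev Term (n : ℤ) : Type u := ⨁ i : S.Idx n, Q.proj K (S.vert i)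

open scoped Classical in
/-- The differential on the summand with index `i`. -/
def dOn (n : ℤ) (i : S.Idx n) :
    Q.proj K (S.vert i) →ₗ[Q.BoundPathAlgebra K] S.Term (n + 1) :=
  ∑ᶠ j : S.Idx (n + 1), DirectSum.lof (Q.BoundPathAlgebra K) _ (fun j : S.Idx (n + 1) =>
    Q.proj K (S.vert j)) j ∘ₗ mulRight _ _ (S.coef i j)

open scoped Classical in
/-- The differential. -/
def d (n : ℤ) : S.Term n →ₗ[Q.BoundPathAlgebra K] S.Term (n + 1) :=
  DirectSum.toModule _ _ _ (S.dOn n)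

theorem mulRight_comp (i j k : S.ι) :
    mulRight (S.vert j) (S.vert k) (S.coef j k) ∘ₗ
      mulRight (S.vert i) (S.vert j) (S.coef i j) = 0 := by
  ext m
  have h := S.sq i j k
  simp only [mulRight, LinearMap.comp_apply, LinearMap.coe_mk, AddHom.coe_mk,
    LinearMap.zero_apply, ZeroMemClass.coe_zero]
  calc (m : Q.BoundPathAlgebra K) * S.coef i j * Q.idem K (S.vert j) * S.coef j k *
        Q.idem K (S.vert k)
      = m * (S.coef i j * Q.idem K (S.vert j) * S.coef j k) * Q.idem K (S.vert k) := by
        simp only [mul_assoc]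
    _ = 0 := by rw [h, mul_zero, zero_mul]

theorem d_comp_d (n : ℤ) : S.d (n + 1) ∘ₗ S.d n = 0 := by
  classical
  refine DirectSum.linearMap_ext _ fun i => ?_
  have h1 : S.d n ∘ₗ DirectSum.lof _ _ (fun j : S.Idx n => Q.proj K (S.vert j)) i = S.dOn n i := by
    ext1 m
    exact DirectSum.toModule_lof _ _ _
  rw [LinearMap.comp_assoc, h1, LinearMap.zero_comp]
  refine finsum_induction (fun g => S.d (n + 1) ∘ₗ g = 0) (LinearMap.comp_zero _)
    (fun f g hf hg => by rw [LinearMap.comp_add, hf, hg, add_zero]) fun j => ?_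
  have h2 : S.d (n + 1) ∘ₗ DirectSum.lof _ _ (fun j : S.Idx (n + 1) => Q.proj K (S.vert j)) j =
      S.dOn (n + 1) j := by
    ext1 m
    exact DirectSum.toModule_lof _ _ _
  rw [← LinearMap.comp_assoc, h2]
  refine finsum_induction (fun g => g ∘ₗ mulRight (S.vert i) (S.vert j) (S.coef i j) = 0)
    (LinearMap.zero_comp _)
    (fun f g hf hg => by rw [LinearMap.add_comp, hf, hg, add_zero]) fun k => ?_
  rw [LinearMap.comp_assoc, mulRight_comp, LinearMap.comp_zero]

/-- The cochain complex of `Λ`-modules. -/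
def complex : CochainComplex (ModuleCat.{u} (Q.BoundPathAlgebra K)) ℤ :=
  CochainComplex.of (fun n => ModuleCat.of (Q.BoundPathAlgebra K) (S.Term n))
    (fun n => ModuleCat.ofHom (S.d n)) fun n => by
      rw [← ModuleCat.ofHom_comp, S.d_comp_d]
      rfl

end ProjSystem

/-- The complex `P` of `Λ`-modules, together with some map to `M`, is a projective resolution of
`M` by finitely generated projective modules, in cohomological grading. -/
structure IsProjectiveResolution (P : CochainComplex (ModuleCat.{u} (Q.BoundPathAlgebra K)) ℤ)
    (M : ModuleCat.{u} (Q.BoundPathAlgebra K)) : Prop where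
  projective : ∀ n, Projective (P.X n)
  finite : ∀ n, Module.Finite (Q.BoundPathAlgebra K) (P.X n)
  isZero : ∀ n, 0 < n → Limits.IsZero (P.X n)
  quasiIso : ∃ f : P ⟶ (HomologicalComplex.single _ (ComplexShape.up ℤ) 0).obj M, QuasiIso f

end

/-! ### Homotopy strings -/

/-- A possibly infinite sequence of letters, indexed by integers. `pos` is the set of positions of
its vertices and `letter i` is the letter from the position `i` to the position `i + 1`; positions
increase from right to left. The values of `vert` outside `pos` are irrelevant. -/
structure Word (Q : BoundQuiver V E) where
  pos : Set ℤ
  vert : ℤ → V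
  letter : ℤ → Option (Letter E)

namespace Word

variable {Q : BoundQuiver V E}

/-- The word with the given letters, and with vertex `x` at the position `0` if there is no letter
at this position. -/
def ofLetters (x : V) (letter : ℤ → Option (Letter E)) : Word Q where
  pos := {i | i = 0 ∨ (letter i).isSome ∨ (letter (i - 1)).isSome}
  vert i := match letter i with
    | some u => u.src Q
    | none => (letter (i - 1)).elim x (Letter.tgt Q)
  letter := letter

variable (σ : Word Q)

/-- `σ` is a (possibly infinite) walk. -/
structure IsWalk : Prop where
  nonempty : σ.pos.Nonempty
  ordConnected : σ.pos.OrdConnected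
  isSome_iff : ∀ i, (σ.letter i).isSome ↔ i ∈ σ.pos ∧ i + 1 ∈ σ.pos
  src_eq : ∀ i u, σ.letter i = some u → u.src Q = σ.vert i
  tgt_eq : ∀ i u, σ.letter i = some u → u.tgt Q = σ.vert (i + 1)
  adjacent : ∀ i u v, σ.letter i = some u → σ.letter (i + 1) = some v → Letter.Adjacent Q u v

/-- `σ` is a (possibly infinite) homotopy string: a walk which, if it is infinite to the left, is
eventually a direct antipath on the left and, if it is infinite to the right, is eventually an
inverse antipath on the right. -/
structure IsHomotopyString : Prop extends IsWalk σ where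
  left : ¬ BddAbove σ.pos → ∃ m, ∀ i, m ≤ i → ∃ a b, Q.rel b a ∧
    σ.letter i = some (.direct a) ∧ σ.letter (i + 1) = some (.direct b)
  right : ¬ BddBelow σ.pos → ∃ m, ∀ i, i ≤ m → ∃ a b, Q.rel b a ∧
    σ.letter i = some (.inverse a) ∧ σ.letter (i - 1) = some (.inverse b)

/-- The decomposition of `σ` into homotopy letters breaks at the position `i`. -/
def IsBreak (i : ℤ) : Prop :=
  i ∈ σ.pos ∧ ∀ u v, σ.letter (i - 1) = some u → σ.letter i = some v → ¬ Letter.Straight Q u v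

/-- The subwalk between the positions `i < j` is a homotopy letter. -/
def IsHomotopyLetter (i j : ℤ) : Prop :=
  i < j ∧ σ.IsBreak i ∧ σ.IsBreak j ∧ ∀ k, i < k → k < j → ¬ σ.IsBreak k

/-- The subwalk between the positions `i < j` is a direct homotopy letter. -/
def IsDirectLetter (i j : ℤ) : Prop :=
  σ.IsHomotopyLetter i j ∧ ∀ k, i ≤ k → k < j → ∃ a, σ.letter k = some (.direct a)

/-- The subwalk between the positions `i < j` is an inverse homotopy letter. -/
def IsInverseLetter (i j : ℤ) : Prop :=
  σ.IsHomotopyLetter i j ∧ ∀ k, i ≤ k → k < j → ∃ a, σ.letter k = some (.inverse a)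

open scoped Classical in
/-- The change of the degree at the letter from position `i` to `i + 1`: passing a direct
homotopy letter from right to left lowers the degree by one, passing an inverse one raises it by
one. (The step is counted at the right end of the homotopy letter.) -/
noncomputable def step (i : ℤ) : ℤ :=
  if σ.IsBreak i then (σ.letter i).elim 0 fun u => if u.isDirect then -1 else 1 else 0

/-- The cohomological degree of the position `i`, if the position `p` is placed in degree `0`
(meaningful if `p` and `i` are breaks). -/
noncomputable def degree (p i : ℤ) : ℤ :=
  ∑ k ∈ Finset.Ico p i, σ.step k - ∑ k ∈ Finset.Ico i p, σ.step k

/-- The position `p` is a peak: no homotopy letter that ends at `p` points away from `p`, that is,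
the summand at this position is not the source of a component of the differential. -/
def IsPeak (p : ℤ) : Prop :=
  p ∈ σ.pos ∧ (∀ u, σ.letter p = some u → u.isDirect) ∧
    ∀ u, σ.letter (p - 1) = some u → u.isDirect = false

noncomputable section

variable (K : Type u) [Field K] [Fintype V]

/-- The element of `Λ` given by the arrow underlying the letter at position `i`. -/
def arrowAt (i : ℤ) : Q.BoundPathAlgebra K := (σ.letter i).elim 0 fun u => Q.arrow K u.arrow

/-- The path formed by the `n` letters to the left of the position `i`, if they are direct. -/
def directPath (i : ℤ) : ℕ → Q.BoundPathAlgebra K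
  | 0 => Q.idem K (σ.vert i)
  | n + 1 => σ.arrowAt K (i + n) * directPath i n

/-- The inverse of the walk formed by the `n` letters to the left of the position `i`, if they are
inverse; this is a path which ends at the position `i`. -/
def inversePath (i : ℤ) : ℕ → Q.BoundPathAlgebra K
  | 0 => Q.idem K (σ.vert i)
  | n + 1 => inversePath i n * σ.arrowAt K (i + n)

open scoped Classical in
/-- The component from the position `i` to the position `j` of the differential of the string
complex: a homotopy letter between `i` and `j` which, up to inversion, is a path `p` from (the
vertex at) `j` to `i`, gives the map `P(vert i) → P(vert j)`, `m ↦ m p`. -/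
def component (i j : ℤ) : Q.BoundPathAlgebra K :=
  if σ.IsDirectLetter j i then σ.directPath K j (i - j).toNat
  else if σ.IsInverseLetter i j then σ.inversePath K i (j - i).toNat
  else 0

variable {K}

theorem directPath_succ (i : ℤ) (n : ℕ) : ∃ x, σ.directPath K i (n + 1) =
    x * σ.arrowAt K i * Q.idem K (σ.vert i) := by
  induction n with
  | zero => exact ⟨1, by simp [directPath]⟩
  | succ n ih =>
    obtain ⟨x, hx⟩ := ih
    exact ⟨σ.arrowAt K (i + (n + 1 : ℕ)) * x, by rw [directPath, hx]; simp only [mul_assoc]⟩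

theorem inversePath_succ (i : ℤ) (n : ℕ) : ∃ x, σ.inversePath K i (n + 1) =
    Q.idem K (σ.vert i) * σ.arrowAt K i * x := by
  induction n with
  | zero => exact ⟨1, by simp [inversePath]⟩
  | succ n ih =>
    obtain ⟨x, hx⟩ := ih
    exact ⟨x * σ.arrowAt K (i + (n + 1 : ℕ)), by rw [inversePath, hx]; simp only [mul_assoc]⟩

theorem arrow_idem_arrow {a b : E} (h : Q.arrow K b * Q.arrow K a = 0) (x y : V) :
    Q.arrow K b * Q.idem K x * Q.idem K y * Q.arrow K a = 0 := by
  classical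
  rw [arrow_mul_idem]
  split_ifs
  · rw [arrow_mul_idem]
    split_ifs
    · exact h
    · exact zero_mul _
  · rw [zero_mul, zero_mul]

theorem arrow_mul_of_not_straight {a b : E} (h : ¬ (Q.s b = Q.t a ∧ ¬ Q.rel b a)) :
    Q.arrow K b * Q.arrow K a = 0 := by
  by_cases h' : Q.rel b a
  · exact arrow_mul_arrow_of_rel K h'
  · exact arrow_mul_arrow_of_ne K fun h'' => h ⟨h'', h'⟩

/-- Consecutive components of the differential compose to zero. The two positions `j` and `j'`
will be equal, or equal modulo the length of a band. -/
theorem component_mul_component {i j j' k : ℤ} (h : σ.letter j = σ.letter j')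
    (h' : σ.letter (j - 1) = σ.letter (j' - 1)) (x : V) :
    σ.component K i j * Q.idem K x * σ.component K j' k = 0 := by
  unfold component
  split_ifs with h1 h2 h3 h4 h5
  · -- two direct homotopy letters
    obtain ⟨⟨hji, _, hb, _⟩, hd⟩ := h1
    obtain ⟨⟨hkj, hb', _, _⟩, hd'⟩ := h2
    obtain ⟨b, hlb⟩ := hd j le_rfl hji
    obtain ⟨a, hla⟩ := hd' (j' - 1) (by omega) (by omega)
    have hns := ‹σ.IsBreak j›.2 _ _ (h'.trans hla) hlb
    obtain ⟨n, hn⟩ : ∃ n : ℕ, (i - j).toNat = n + 1 := ⟨(i - j).toNat - 1, by omega⟩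
    obtain ⟨m, hm⟩ : ∃ m : ℕ, (j' - k).toNat = m + 1 := ⟨(j' - k).toNat - 1, by omega⟩
    obtain ⟨y, hy⟩ := σ.directPath_succ (K := K) j n
    have hkm : k + (m : ℤ) = j' - 1 := by omega
    rw [hn, hm, hy, directPath, hkm, arrowAt, arrowAt, hlb, hla]
    have hz := arrow_idem_arrow (K := K) (arrow_mul_of_not_straight hns) (σ.vert j) x
    calc _ = y * (Q.arrow K b * Q.idem K (σ.vert j) * Q.idem K x * Q.arrow K a) *
        σ.directPath K k m := by simp only [mul_assoc]; rfl
      _ = 0 := by rw [hz, mul_zero, zero_mul]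
  · obtain ⟨⟨hji, _, _, _⟩, hd⟩ := h1
    obtain ⟨⟨hkj, _, _, _⟩, hd'⟩ := h3
    obtain ⟨b, hlb⟩ := hd j le_rfl hji
    obtain ⟨a, hla⟩ := hd' j' le_rfl hkj
    rw [h, hla] at hlb
    simp at hlb
  · exact mul_zero _
  · obtain ⟨⟨hij, _, _, _⟩, hd⟩ := h4
    obtain ⟨⟨hkj, _, _, _⟩, hd'⟩ := h5
    obtain ⟨b, hlb⟩ := hd (j - 1) (by omega) (by omega)
    obtain ⟨a, hla⟩ := hd' (j' - 1) (by omega) (by omega)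
    rw [h', hla] at hlb
    simp at hlb
  · -- two inverse homotopy letters
    rename_i h6
    obtain ⟨⟨hij, _, hb, _⟩, hd⟩ := h4
    obtain ⟨⟨hjk, _, _, _⟩, hd'⟩ := h6
    obtain ⟨a, hla⟩ := hd (j - 1) (by omega) (by omega)
    obtain ⟨b, hlb⟩ := hd' j' le_rfl hjk
    have hns := hb.2 _ _ hla (h.trans hlb)
    obtain ⟨n, hn⟩ : ∃ n : ℕ, (j - i).toNat = n + 1 := ⟨(j - i).toNat - 1, by omega⟩
    obtain ⟨m, hm⟩ : ∃ m : ℕ, (k - j').toNat = m + 1 := ⟨(k - j').toNat - 1, by omega⟩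
    obtain ⟨y, hy⟩ := σ.inversePath_succ (K := K) j' m
    have hin : i + (n : ℤ) = j - 1 := by omega
    rw [hn, hm, hy, inversePath, hin, arrowAt, arrowAt, hlb, hla]
    have hz := arrow_idem_arrow (K := K) (arrow_mul_of_not_straight hns) x (σ.vert j')
    calc _ = σ.inversePath K i n *
        (Q.arrow K a * Q.idem K x * Q.idem K (σ.vert j') * Q.arrow K b) * y := by
          simp only [mul_assoc]; rfl
      _ = 0 := by rw [hz, mul_zero, zero_mul]
  · exact mul_zero _
  · rw [zero_mul, zero_mul]
  · rw [zero_mul, zero_mul]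
  · rw [zero_mul, zero_mul]

variable (K)

/-- The string complex `P_σ`, with the position `p` placed in degree `0`: its summands are the
projectives at the ends of the homotopy letters, the homotopy letters are the components of the
differential. -/
def stringComplex (p : ℤ) : CochainComplex (ModuleCat.{u} (Q.BoundPathAlgebra K)) ℤ :=
  ProjSystem.complex
    { ι := {i : ℤ // σ.IsBreak i}
      vert := fun i => σ.vert i
      deg := fun i => σ.degree p i
      coef := fun i j => σ.component K i j
      sq := fun _ _ _ => σ.component_mul_component rfl rfl _ }

end

end Word

/-! ### The homotopy string of a projective resolution -/

section Pi

variable (Q : BoundQuiver V E)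

open scoped Classical in
/-- The arrow `b` for which `b a` is a relation, if there is one. -/
noncomputable def nextRel (a : E) : Option E :=
  if h : ∃ b, Q.rel b a then some h.choose else none

/-- The arrows of the maximal direct antipath starting with the given arrow; the empty antipath,
if there is no arrow given. -/
noncomputable def antipath (o : Option E) : ℕ → Option E
  | 0 => o
  | n + 1 => (antipath o n).bind Q.nextRel

variable {Q}

namespace GString

variable (w : Q.GString)

/-- `b w c⁻¹` is defined as a string, where the letters `b` and `c⁻¹` may be absent. -/
def Extends (β γ : Option E) : Prop :=
  ((γ.map Letter.inverse).toList ++ w.letters ++ (β.map Letter.direct).toList).IsChain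
    (Letter.Compatible Q) ∧
  (∀ b ∈ β, Q.s b = w.vertex w.letters.length) ∧ ∀ c ∈ γ, Q.s c = w.start

/-- `b w c⁻¹` is defined as a string and none of the absent ones among the letters `b`, `c⁻¹` can be
added. -/
def IsMaximalExtension (β γ : Option E) : Prop :=
  w.Extends β γ ∧ (β = none → ∀ b, ¬ w.Extends (some b) γ) ∧
    (γ = none → ∀ c, ¬ w.Extends β (some c))

/-- The letters of `w` after removing the maximal inverse prefix, if `γ` is absent. -/
def trimRight (γ : Option E) : List (Letter E) :=
  if γ.isNone then w.letters.dropWhile fun u => !u.isDirect else w.letters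

/-- The letters of the module part `w'`: the maximal inverse prefix of `w` is removed if `γ` is
absent, the maximal direct suffix is removed if `β` is absent. -/
def modulePart (β γ : Option E) : List (Letter E) :=
  if β.isNone then (w.trimRight γ).rdropWhile Letter.isDirect else w.trimRight γ

/-- The start vertex of the module part. -/
def modulePartStart (γ : Option E) : V :=
  w.vertex (w.letters.length - (w.trimRight γ).length)

/-- The homotopy string `π(w) = dir(b) w' inv(c⁻¹)`. The module part `w'` starts at the position
`0`; the inverse antipath `inv(c⁻¹)` to its right is the inverse of `dir(c)`. -/
noncomputable def homotopyString (β γ : Option E) : Word Q :=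
  Word.ofLetters (w.modulePartStart γ) fun i =>
    if i < 0 then (Q.antipath γ (-1 - i).toNat).map Letter.inverse
    else if i < (w.modulePart β γ).length then (w.modulePart β γ)[i.toNat]?
    else (Q.antipath β (i - (w.modulePart β γ).length).toNat).map Letter.direct

end GString

end Pi

/-! ### Homotopy bands -/

namespace Word

variable {Q : BoundQuiver V E}

/-- The periodic two-sided infinite word `⋯ l l l ⋯`; the first period starts at the position `0`.
(The vertex `x` is only used if `l` is empty.) -/
def periodic (Q : BoundQuiver V E) (x : V) (l : List (Letter E)) : Word Q where
  pos := Set.univ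
  vert i := (l[(i % l.length).toNat]?).elim x (Letter.src Q)
  letter i := l[(i % l.length).toNat]?

/-- The number of direct homotopy letters of the closed walk `l`, read cyclically. -/
noncomputable def numDirect (Q : BoundQuiver V E) (x : V) (l : List (Letter E)) : ℕ :=
  {i : ℤ | 0 ≤ i ∧ i < l.length ∧ (periodic Q x l).IsBreak i ∧
    ∃ a, (periodic Q x l).letter i = some (.direct a)}.ncard

/-- The number of inverse homotopy letters of the closed walk `l`, read cyclically. -/
noncomputable def numInverse (Q : BoundQuiver V E) (x : V) (l : List (Letter E)) : ℕ :=
  {i : ℤ | 0 ≤ i ∧ i < l.length ∧ (periodic Q x l).IsBreak i ∧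
    ∃ a, (periodic Q x l).letter i = some (.inverse a)}.ncard

/-- `l` is (up to rotation) a homotopy band: a closed walk which is not a proper power, with equal
numbers of direct and inverse homotopy letters. -/
structure IsHomotopyBand (Q : BoundQuiver V E) (x : V) (l : List (Letter E)) : Prop where
  ne_nil : l ≠ []
  closed : (l ++ l).IsChain (Letter.Adjacent Q)
  primitive : ∀ (v : List (Letter E)) (m : ℕ), 1 < m → l ≠ (List.replicate m v).flatten
  balanced : numDirect Q x l = numInverse Q x l

open scoped Classical in
/-- The scalar on the homotopy letter between the positions `i` and `j` of the periodic word with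
period `n`: it is `c` if this homotopy letter contains a translate of the letter with index `k`, and
one otherwise. -/
noncomputable def bandScalar {K : Type u} [Field K] (n k : ℕ) (c : K) (i j : ℤ) : K :=
  if ∃ m : ℤ, min i j ≤ m ∧ m < max i j ∧ m ≡ k [ZMOD n] then c else 1

/-- The band complex of the closed walk `l`, with the scalar `c` placed on the homotopy letter
that contains the letter with index `k`, and with the position `p` placed in degree `0`. It is
obtained from the periodic word `⋯ l l l ⋯` by identifying positions modulo the length of `l`. -/
noncomputable def bandComplex (Q : BoundQuiver V E) (K : Type u) [Field K] [Fintype V] (x : V)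
    (l : List (Letter E)) (k : ℕ) (c : K) (p : ℤ) :
    CochainComplex (ModuleCat.{u} (Q.BoundPathAlgebra K)) ℤ :=
  ProjSystem.complex
    { ι := {i : ℤ // 0 ≤ i ∧ i < l.length ∧ (periodic Q x l).IsBreak i}
      vert := fun i => (periodic Q x l).vert i
      deg := fun i => (periodic Q x l).degree p i
      coef := fun i j => ∑ᶠ m : ℤ, bandScalar l.length k c i (j + m * l.length) •
        (periodic Q x l).component K i (j + m * l.length)
      sq := fun i j j' => by
        refine finsum_induction (fun z => z * _ * _ = 0) (by rw [zero_mul, zero_mul])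
          (fun y z hy hz => by rw [add_mul, add_mul, hy, hz, add_zero]) fun m => ?_
        refine finsum_induction (fun z => _ * z = 0) (mul_zero _)
          (fun y z hy hz => by rw [mul_add, hy, hz, add_zero]) fun m' => ?_
        rw [smul_mul_assoc, smul_mul_assoc, mul_smul_comm, component_mul_component, smul_zero,
          smul_zero]
        · simp [periodic]
        · have h : ((j : ℤ) + m * l.length - 1) % l.length = ((j : ℤ) - 1) % l.length := by
            rw [show (j : ℤ) + m * l.length - 1 = ((j : ℤ) - 1) + m * l.length by ring]
            exact Int.add_mul_emod_self_right _ _ _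
          simp only [periodic, h] }

end Word

end BoundQuiver

open BoundQuiver

/-!
The classes of the paths without relations form a basis of a gentle algebra `Λ` (`coords_injective`).
Since at most one arrow prolongs a given arrow `a` by a relation, this basis shows that the left
annihilator of `a` is generated by the arrow `b` with `b a ∈ I`, if there is one, and is zero
otherwise (`exists_of_mul_arrow_eq_zero`); moreover, left ideals generated by different arrows
intersect trivially (`mul_arrow_eq_zero_of_sum`, `mul_arrow_eq_mul_arrow`).

In the complex of a walk at most two homotopy letters start at every summand, one to either side
(`ProjSystem.Outgoing`), and different homotopy letters that arrive at the same summand do so with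
different arrows. A cycle is therefore annihilated, summand by summand, by the last arrow of every
homotopy letter starting there. If two letters start at a summand, then the coefficient of the cycle
lies in two left ideals `Λ b` and `Λ b'` with `b ≠ b'`, so it vanishes; if only one letter starts
there, then the summand lies on an antipath and the coefficient is zero or a multiple of the next arrow
of the antipath, so it comes from a boundary (`ProjSystem.Outgoing.exact_of_isExact`). For `π(w)`, the degree of a position is `0` or `-1`
on the part coming from `w`, according to whether a direct letter precedes it, and it drops by one
with every step along the two antipaths (`GString.IsTrim.degree_eq`); for a band only the first kind
of position occurs (`GString.IsBand.degree_eq`). In particular, this gives exactness in negative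
degrees.

In degree `0` it remains to see that the generators of the summands of degree `0` and the relations
given by the summands of degree `-1` present the module
(`ProjSystem.Outgoing.isProjectiveResolution`). Modules given by matrices are presented by their basis
vectors and the action of the arrows on them (`MatrixRep.exists_linearMap`). The summands of degree
`0` are at the peaks of `w`, and vectors at the peaks spread along the walk by acting with its letters
(`Word.exists_family`). A relation at a position where a direct letter is followed by an inverse one
says that the vectors reached from the two sides agree, up to the sign which is given by the
differential; the relation at the first summand of an antipath says that the arrow `b` annihilates the
vector at the end of `w`. The other arrows act by zero: at a position between two letters an arrow is
one of these letters or it is annihilated by one of them, as `Λ` is gentle, and at the ends of `w` this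
follows from the maximality of `b w a` (`GString.IsMaximalExtension.arrow_cases`).

The signs are absorbed by rescaling the generators, with a change of sign at every inverse homotopy
letter (`GString.exists_signs`). Along a band this must be consistent after one period, in which the
sign changes `r` times, because there are as many inverse as direct homotopy letters; this accounts
for the factor `(-1)^r` in the scalar of the band complex, while the inverse of `λ` arises because the
arrow with the scalar `λ` occurs in the path of its homotopy letter
(`GString.IsBand.exists_weights`).
-/

namespace BoundQuiver

/-! ### A basis of the bound path algebra -/

section Basis

noncomputable section

variable {V E : Type u} (Q : BoundQuiver V E)

/-- The paths without a relation as a subpath. Their classes form a basis of `Λ`. -/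
abbrev NonzeroPath : Type u := {p : Q.Path // p.arrows.IsChain fun a b => ¬ Q.rel b a}

variable (K : Type u) [Field K]

open scoped Classical in
/-- The path that starts at `x` and traverses the arrows in `l`, as a basis vector; zero, if this is
not a path or if it contains a relation. -/
def pathVec (x : V) (l : List E) : Q.NonzeroPath →₀ K :=
  if h : Q.IsPathFrom x l ∧ l.IsChain fun a b => ¬ Q.rel b a then
    Finsupp.single ⟨⟨x, l, h.1⟩, h.2⟩ 1 else 0

variable {Q}

theorem pathVec_of_nonzero (p : Q.NonzeroPath) :
    Q.pathVec K p.1.start p.1.arrows = Finsupp.single p 1 := dif_pos ⟨p.1.isPath, p.2⟩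

/-- The operator on the span of the nonzero paths by which an arrow acts from the left. -/
def arrowOp (a : E) : Module.End K (Q.NonzeroPath →₀ K) :=
  Finsupp.linearCombination K fun p => Q.pathVec K p.1.start (p.1.arrows ++ [a])

open scoped Classical in
/-- The projection of the span of the nonzero paths onto the span of those ending at `x`. -/
def vertexOp (x : V) : Module.End K (Q.NonzeroPath →₀ K) :=
  Finsupp.linearCombination K fun p => if p.1.finish = x then Finsupp.single p 1 else 0

theorem arrowOp_pathVec (a : E) (x : V) (l : List E) :
    arrowOp K a (Q.pathVec K x l) = Q.pathVec K x (l ++ [a]) := by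
  by_cases h : Q.IsPathFrom x l ∧ l.IsChain fun a b => ¬ Q.rel b a
  · rw [pathVec, dif_pos h, arrowOp, Finsupp.linearCombination_single, one_smul]
  · rw [pathVec, dif_neg h, map_zero, pathVec, dif_neg]
    intro h'
    exact h ⟨(Q.isPathFrom_append.1 h'.1).1, h'.2.left_of_append⟩

open scoped Classical in
theorem vertexOp_pathVec (x y : V) (l : List E) :
    vertexOp K y (Q.pathVec K x l) = if Q.endVertex x l = y then Q.pathVec K x l else 0 := by
  by_cases h : Q.IsPathFrom x l ∧ l.IsChain fun a b => ¬ Q.rel b a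
  · rw [pathVec, dif_pos h, vertexOp, Finsupp.linearCombination_single, one_smul]
    rfl
  · rw [pathVec, dif_neg h, map_zero, ite_self]

theorem linearMap_ext_pathVec {M : Type*} [AddCommGroup M] [Module K M]
    {f g : (Q.NonzeroPath →₀ K) →ₗ[K] M}
    (h : ∀ x l, f (Q.pathVec K x l) = g (Q.pathVec K x l)) : f = g := by
  refine Finsupp.lhom_ext' fun p => LinearMap.ext_ring ?_
  have := h p.1.start p.1.arrows
  rwa [pathVec_of_nonzero] at this

theorem pathVec_eq_zero_of_not {x : V} {l : List E}
    (h : ¬ (Q.IsPathFrom x l ∧ l.IsChain fun a b => ¬ Q.rel b a)) : Q.pathVec K x l = 0 :=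
  dif_neg h

theorem pathVec_apply_of_ne {x : V} {l : List E} {p : Q.NonzeroPath} (h : p.1.arrows ≠ l) :
    Q.pathVec K x l p = 0 := by
  rw [pathVec]
  split_ifs with h'
  · rw [Finsupp.single_apply_eq_zero]
    intro h''
    exact absurd (congrArg (fun p : Q.NonzeroPath => p.1.arrows) h'') h
  · rfl

variable [Fintype V]

variable (Q) in
/-- The left regular representation of `Λ`, in terms of nonzero paths. -/
def regularSystem : RelSystem Q (Module.End K (Q.NonzeroPath →₀ K)) where
  e := vertexOp K
  f := arrowOp K
  e_mul_self x := linearMap_ext_pathVec K fun y l => by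
    rw [Module.End.mul_apply, vertexOp_pathVec]
    split_ifs with h
    · rw [vertexOp_pathVec, if_pos h]
    · rw [map_zero]
  e_mul_ne x y hxy := linearMap_ext_pathVec K fun z l => by
    rw [Module.End.mul_apply, vertexOp_pathVec, LinearMap.zero_apply]
    split_ifs with h
    · rw [vertexOp_pathVec, if_neg (by rw [h]; exact hxy.symm)]
    · rw [map_zero]
  sum_e := linearMap_ext_pathVec K fun y l => by
    classical
    rw [LinearMap.sum_apply]
    simp [vertexOp_pathVec]
  e_mul_f a := linearMap_ext_pathVec K fun y l => by
    rw [Module.End.mul_apply, arrowOp_pathVec, vertexOp_pathVec, if_pos]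
    rw [endVertex_append]
    rfl
  f_mul_e a := linearMap_ext_pathVec K fun y l => by
    rw [Module.End.mul_apply, vertexOp_pathVec]
    split_ifs with h
    · rfl
    · rw [map_zero, arrowOp_pathVec, pathVec_eq_zero_of_not]
      intro h'
      exact h (Q.isPathFrom_append.1 h'.1).2.1.symm
  rel b a hba := linearMap_ext_pathVec K fun y l => by
    rw [Module.End.mul_apply, arrowOp_pathVec, arrowOp_pathVec, LinearMap.zero_apply,
      pathVec_eq_zero_of_not]
    rintro ⟨-, h⟩
    rw [List.append_assoc] at h
    have h' := h.right_of_append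
    simp only [List.cons_append, List.nil_append, List.isChain_cons_cons] at h'
    exact h'.1 hba

theorem regularSystem_value (m : List E) : ∀ (x y : V) (l : List E), Q.endVertex x l = y →
    (regularSystem Q K).value y m (Q.pathVec K x l) = Q.pathVec K x (l ++ m) := by
  induction m with
  | nil =>
    intro x y l h
    rw [List.append_nil]
    exact (vertexOp_pathVec K x y l).trans (if_pos h)
  | cons a m ih =>
    intro x y l _
    rw [RelSystem.value, Module.End.mul_apply]
    change (regularSystem Q K).value (Q.t a) m (arrowOp K a _) = _
    rw [arrowOp_pathVec, ih _ _ _ (by rw [endVertex_append]; rfl), List.append_assoc]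
    rfl

variable {K}

theorem toBound_surjective : Function.Surjective (Q.toBound K) :=
  (Q.relIdeal K).ringCon.mk'_surjective

theorem toBound_smul (c : K) (y : PathAlgebra K Q) : Q.toBound K (c • y) = c • Q.toBound K y :=
  rfl

theorem RelSystem.toHom_toBound {A : Type*} [Ring A] [Algebra K A] (S : RelSystem Q A)
    (y : PathAlgebra K Q) : S.toHom K (Q.toBound K y) = S.liftLin K y := rfl

theorem RelSystem.toHom_smul {A : Type*} [Ring A] [Algebra K A] (S : RelSystem Q A)
    (c : K) (r : Q.BoundPathAlgebra K) : S.toHom K (c • r) = c • S.toHom K r := by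
  obtain ⟨y, rfl⟩ := toBound_surjective r
  rw [← toBound_smul, S.toHom_toBound, map_smul, S.toHom_toBound]

variable (Q K) in
/-- The class of a path in `Λ`. -/
def pathClass (p : Q.Path) : Q.BoundPathAlgebra K := Q.toBound K (ofPath K p)

@[elab_as_elim]
theorem boundPathAlgebra_induction {P : Q.BoundPathAlgebra K → Prop} (r : Q.BoundPathAlgebra K)
    (h0 : P 0) (hadd : ∀ x y, P x → P y → P (x + y))
    (hs : ∀ (c : K) (p : Q.Path), P (c • pathClass Q K p)) : P r := by
  obtain ⟨y, rfl⟩ := toBound_surjective r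
  induction y using pathAlgebra_induction with
  | h0 => rwa [map_zero]
  | hadd x y hx hy => rw [map_add]; exact hadd _ _ hx hy
  | hs c p => exact hs c p

theorem pathClass_cons (x : V) (a : E) (l : List E) (h : Q.IsPathFrom x (a :: l)) :
    pathClass Q K ⟨x, a :: l, h⟩ = pathClass Q K ⟨Q.t a, l, h.2⟩ * Q.arrow K a := by
  obtain ⟨rfl, h⟩ := h
  rw [pathClass, pathClass, arrow, ← map_mul, ofPath_mul_of_eq K (p := Q.arrowPath a) rfl]
  rfl

theorem pathClass_mul_arrow_of_ne (p : Q.Path) (a : E) (h : Q.t a ≠ p.start) :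
    pathClass Q K p * Q.arrow K a = 0 := by
  rw [pathClass, arrow, ← map_mul, ofPath_mul_of_ne K (p := Q.arrowPath a) h, map_zero]

open scoped Classical in
theorem pathClass_mul_idem (p : Q.Path) (x : V) :
    pathClass Q K p * Q.idem K x = if x = p.start then pathClass Q K p else 0 := by
  rw [pathClass, idem, ← map_mul, mul_trivialPath]
  split_ifs
  · rfl
  · exact map_zero _

theorem idem_mul_idem_of_ne {x y : V} (h : x ≠ y) : Q.idem K x * Q.idem K y = 0 := by
  rw [idem, idem, ← map_mul, ofPath_mul_of_ne K, map_zero]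
  exact fun h' => h h'.symm

theorem idem_mul_arrow (a : E) : Q.idem K (Q.t a) * Q.arrow K a = Q.arrow K a := by
  classical
  rw [idem, arrow, ← map_mul, trivialPath_mul]
  exact congrArg _ (if_pos rfl)

theorem arrow_mul_idem_self (a : E) : Q.arrow K a * Q.idem K (Q.s a) = Q.arrow K a := by
  classical
  rw [arrow_mul_idem, if_pos rfl]

theorem pathClass_eq_zero : ∀ (l : List E) (x : V) (h : Q.IsPathFrom x l),
    ¬ (l.IsChain fun a b => ¬ Q.rel b a) → pathClass Q K ⟨x, l, h⟩ = 0
  | [], _, _, hn => absurd .nil hn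
  | [a], _, _, hn => absurd (.singleton a) hn
  | a :: b :: l, x, h, hn => by
    rw [pathClass_cons]
    by_cases hba : Q.rel b a
    · rw [pathClass_cons, mul_assoc, arrow_mul_arrow_of_rel K hba, mul_zero]
    · rw [pathClass_eq_zero, zero_mul]
      intro h'
      exact hn (List.isChain_cons_cons.2 ⟨hba, h'⟩)

variable (Q K) in
/-- The coordinates of an element of `Λ` with respect to the basis of nonzero paths. -/
def coords : Q.BoundPathAlgebra K →ₗ[K] (Q.NonzeroPath →₀ K) where
  toFun r := (regularSystem Q K).toHom K r (∑ x, Q.pathVec K x [])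
  map_add' r r' := by rw [map_add]; rfl
  map_smul' c r := by rw [RelSystem.toHom_smul]; rfl

theorem coords_pathClass (p : Q.Path) :
    coords Q K (pathClass Q K p) = Q.pathVec K p.start p.arrows := by
  classical
  change (regularSystem Q K).liftLin K (ofPath K p) (∑ x, Q.pathVec K x []) = _
  rw [RelSystem.liftLin_ofPath, ← RelSystem.value_mul_e _ _ _ p.isPath, Module.End.mul_apply]
  have h : (regularSystem Q K).e p.start (∑ x, Q.pathVec K x []) = Q.pathVec K p.start [] := by
    change vertexOp K p.start _ = _
    rw [map_sum, Finset.sum_eq_single p.start]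
    · exact (vertexOp_pathVec K _ _ _).trans (if_pos rfl)
    · exact fun x _ hx => (vertexOp_pathVec K _ _ _).trans (if_neg hx)
    · exact fun h => absurd (Finset.mem_univ _) h
  rw [h]
  exact regularSystem_value K p.arrows p.start p.start [] rfl

theorem sum_coords (r : Q.BoundPathAlgebra K) :
    Finsupp.linearCombination K (fun p : Q.NonzeroPath => pathClass Q K p.1) (coords Q K r) = r := by
  induction r using boundPathAlgebra_induction with
  | h0 => rw [map_zero, map_zero]
  | hadd x y hx hy => rw [map_add, map_add, hx, hy]
  | hs c p =>
    rw [map_smul, map_smul, coords_pathClass]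
    by_cases h : p.arrows.IsChain fun a b => ¬ Q.rel b a
    · rw [pathVec, dif_pos ⟨p.isPath, h⟩, Finsupp.linearCombination_single, one_smul]
    · rw [pathVec_eq_zero_of_not K fun h' => h h'.2, map_zero, pathClass_eq_zero _ _ p.isPath h]

theorem coords_injective : Function.Injective (coords Q K) :=
  Function.LeftInverse.injective sum_coords

/-- The relation ideal contains only paths that contain a relation, so the other paths are nonzero
in `Λ`. -/
theorem isChain_of_mem_relIdeal {p : Q.Path} (hp : ofPath K p ∈ Q.relIdeal K) :
    ¬ p.arrows.IsChain fun a b => ¬ Q.rel b a := by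
  intro h
  have h0 : pathClass Q K p = 0 := by
    rw [pathClass, ← map_zero (Q.toBound K)]
    exact Quotient.sound' hp
  have h1 := coords_pathClass (K := K) p
  rw [h0, map_zero, pathVec, dif_pos ⟨p.isPath, h⟩] at h1
  exact one_ne_zero (Finsupp.single_eq_zero.1 h1.symm)

theorem coords_mul_arrow_of_ne (r : Q.BoundPathAlgebra K) (a : E) (p : Q.NonzeroPath)
    (h : p.1.arrows.head? ≠ some a) : coords Q K (r * Q.arrow K a) p = 0 := by
  induction r using boundPathAlgebra_induction with
  | h0 => rw [zero_mul, map_zero]; rfl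
  | hadd x y hx hy => rw [add_mul, map_add, Finsupp.add_apply, hx, hy, add_zero]
  | hs c q =>
    rw [smul_mul_assoc, map_smul, Finsupp.smul_apply]
    by_cases hq : Q.t a = q.start
    · obtain ⟨x, l, hl⟩ := q
      subst hq
      rw [← pathClass_cons (Q.s a) a l ⟨rfl, hl⟩, coords_pathClass, pathVec_apply_of_ne K,
        smul_zero]
      rintro h'
      rw [h'] at h
      exact h rfl
    · rw [pathClass_mul_arrow_of_ne q a hq, map_zero, Finsupp.zero_apply, smul_zero]

theorem coords_mul_arrow (r : Q.BoundPathAlgebra K) (a : E) (l : List E)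
    (h : Q.IsPathFrom (Q.t a) l) (hl : (a :: l).IsChain fun a b => ¬ Q.rel b a) :
    coords Q K (r * Q.arrow K a) ⟨⟨Q.s a, a :: l, ⟨rfl, h⟩⟩, hl⟩ =
      coords Q K r ⟨⟨Q.t a, l, h⟩, hl.tail⟩ := by
  induction r using boundPathAlgebra_induction with
  | h0 => rw [zero_mul, map_zero]; rfl
  | hadd x y hx hy => rw [add_mul, map_add, map_add, Finsupp.add_apply, hx, hy]; rfl
  | hs c q =>
    rw [smul_mul_assoc, map_smul, map_smul, Finsupp.smul_apply, Finsupp.smul_apply]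
    congr 1
    by_cases hq : Q.t a = q.start
    · obtain ⟨x, m, hm⟩ := q
      subst hq
      rw [← pathClass_cons (Q.s a) a m ⟨rfl, hm⟩, coords_pathClass, coords_pathClass]
      by_cases hml : l = m
      · subst hml
        rw [pathVec, dif_pos ⟨⟨rfl, h⟩, hl⟩, pathVec, dif_pos ⟨h, hl.tail⟩,
          Finsupp.single_eq_same, Finsupp.single_eq_same]
      · rw [pathVec_apply_of_ne K (l := m) hml, pathVec_apply_of_ne K]
        intro h'
        exact hml (List.cons.inj h').2
    · rw [pathClass_mul_arrow_of_ne q a hq, map_zero, Finsupp.zero_apply, coords_pathClass, pathVec]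
      split_ifs with h'
      · rw [eq_comm, Finsupp.single_apply_eq_zero]
        intro h''
        exact absurd (congrArg (fun p : Q.NonzeroPath => p.1.start) h'') hq
      · rfl

theorem coords_mul_idem_of_ne (r : Q.BoundPathAlgebra K) (x : V) (p : Q.NonzeroPath)
    (h : p.1.start ≠ x) : coords Q K (r * Q.idem K x) p = 0 := by
  classical
  induction r using boundPathAlgebra_induction with
  | h0 => rw [zero_mul, map_zero]; rfl
  | hadd x y hx hy => rw [add_mul, map_add, Finsupp.add_apply, hx, hy, add_zero]
  | hs c q =>
    rw [smul_mul_assoc, map_smul, Finsupp.smul_apply, pathClass_mul_idem]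
    split_ifs with hq
    · rw [coords_pathClass, pathVec]
      split_ifs with h'
      · rw [Finsupp.single_apply_eq_zero.2, smul_zero]
        intro h''
        exact absurd ((congrArg (fun p : Q.NonzeroPath => p.1.start) h'').trans hq.symm) h
      · exact smul_zero _
    · rw [map_zero, Finsupp.zero_apply, smul_zero]

/-- The left ideals `Λ a`, for the arrows `a`, are independent. -/
theorem mul_arrow_eq_zero_of_sum {ι : Type*} (s : Finset ι) (r : ι → Q.BoundPathAlgebra K)
    (a : ι → E) (h : ∑ i ∈ s, r i * Q.arrow K (a i) = 0) {i : ι} (hi : i ∈ s)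
    (ha : ∀ j ∈ s, j ≠ i → r j = 0 ∨ a j ≠ a i) : r i * Q.arrow K (a i) = 0 := by
  refine coords_injective ?_
  rw [map_zero]
  ext p
  by_cases hp : p.1.arrows.head? = some (a i)
  · have h' := DFunLike.congr_fun (congrArg (coords Q K) h) p
    rw [map_sum, Finsupp.finsetSum_apply, Finset.sum_eq_single_of_mem i hi] at h'
    · rw [h', map_zero]
    · intro j hj hji
      rcases ha j hj hji with h0 | h0
      · rw [h0, zero_mul, map_zero]; rfl
      · refine coords_mul_arrow_of_ne _ _ _ fun h1 => h0 ?_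
        rw [hp] at h1
        exact (Option.some.inj h1).symm
  · rw [coords_mul_arrow_of_ne _ _ _ hp]; rfl

theorem mul_arrow_eq_mul_arrow {a b : E} (hab : a ≠ b) {r r' : Q.BoundPathAlgebra K}
    (h : r * Q.arrow K a = r' * Q.arrow K b) : r * Q.arrow K a = 0 := by
  refine coords_injective ?_
  rw [map_zero]
  ext p
  by_cases hp : p.1.arrows.head? = some a
  · rw [h, coords_mul_arrow_of_ne]
    · rfl
    · rw [hp]
      exact fun h' => hab (Option.some.inj h')
  · rw [coords_mul_arrow_of_ne _ _ _ hp]; rfl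

/-- The annihilator of an arrow `a` in `Λ e` is generated by the arrow `b` such that `b a` is a
relation, if there is one. -/
theorem exists_of_mul_arrow_eq_zero (hQ : Q.IsGentle K) {a : E} {r : Q.BoundPathAlgebra K}
    (hr : r * Q.idem K (Q.t a) = r) (h : r * Q.arrow K a = 0) :
    r = 0 ∨ ∃ b r', Q.rel b a ∧ r = r' * Q.arrow K b := by
  have key : ∀ p : Q.NonzeroPath, coords Q K r p ≠ 0 →
      ∃ b l, Q.rel b a ∧ p.1.arrows = b :: l := by
    rintro ⟨⟨x, l, hl⟩, hc⟩ hp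
    by_cases hx : x = Q.t a
    · subst hx
      by_contra hn
      have hl' : (a :: l).IsChain fun a b => ¬ Q.rel b a := by
        cases l with
        | nil => exact .singleton a
        | cons b l =>
          exact List.isChain_cons_cons.2 ⟨fun hb => hn ⟨b, l, hb, rfl⟩, hc⟩
      have := coords_mul_arrow r a l hl hl'
      rw [h, map_zero, Finsupp.zero_apply] at this
      exact hp this.symm
    · rw [← hr] at hp
      exact absurd (coords_mul_idem_of_ne r _ _ hx) hp
  by_cases h0 : ∃ b, Q.rel b a
  · obtain ⟨b, hb⟩ := h0
    refine .inr ⟨b, ?_⟩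
    suffices h' : ∃ r', r = r' * Q.arrow K b by
      obtain ⟨r', h'⟩ := h'
      exact ⟨r', hb, h'⟩
    have hmem : r ∈ LinearMap.range (LinearMap.mulRight K (Q.arrow K b)) := by
      rw [← sum_coords r, Finsupp.linearCombination_apply]
      refine Submodule.sum_mem _ fun p hp => Submodule.smul_mem _ _ ?_
      obtain ⟨b', l, hb', hl⟩ := key p (Finsupp.mem_support_iff.1 hp)
      obtain rfl := hQ.rel_left a hb hb'
      obtain ⟨⟨x, m, hm⟩, hc⟩ := p
      subst hl
      exact ⟨_, (pathClass_cons x b l hm).symm⟩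
    obtain ⟨r', h'⟩ := hmem
    exact ⟨r', h'.symm⟩
  · left
    refine coords_injective (Finsupp.ext fun p => ?_)
    rw [map_zero]
    by_contra hp
    obtain ⟨b, l, hb, -⟩ := key p hp
    exact h0 ⟨b, hb⟩

/-- Right multiplication with `a` can be cancelled after an arrow `b` such that `b a` is not a
relation. -/
theorem mul_arrow_eq_zero_of_mul (hQ : Q.IsGentle K) {a b : E} (hs : Q.s b = Q.t a)
    (hba : ¬ Q.rel b a) {r : Q.BoundPathAlgebra K} (h : r * Q.arrow K b * Q.arrow K a = 0) :
    r * Q.arrow K b = 0 := by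
  have h1 : r * Q.arrow K b * Q.idem K (Q.t a) = r * Q.arrow K b := by
    rw [← hs, mul_assoc, arrow_mul_idem_self]
  rcases exists_of_mul_arrow_eq_zero hQ h1 h with h0 | ⟨c, r', hc, h'⟩
  · exact h0
  · refine mul_arrow_eq_mul_arrow ?_ h'
    rintro rfl
    exact hba hc

end

end Basis

/-! ### Projectivity and exactness of complexes of projectives -/

section Homological

variable {V E : Type u} {Q : BoundQuiver V E} {K : Type u} [Field K] [Fintype V]

theorem mul_idem_of_mem_proj {x : V} {m : Q.BoundPathAlgebra K} (hm : m ∈ Q.proj K x) :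
    m * Q.idem K x = m := by
  obtain ⟨r, rfl⟩ := Submodule.mem_span_singleton.1 hm
  rw [smul_eq_mul, mul_assoc, idem_mul_idem]

theorem mul_idem_mem_proj (m : Q.BoundPathAlgebra K) (x : V) : m * Q.idem K x ∈ Q.proj K x :=
  Submodule.smul_mem _ m (Submodule.mem_span_singleton_self _)

instance projective_proj (x : V) : Module.Projective (Q.BoundPathAlgebra K) (Q.proj K x) :=
  Module.Projective.of_split (Q.proj K x).subtype
    ((LinearMap.toSpanSingleton _ _ (Q.idem K x)).codRestrict _ fun m => mul_idem_mem_proj m x) (by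
      ext m
      exact mul_idem_of_mem_proj m.2)

instance finite_proj (x : V) : Module.Finite (Q.BoundPathAlgebra K) (Q.proj K x) :=
  Module.Finite.span_singleton _ _

/-- A map from `P.X (n + 1)` to `M` that makes `P.X n ⟶ P.X (n + 1) ⟶ M ⟶ 0` exact gives a
quasi-isomorphism, if `P` is exact outside of degree `n + 1` and vanishes in degree `n + 2`. -/
theorem exists_quasiIso_single {A : Type u} [Ring A] (P : CochainComplex (ModuleCat.{u} A) ℤ)
    (M : ModuleCat.{u} A) (n : ℤ) (φ : P.X (n + 1) ⟶ M) (hz : Limits.IsZero (P.X (n + 1 + 1)))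
    (hex : ∀ m, m ≠ n + 1 → P.ExactAt m) (hφ : P.d n (n + 1) ≫ φ = 0)
    (hker : ∀ x, φ x = 0 → ∃ y, P.d n (n + 1) y = x) (hsurj : Function.Surjective φ) :
    ∃ f : P ⟶ (HomologicalComplex.single _ (ComplexShape.up ℤ) (n + 1)).obj M, QuasiIso f := by
  have hrel : ∀ i, (ComplexShape.up ℤ).Rel i (n + 1) → P.d i (n + 1) ≫ φ = 0 := by
    intro i hi
    obtain rfl : i = n := by
      have : i + 1 = n + 1 := hi
      omega
    exact hφ
  refine ⟨HomologicalComplex.mkHomToSingle φ hrel, ⟨fun m => ?_⟩⟩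
  · by_cases hm : m = n + 1
    · subst hm
      rw [quasiIsoAt_iff' _ n (n + 1) (n + 1 + 1) (by simp) (by simp)]
      rw [ShortComplex.quasiIso_iff_of_zeros' _ (hz.eq_of_tgt _ _)]
      · have e : (HomologicalComplex.mkHomToSingle φ hrel).f (n + 1) =
            φ ≫ (HomologicalComplex.singleObjXSelf (ComplexShape.up ℤ) (n + 1) M).inv :=
          HomologicalComplex.mkHomToSingle_f _ _
        constructor
        · rw [ShortComplex.moduleCat_exact_iff]
          intro (x : P.X (n + 1)) hx
          refine hker x ?_
          change (HomologicalComplex.mkHomToSingle φ hrel).f (n + 1) x = 0 at hx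
          rw [e] at hx
          have hx' := congrArg
            (HomologicalComplex.singleObjXSelf (ComplexShape.up ℤ) (n + 1) M).hom hx
          rw [map_zero, ← ModuleCat.comp_apply, Category.assoc, Iso.inv_hom_id,
            Category.comp_id] at hx'
          exact hx'
        · change Epi ((HomologicalComplex.mkHomToSingle φ hrel).f (n + 1))
          rw [e]
          have : Epi φ := (ModuleCat.epi_iff_surjective φ).2 hsurj
          exact epi_comp _ _
      · exact HomologicalComplex.single_obj_d (c := ComplexShape.up ℤ) ..
      · exact HomologicalComplex.single_obj_d (c := ComplexShape.up ℤ) ..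
    · rw [quasiIsoAt_iff_exactAt _ _ (hex m hm)]
      exact HomologicalComplex.exactAt_single_obj _ _ _ _ hm

namespace ProjSystem

variable (S : ProjSystem Q K)

open scoped Classical in
theorem d_lof (n : ℤ) (i : S.Idx n) (m : Q.proj K (S.vert i)) :
    S.d n (DirectSum.lof (Q.BoundPathAlgebra K) _ (fun i : S.Idx n => Q.proj K (S.vert i)) i m) =
      S.dOn n i m := DirectSum.toModule_lof _ _ _

theorem dOn_apply (n : ℤ) [Finite (S.Idx (n + 1))] (i : S.Idx n) (m : Q.proj K (S.vert i))
    (j : S.Idx (n + 1)) : ((S.dOn n i m : S.Term (n + 1)) j : Q.BoundPathAlgebra K) =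
      m * (S.coef i j * Q.idem K (S.vert j)) := by
  classical
  have := Fintype.ofFinite (S.Idx (n + 1))
  rw [dOn, finsum_eq_sum_of_fintype, LinearMap.sum_apply, DFinsupp.finsetSum_apply,
    Finset.sum_eq_single j, ← mul_assoc]
  · rw [LinearMap.comp_apply, DirectSum.lof_apply]
    rfl
  · intro k _ hk
    exact DFinsupp.single_eq_of_ne hk.symm
  · exact fun h => absurd (Finset.mem_univ _) h

theorem d_apply (n : ℤ) [Fintype (S.Idx n)] [Finite (S.Idx (n + 1))] (x : S.Term n)
    (j : S.Idx (n + 1)) : ((S.d n x) j : Q.BoundPathAlgebra K) =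
      ∑ i : S.Idx n, (x i : Q.BoundPathAlgebra K) * (S.coef i j * Q.idem K (S.vert j)) := by
  classical
  induction x using DirectSum.induction_on with
  | zero => simp
  | of i m =>
    change ((S.d n (DirectSum.lof (Q.BoundPathAlgebra K) _ _ i m)) j : Q.BoundPathAlgebra K) = _
    rw [d_lof, dOn_apply, Finset.sum_eq_single i]
    · rw [DirectSum.of_eq_same]
    · intro k _ hk
      rw [DirectSum.of_eq_of_ne _ _ _ hk, ZeroMemClass.coe_zero, zero_mul]
    · exact fun h => absurd (Finset.mem_univ _) h
  | add x y hx hy =>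
    rw [map_add, DirectSum.add_apply, Submodule.coe_add, hx, hy, ← Finset.sum_add_distrib]
    refine Finset.sum_congr rfl fun i _ => ?_
    rw [DirectSum.add_apply, Submodule.coe_add, add_mul]

open scoped Classical in
theorem mem_of_lof_mem (n : ℤ) [Finite (S.Idx n)]
    (W : Submodule (Q.BoundPathAlgebra K) (S.Term n)) (x : S.Term n)
    (h : ∀ i, DirectSum.lof (Q.BoundPathAlgebra K) _ (fun i : S.Idx n => Q.proj K (S.vert i)) i
      (x i) ∈ W) : x ∈ W := by
  have := Fintype.ofFinite (S.Idx n)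
  rw [← DirectSum.sum_univ_of x]
  exact Submodule.sum_mem _ fun i _ => h i

theorem complex_d (n : ℤ) : S.complex.d n (n + 1) = ModuleCat.ofHom (S.d n) :=
  CochainComplex.of_d (fun n => ModuleCat.of (Q.BoundPathAlgebra K) (S.Term n))
    (fun n => ModuleCat.ofHom (S.d n)) n

theorem exactAt_complex (n : ℤ) (h : ∀ x, S.d (n + 1) x = 0 → x ∈ LinearMap.range (S.d n)) :
    S.complex.ExactAt (n + 1) := by
  rw [HomologicalComplex.exactAt_iff' _ n (n + 1) (n + 1 + 1) (by simp) (by simp),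
    ShortComplex.moduleCat_exact_iff]
  intro x hx
  change S.complex.d (n + 1) (n + 1 + 1) x = 0 at hx
  change ∃ y, S.complex.d n (n + 1) y = x
  rw [complex_d] at hx ⊢
  exact h x hx

/-- The homotopy letters that start at the summands of a complex of projectives. From every summand
there starts at most one homotopy letter to either side; the sides are encoded by a Boolean, and
`out i s j` says that the one starting at `i` on the side `s` ends at `j`. The map that it gives is
right multiplication with `map i s`, which is a multiple of a path; `first` and `last` specify the
first and the last arrow of this path. -/
structure Outgoing where
  out : S.ι → Bool → S.ι → Prop
  map : S.ι → Bool → Q.BoundPathAlgebra K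
  first : S.ι → Bool → E → Prop
  last : S.ι → Bool → E → Prop
  out_unique : ∀ {i s j j'}, out i s j → out i s j' → j = j'
  deg_eq : ∀ {i s j}, out i s j → S.deg j = S.deg i + 1
  idem_mul_map : ∀ {i s j}, out i s j → Q.idem K (S.vert i) * map i s = map i s
  coef_eq : ∀ i j, S.coef i j * Q.idem K (S.vert j) = ∑ s, open scoped Classical in
    if out i s j then map i s else 0
  exists_first : ∀ {i s j}, out i s j → ∃ a y, first i s a ∧ map i s = y * Q.arrow K a
  first_ne : ∀ {i s i' s' j a a'}, out i s j → out i' s' j → (i, s) ≠ (i', s') →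
    first i s a → first i' s' a' → a ≠ a'
  exists_last : ∀ {i s j}, out i s j → ∃ a, last i s a
  t_last : ∀ {i s j a}, out i s j → last i s a → Q.t a = S.vert i
  cancel : ∀ {i s j a}, out i s j → last i s a → ∀ x, x * map i s = 0 → x * Q.arrow K a = 0
  last_ne : ∀ {i j j' a a'}, out i true j → out i false j' → last i true a →
    last i false a' → a ≠ a'

namespace Outgoing

variable {S} (D : S.Outgoing)

/-- Every summand in negative degree has homotopy letters starting there on both sides, or there is
one such that every arrow prolonging it by a relation is a homotopy letter to this summand, which is
the only one that starts at its source. -/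
def IsExact : Prop := ∀ i, S.deg i < 0 →
  (∃ j j', D.out i true j ∧ D.out i false j') ∨
    ∃ s j a, D.out i s j ∧ D.last i s a ∧ ∀ b, Q.rel b a →
      ∃ i' s', S.vert i' = Q.t b ∧ D.out i' s' i ∧ D.map i' s' = Q.arrow K b ∧
        ∀ j', ¬ D.out i' (!s') j'

/-- The coefficient of a cycle at the source of a homotopy letter is annihilated by the last arrow
of this letter: the homotopy letters ending at a summand have different first arrows, so that their
contributions vanish separately, and all of the letter but its last arrow can be cancelled. -/
theorem mul_last_eq_zero {n : ℤ} [Finite (S.Idx n)] [Finite (S.Idx (n + 1))] {x : S.Term n}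
    (hx : S.d n x = 0) (i : S.Idx n) {s : Bool} {j : S.ι} (h : D.out i s j) {a : E}
    (ha : D.last i s a) : (x i : Q.BoundPathAlgebra K) * Q.arrow K a = 0 := by
  classical
  have := Fintype.ofFinite (S.Idx n)
  refine D.cancel h ha _ ?_
  have hj : S.deg j = n + 1 := by rw [D.deg_eq h, i.2]
  have h1 := S.d_apply n x ⟨j, hj⟩
  rw [hx, DirectSum.zero_apply, ZeroMemClass.coe_zero] at h1
  have h2 : ∀ i' s', ∃ b y, D.out i' s' j →
      D.first i' s' b ∧ D.map i' s' = y * Q.arrow K b := by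
    intro i' s'
    by_cases h' : D.out i' s' j
    · obtain ⟨b, y, hy⟩ := D.exists_first h'
      exact ⟨b, y, fun _ => hy⟩
    · exact ⟨a, 0, fun h'' => absurd h'' h'⟩
  choose b y hy using h2
  have h3 : ∑ p ∈ (Finset.univ : Finset (S.Idx n × Bool)),
      (if D.out p.1 p.2 j then (x p.1 : Q.BoundPathAlgebra K) * y p.1 p.2 else 0) *
        Q.arrow K (b p.1 p.2) = 0 := by
    rw [← Finset.univ_product_univ, Finset.sum_product]
    refine Eq.trans ?_ h1.symm
    refine Finset.sum_congr rfl fun i' _ => ?_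
    rw [D.coef_eq, Finset.mul_sum]
    refine Finset.sum_congr rfl fun s' _ => ?_
    split_ifs with h'
    · rw [(hy _ _ h').2, mul_assoc]
    · rw [zero_mul, mul_zero]
  have h4 := mul_arrow_eq_zero_of_sum _ _ _ h3 (Finset.mem_univ (i, s)) (by
    rintro ⟨i', s'⟩ - hne
    by_cases h' : D.out i' s' j
    · refine .inr (D.first_ne h' h (fun he => hne ?_) (hy _ _ h').1 (hy _ _ h).1)
      obtain ⟨e1, e2⟩ := Prod.mk.inj he
      exact Prod.ext (Subtype.ext e1) e2
    · exact .inl (if_neg h'))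
  rw [if_pos h, mul_assoc, ← (hy _ _ h).2] at h4
  exact h4

/-- If only one homotopy letter starts at a summand, the differential maps this summand to the end
of the letter. -/
theorem dOn_eq_lof {n : ℤ} [DecidableEq (S.Idx (n + 1))] [Finite (S.Idx (n + 1))] (i : S.Idx n)
    {s : Bool} {j : S.Idx (n + 1)} (h : D.out i s j) (h' : ∀ j', ¬ D.out i (!s) j')
    (m : Q.proj K (S.vert i)) (m' : Q.proj K (S.vert j))
    (hm : (m' : Q.BoundPathAlgebra K) = m * D.map i s) :
    S.dOn n i m = DirectSum.lof (Q.BoundPathAlgebra K) _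
      (fun i : S.Idx (n + 1) => Q.proj K (S.vert i)) j m' := by
  classical
  refine DFinsupp.ext fun k => Subtype.ext ?_
  rw [dOn_apply, D.coef_eq]
  have hs : ∀ k : S.Idx (n + 1), (∑ s', if D.out i s' k then D.map i s' else 0) =
      if D.out i s k then D.map i s else 0 := by
    intro k
    refine Fintype.sum_eq_single s fun s' hs' => ?_
    obtain rfl : s' = !s := by cases s <;> cases s' <;> simp_all
    rw [if_neg (h' _)]
  rw [hs]
  by_cases hk : k = j
  · subst hk
    rw [if_pos h, ← hm]
    exact congrArg Subtype.val (DirectSum.lof_apply (R := Q.BoundPathAlgebra K)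
      (M := fun i : S.Idx (n + 1) => Q.proj K (S.vert i)) k m').symm
  · rw [if_neg fun h'' => hk (Subtype.ext (D.out_unique h'' h)), mul_zero]
    have : (DirectSum.lof (Q.BoundPathAlgebra K) _
      (fun i : S.Idx (n + 1) => Q.proj K (S.vert i)) j m') k = 0 := DFinsupp.single_eq_of_ne hk
    rw [this]
    rfl

/-- Exactness in degree `n + 1` holds summand by summand: the coefficient of a cycle at a summand
either vanishes, or it is a multiple of the arrow which prolongs the homotopy letter starting there
by a relation, and this arrow is a component of the differential. -/
theorem exact_of_isExact (hQ : Q.IsGentle K) (hD : D.IsExact) {n : ℤ} (hn : n + 1 < 0)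
    [Finite (S.Idx n)] [Finite (S.Idx (n + 1))] [Finite (S.Idx (n + 1 + 1))]
    (x : S.Term (n + 1)) (hx : S.d (n + 1) x = 0) : x ∈ LinearMap.range (S.d n) := by
  classical
  refine S.mem_of_lof_mem _ _ x fun i => ?_
  have hxi := mul_idem_of_mem_proj (x i).2
  have hzero : (x i : Q.BoundPathAlgebra K) = 0 → DirectSum.lof (Q.BoundPathAlgebra K) _
      (fun i : S.Idx (n + 1) => Q.proj K (S.vert i)) i (x i) ∈ LinearMap.range (S.d n) := by
    intro h
    rw [show x i = 0 from Subtype.ext h, map_zero]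
    exact Submodule.zero_mem _
  rcases hD i (by rw [i.2]; exact hn) with ⟨j, j', h, h'⟩ | ⟨s, j, a, h, ha, hb⟩
  · -- two arrows prolonging the two homotopy letters by relations are different
    obtain ⟨a, ha⟩ := D.exists_last h
    obtain ⟨a', ha'⟩ := D.exists_last h'
    have e := D.mul_last_eq_zero hx i h ha
    have e' := D.mul_last_eq_zero hx i h' ha'
    refine hzero ?_
    rcases exists_of_mul_arrow_eq_zero hQ (by rw [D.t_last h ha]; exact hxi) e with
      h0 | ⟨b, y, hb, hy⟩
    · exact h0
    rcases exists_of_mul_arrow_eq_zero hQ (by rw [D.t_last h' ha']; exact hxi) e' with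
      h0 | ⟨b', y', hb', hy'⟩
    · exact h0
    rw [hy]
    refine mul_arrow_eq_mul_arrow ?_ (hy.symm.trans hy')
    rintro rfl
    exact D.last_ne h h' ha ha' (hQ.rel_right b hb hb')
  · rcases exists_of_mul_arrow_eq_zero hQ (by rw [D.t_last h ha]; exact hxi)
      (D.mul_last_eq_zero hx i h ha) with h0 | ⟨b, y, hb', hy⟩
    · exact hzero h0
    obtain ⟨i', s', hv, ho, hm, hn'⟩ := hb b hb'
    have hi' : S.deg i' = n := by
      have := D.deg_eq ho
      rw [i.2] at this
      omega
    refine ⟨DirectSum.lof (Q.BoundPathAlgebra K) _ (fun i : S.Idx n => Q.proj K (S.vert i))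
      ⟨i', hi'⟩ ⟨y * Q.idem K (S.vert i'), mul_idem_mem_proj _ _⟩, ?_⟩
    rw [d_lof]
    refine D.dOn_eq_lof ⟨i', hi'⟩ (j := i) ho hn' _ _ ?_
    rw [hm, hv, mul_assoc, idem_mul_arrow, hy]

open scoped Classical in
/-- The contribution of one homotopy letter to the relation which the values of a map on the
generators of the projectives have to satisfy in order to vanish on the image of the
differential. -/
noncomputable def eval {N : Type*} [AddCommGroup N] [Module (Q.BoundPathAlgebra K) N]
    (G : S.ι → N) (i : S.ι) (s : Bool) : N :=
  if h : ∃ j, D.out i s j then D.map i s • G h.choose else 0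

variable {N : Type*} [AddCommGroup N] [Module (Q.BoundPathAlgebra K) N]

theorem eval_of_out (G : S.ι → N) {i : S.ι} {s : Bool} {j : S.ι} (h : D.out i s j) :
    D.eval G i s = D.map i s • G j := by
  have h' : ∃ j, D.out i s j := ⟨j, h⟩
  rw [eval, dif_pos h', D.out_unique h'.choose_spec h]

theorem eval_of_not (G : S.ι → N) {i : S.ι} {s : Bool} (h : ∀ j, ¬ D.out i s j) :
    D.eval G i s = 0 := dif_neg fun ⟨j, hj⟩ => h j hj

/-- The relations at the summands of degree `n`. -/
def Relations (n : ℤ) (G : S.ι → N) : Prop :=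
  ∀ i, S.deg i = n → D.eval G i true + D.eval G i false = 0

theorem sum_coef_smul {n : ℤ} [Fintype (S.Idx (n + 1))] (i : S.Idx n) (G : S.ι → N) :
    ∑ j : S.Idx (n + 1), (S.coef i j * Q.idem K (S.vert j)) • G j =
      D.eval G i true + D.eval G i false := by
  classical
  rw [← Fintype.sum_bool fun s => D.eval G i s]
  have : ∀ j : S.Idx (n + 1), (S.coef i j * Q.idem K (S.vert j)) • G j =
      ∑ s, if D.out i s j then D.map i s • G j else 0 := by
    intro j
    rw [D.coef_eq, Finset.sum_smul]
    refine Finset.sum_congr rfl fun s _ => ?_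
    split_ifs
    · rfl
    · exact zero_smul _ _
  rw [Finset.sum_congr rfl fun j _ => this j, Finset.sum_comm]
  refine Finset.sum_congr rfl fun s _ => ?_
  by_cases h : ∃ j, D.out i s j
  · obtain ⟨j, h⟩ := h
    have hj : S.deg j = n + 1 := by rw [D.deg_eq h, i.2]
    rw [D.eval_of_out G h, Finset.sum_eq_single ⟨j, hj⟩, if_pos h]
    · intro k _ hk
      exact if_neg fun h' => hk (Subtype.ext (D.out_unique h' h))
    · exact fun h' => absurd (Finset.mem_univ _) h'
  · rw [D.eval_of_not G fun j hj => h ⟨j, hj⟩]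
    exact Finset.sum_eq_zero fun k _ => if_neg fun h' => h ⟨_, h'⟩

/-- A complex of projectives in degrees `≤ 0` with the exactness property `IsExact` is a projective
resolution of every module which is presented by the generators of the projectives in degree `0` and
the relations given by the differential in degree `-1`. -/
theorem isProjectiveResolution (hQ : Q.IsGentle K) (hfin : ∀ n, Finite (S.Idx n))
    (hdeg : ∀ i, S.deg i ≤ 0) (hD : D.IsExact) (M : ModuleCat.{u} (Q.BoundPathAlgebra K))
    (F : S.ι → M) (hFe : ∀ i, S.deg i = 0 → Q.idem K (S.vert i) • F i = F i)
    (hF : D.Relations (-1) F) (hspan : ∀ W : Submodule (Q.BoundPathAlgebra K) M,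
      (∀ i, S.deg i = 0 → F i ∈ W) → W = ⊤)
    (hlift : ∀ (N : Type u) [AddCommGroup N] [Module (Q.BoundPathAlgebra K) N] (G : S.ι → N),
      (∀ i, Q.idem K (S.vert i) • G i = G i) → D.Relations (-1) G →
        ∃ f : M →ₗ[Q.BoundPathAlgebra K] N, ∀ i, S.deg i = 0 → f (F i) = G i) :
    IsProjectiveResolution S.complex M := by
  classical
  have hsub : ∀ n, 0 < n → Subsingleton (S.Term n) := by
    intro n hn
    have : IsEmpty (S.Idx n) := ⟨fun i => by have := hdeg i; rw [i.2] at this; omega⟩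
    exact ⟨fun x y => DFinsupp.ext fun i => isEmptyElim i⟩
  have hzero : ∀ n, 0 < n → Limits.IsZero (S.complex.X n) := fun n hn =>
    have := hsub n hn
    ModuleCat.isZero_of_subsingleton (ModuleCat.of (Q.BoundPathAlgebra K) (S.Term n))
  refine ⟨fun n => ?_, fun n => ?_, hzero, ?_⟩
  · exact ModuleCat.projective_of_categoryTheory_projective
      (ModuleCat.of (Q.BoundPathAlgebra K) (S.Term n))
  · have := Fintype.ofFinite (S.Idx n)
    exact Module.Finite.instDirectSum (R := Q.BoundPathAlgebra K)
      (fun i : S.Idx n => Q.proj K (S.vert i))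
  have h01 : (0 : ℤ) = -1 + 1 := by norm_num
  rw [h01]
  have := Fintype.ofFinite (S.Idx (-1 + 1))
  let φ : S.Term (-1 + 1) →ₗ[Q.BoundPathAlgebra K] M := DirectSum.toModule _ _ _ fun i =>
    (LinearMap.toSpanSingleton _ _ (F i)).comp (Q.proj K (S.vert i)).subtype
  have hφ : ∀ (i : S.Idx (-1 + 1)) (m : Q.proj K (S.vert i)), φ (
      DirectSum.lof (Q.BoundPathAlgebra K) _
      (fun i : S.Idx (-1 + 1) => Q.proj K (S.vert i)) i m) = (m : Q.BoundPathAlgebra K) • F i :=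
    fun i m => DirectSum.toModule_lof _ _ _
  have hφ' : ∀ x, φ x = ∑ i, (x i : Q.BoundPathAlgebra K) • F i := by
    intro x
    conv_lhs => rw [← DirectSum.sum_univ_of x]
    rw [map_sum]
    exact Finset.sum_congr rfl fun i _ => hφ i (x i)
  have hφd : φ ∘ₗ S.d (-1) = 0 := by
    refine DirectSum.linearMap_ext _ fun i => LinearMap.ext fun m => ?_
    rw [LinearMap.comp_apply, LinearMap.comp_apply, d_lof, hφ']
    have : ∀ j, ((S.dOn (-1) i m : S.Term (-1 + 1)) j : Q.BoundPathAlgebra K) • F j =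
        (m : Q.BoundPathAlgebra K) • (S.coef i j * Q.idem K (S.vert j)) • F j := fun j => by
      rw [dOn_apply, mul_smul]
    rw [Finset.sum_congr rfl fun j _ => this j, ← Finset.smul_sum, D.sum_coef_smul, hF i i.2,
      smul_zero]
    rfl
  refine exists_quasiIso_single S.complex M (-1) (ModuleCat.ofHom φ) (hzero _ (by norm_num))
    ?_ ?_ ?_ ?_
  · intro m hm
    obtain ⟨n, rfl⟩ : ∃ n, m = n + 1 := ⟨m - 1, by omega⟩
    refine S.exactAt_complex n fun x hx => ?_
    rcases lt_or_gt_of_ne hm with h | h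
    · have := hfin n
      have := hfin (n + 1)
      have := hfin (n + 1 + 1)
      exact D.exact_of_isExact hQ hD (by omega) x hx
    · have := hsub (n + 1) (by omega)
      rw [Subsingleton.elim x 0]
      exact Submodule.zero_mem _
  · rw [complex_d]
    exact (ModuleCat.ofHom_comp _ _).symm.trans (by rw [hφd]; rfl)
  · intro x hx
    rw [complex_d]
    -- the universal property of `M` is applied to the cokernel `N` of the differential; it yields a
    -- factorization of the projection to `N` over `φ`, so the kernel of `φ` lies in the image
    let N := S.Term (-1 + 1) ⧸ LinearMap.range (S.d (-1))
    let q : S.Term (-1 + 1) →ₗ[Q.BoundPathAlgebra K] N := (LinearMap.range (S.d (-1))).mkQ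
    let g : ∀ i : S.Idx (-1 + 1), N := fun i => q (DirectSum.lof (Q.BoundPathAlgebra K) _
      (fun i : S.Idx (-1 + 1) => Q.proj K (S.vert i)) i
        ⟨Q.idem K (S.vert i), Submodule.mem_span_singleton_self _⟩)
    let G : S.ι → N := fun i => if h : S.deg i = -1 + 1 then g ⟨i, h⟩ else 0
    have hG : ∀ i : S.Idx (-1 + 1), G i = g i := fun i => dif_pos i.2
    have hg : ∀ (i : S.Idx (-1 + 1)) (m : Q.proj K (S.vert i)), q (
        DirectSum.lof (Q.BoundPathAlgebra K) _
        (fun i : S.Idx (-1 + 1) => Q.proj K (S.vert i)) i m) =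
          (m : Q.BoundPathAlgebra K) • G i := by
      intro i m
      rw [hG, ← map_smul, ← map_smul]
      congr 2
      exact Subtype.ext (mul_idem_of_mem_proj m.2).symm
    have hg' : ∀ x, q x = ∑ i, (x i : Q.BoundPathAlgebra K) • G i := by
      intro x
      conv_lhs => rw [← DirectSum.sum_univ_of x]
      rw [map_sum]
      exact Finset.sum_congr rfl fun i _ => hg i (x i)
    obtain ⟨f, hf⟩ := hlift N G (by
      intro i
      by_cases h : S.deg i = -1 + 1
      · rw [hG ⟨i, h⟩, ← map_smul, ← map_smul]
        congr 2
        exact Subtype.ext (idem_mul_idem K _)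
      · rw [show G i = 0 from dif_neg h, smul_zero]) (by
      intro i hi
      have h0 : q (S.dOn (-1) ⟨i, hi⟩ ⟨Q.idem K (S.vert i),
          Submodule.mem_span_singleton_self _⟩) = 0 := by
        rw [← d_lof]
        exact (Submodule.Quotient.mk_eq_zero _).2 ⟨_, rfl⟩
      have h1 : ∀ j : S.Idx (-1 + 1), ((S.dOn (-1) ⟨i, hi⟩ ⟨Q.idem K (S.vert i),
          Submodule.mem_span_singleton_self _⟩ : S.Term (-1 + 1)) j : Q.BoundPathAlgebra K) • G j =
          Q.idem K (S.vert i) • (S.coef i j * Q.idem K (S.vert j)) • G j := fun j => by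
        rw [dOn_apply, mul_smul]
      rw [hg', Finset.sum_congr rfl fun j _ => h1 j, ← Finset.smul_sum,
        D.sum_coef_smul ⟨i, hi⟩] at h0
      have h2 : ∀ s, Q.idem K (S.vert i) • D.eval G i s = D.eval G i s := by
        intro s
        by_cases h : ∃ j, D.out i s j
        · obtain ⟨j, h⟩ := h
          rw [D.eval_of_out G h, ← mul_smul, D.idem_mul_map h]
        · rw [D.eval_of_not G fun j hj => h ⟨j, hj⟩, smul_zero]
      rwa [smul_add, h2, h2] at h0)
    have hfq : f ∘ₗ φ = q := by
      refine DirectSum.linearMap_ext _ fun i => LinearMap.ext fun m => ?_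
      rw [LinearMap.comp_apply, LinearMap.comp_apply, LinearMap.comp_apply, hφ, hg, map_smul,
        hf i (by rw [i.2]; norm_num)]
    have hx' : φ x = 0 := hx
    have : q x = 0 := (LinearMap.congr_fun hfq x).symm.trans ((congrArg f hx').trans (map_zero f))
    exact (Submodule.Quotient.mk_eq_zero _).1 this
  · have := hspan (LinearMap.range φ) (by
      intro i hi
      refine ⟨DirectSum.lof (Q.BoundPathAlgebra K) _ (fun i : S.Idx (-1 + 1) =>
        Q.proj K (S.vert i)) ⟨i, hi.trans h01⟩ ⟨Q.idem K (S.vert i),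
          Submodule.mem_span_singleton_self _⟩, ?_⟩
      rw [hφ]
      exact hFe i hi)
    exact LinearMap.range_eq_top.1 this

end Outgoing

end ProjSystem

end Homological

/-! ### Modules given by matrices: presentations -/

section MatrixRep

variable {V E : Type u} {Q : BoundQuiver V E} {K : Type u} [Field K] [Fintype V]

theorem smul_eq_algebraMap_smul {N : Type*} [AddCommGroup N] [Module (Q.BoundPathAlgebra K) N]
    (c : K) (r : Q.BoundPathAlgebra K) (v : N) :
    (c • r) • v = algebraMap K (Q.BoundPathAlgebra K) c • r • v := by
  rw [Algebra.smul_def, mul_smul]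

theorem algebraMap_smul_comm {N : Type*} [AddCommGroup N] [Module (Q.BoundPathAlgebra K) N]
    (c : K) (r : Q.BoundPathAlgebra K) (v : N) :
    r • algebraMap K (Q.BoundPathAlgebra K) c • v =
      algebraMap K (Q.BoundPathAlgebra K) c • r • v := by
  rw [← mul_smul, ← mul_smul, Algebra.commutes]

/-- An additive map is `Λ`-linear, if it commutes with scalars, with the idempotents of the vertices
and with the arrows. -/
theorem map_smul_of_generators {M N : Type*} [AddCommGroup M] [Module (Q.BoundPathAlgebra K) M]
    [AddCommGroup N] [Module (Q.BoundPathAlgebra K) N] (f : M →+ N)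
    (hc : ∀ (c : K) v, f (algebraMap K (Q.BoundPathAlgebra K) c • v) =
      algebraMap K (Q.BoundPathAlgebra K) c • f v)
    (he : ∀ x v, f (Q.idem K x • v) = Q.idem K x • f v)
    (ha : ∀ a v, f (Q.arrow K a • v) = Q.arrow K a • f v) (r : Q.BoundPathAlgebra K) (v : M) :
    f (r • v) = r • f v := by
  induction r using boundPathAlgebra_induction with
  | h0 => rw [zero_smul, zero_smul, map_zero]
  | hadd x y hx hy => rw [add_smul, add_smul, map_add, hx, hy]
  | hs c p =>
    rw [smul_eq_algebraMap_smul, smul_eq_algebraMap_smul, hc]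
    congr 1
    obtain ⟨x, l, h⟩ := p
    induction l generalizing x v with
    | nil => exact he x v
    | cons a l ih => rw [pathClass_cons, mul_smul, mul_smul, ih, ha]

namespace MatrixRep

variable {P : Type} [Fintype P] [DecidableEq P] (R : MatrixRep Q K P)

/-- The basis vectors of the module given by a matrix representation. -/
def basisVec (i : P) : R.toModule := (Pi.single i 1 : P → K)

/-- The coordinates of an element of the module given by a matrix representation. -/
def coord (v : R.toModule) (i : P) : K := (v : P → K) i

theorem ext_coord {v v' : R.toModule} (h : ∀ i, R.coord v i = R.coord v' i) : v = v' := funext h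

theorem coord_add (v v' : R.toModule) (i : P) :
    R.coord (v + v') i = R.coord v i + R.coord v' i := rfl

theorem coord_zero (i : P) : R.coord 0 i = 0 := rfl

theorem coord_sum {ι : Type*} (s : Finset ι) (f : ι → R.toModule) (i : P) :
    R.coord (∑ k ∈ s, f k) i = ∑ k ∈ s, R.coord (f k) i := by
  classical
  induction s using Finset.induction_on with
  | empty => rfl
  | insert a s ha ih => rw [Finset.sum_insert ha, Finset.sum_insert ha, coord_add, ih]

theorem coord_basisVec (i j : P) : R.coord (R.basisVec i) j = if j = i then 1 else 0 :=
  Pi.single_apply i (1 : K) j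

theorem coord_smul (r : Q.BoundPathAlgebra K) (v : R.toModule) (i : P) :
    R.coord (r • v) i = (R.relSystem.toHom K r).mulVec (R.coord v) i := rfl

theorem coord_algebraMap_smul (c : K) (v : R.toModule) (i : P) :
    R.coord (algebraMap K (Q.BoundPathAlgebra K) c • v) i = c * R.coord v i := by
  rw [coord_smul, Algebra.algebraMap_eq_smul_one, RelSystem.toHom_smul, map_one,
    Matrix.smul_mulVec, Matrix.one_mulVec]
  rfl

open scoped Classical in
theorem coord_idem_smul (x : V) (v : R.toModule) (i : P) :
    R.coord (Q.idem K x • v) i = if R.vert i = x then R.coord v i else 0 := by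
  rw [coord_smul, idem, RelSystem.toHom_toBound, RelSystem.liftLin_ofPath]
  change (Matrix.diagonal fun i => if R.vert i = x then (1 : K) else 0).mulVec (R.coord v) i = _
  rw [Matrix.mulVec_diagonal, ite_mul, one_mul, zero_mul]

theorem coord_arrow_smul (a : E) (v : R.toModule) (j : P) :
    R.coord (Q.arrow K a • v) j = ∑ i, R.coef a i j * R.coord v i := by
  rw [coord_smul, arrow, RelSystem.toHom_toBound, RelSystem.liftLin_ofPath]
  change ((R.relSystem.e (Q.t a)) * R.relSystem.f a).mulVec (R.coord v) j = _
  rw [RelSystem.e_mul_f]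
  rfl

theorem coord_arrow_smul_basisVec (a : E) (i j : P) :
    R.coord (Q.arrow K a • R.basisVec i) j = R.coef a i j := by
  rw [coord_arrow_smul, Finset.sum_eq_single i]
  · rw [coord_basisVec, if_pos rfl, mul_one]
  · intro k _ hk
    rw [coord_basisVec, if_neg hk, mul_zero]
  · exact fun h => absurd (Finset.mem_univ _) h

theorem idem_smul_basisVec (i : P) : Q.idem K (R.vert i) • R.basisVec i = R.basisVec i := by
  refine R.ext_coord fun j => ?_
  rw [coord_idem_smul]
  split_ifs with h
  · rfl
  · rw [coord_basisVec, if_neg]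
    rintro rfl
    exact h rfl

theorem sum_coord (v : R.toModule) :
    ∑ i, algebraMap K (Q.BoundPathAlgebra K) (R.coord v i) • R.basisVec i = v := by
  refine R.ext_coord fun j => ?_
  rw [coord_sum, Finset.sum_eq_single j]
  · rw [coord_algebraMap_smul, coord_basisVec, if_pos rfl, mul_one]
  · intro k _ hk
    rw [coord_algebraMap_smul, coord_basisVec, if_neg hk.symm, mul_zero]
  · exact fun h => absurd (Finset.mem_univ _) h

theorem eq_top_of_basisVec_mem (W : Submodule (Q.BoundPathAlgebra K) R.toModule)
    (h : ∀ i, R.basisVec i ∈ W) : W = ⊤ := by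
  refine (Submodule.eq_top_iff').2 fun v => ?_
  rw [← R.sum_coord v]
  exact Submodule.sum_mem _ fun i _ => Submodule.smul_mem _ _ (h i)

/-- The universal property of the module given by a matrix representation: it is presented by the
basis vectors and the formulas for the action of the vertices and the arrows on them. -/
theorem exists_linearMap {N : Type*} [AddCommGroup N] [Module (Q.BoundPathAlgebra K) N] (Y : P → N)
    (he : ∀ i, Q.idem K (R.vert i) • Y i = Y i)
    (ha : ∀ a i, Q.arrow K a • Y i =
      ∑ j, algebraMap K (Q.BoundPathAlgebra K) (R.coef a i j) • Y j) :
    ∃ f : R.toModule →ₗ[Q.BoundPathAlgebra K] N, ∀ i, f (R.basisVec i) = Y i := by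
  classical
  let f : R.toModule →+ N :=
    { toFun := fun v => ∑ i, algebraMap K (Q.BoundPathAlgebra K) (R.coord v i) • Y i
      map_zero' := Finset.sum_eq_zero fun i _ => by rw [coord_zero, map_zero, zero_smul]
      map_add' := fun v v' => by
        rw [← Finset.sum_add_distrib]
        exact Finset.sum_congr rfl fun i _ => by rw [coord_add, map_add, add_smul] }
  have hf : ∀ v, f v = ∑ i, algebraMap K (Q.BoundPathAlgebra K) (R.coord v i) • Y i :=
    fun v => rfl
  refine ⟨{ f with map_smul' := map_smul_of_generators f ?_ ?_ ?_ }, ?_⟩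
  · intro c v
    rw [hf, hf, Finset.smul_sum]
    refine Finset.sum_congr rfl fun i _ => ?_
    rw [coord_algebraMap_smul, map_mul, mul_smul]
  · intro x v
    rw [hf, hf, Finset.smul_sum]
    refine Finset.sum_congr rfl fun i _ => ?_
    rw [coord_idem_smul, algebraMap_smul_comm]
    split_ifs with h
    · rw [← h, he]
    · rw [← he i, ← mul_smul (Q.idem K x), idem_mul_idem_of_ne (Ne.symm h), zero_smul, smul_zero,
        map_zero, zero_smul]
  · intro a v
    rw [hf, hf, Finset.smul_sum]
    calc _ = ∑ j, ∑ i, algebraMap K (Q.BoundPathAlgebra K) (R.coord v i) •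
          algebraMap K (Q.BoundPathAlgebra K) (R.coef a i j) • Y j := by
          refine Finset.sum_congr rfl fun j _ => ?_
          rw [coord_arrow_smul, map_sum, Finset.sum_smul]
          refine Finset.sum_congr rfl fun i _ => ?_
          rw [mul_comm, map_mul, mul_smul]
      _ = _ := by
          rw [Finset.sum_comm]
          refine Finset.sum_congr rfl fun i _ => ?_
          rw [← Finset.smul_sum, ← ha, algebraMap_smul_comm]
  · intro i
    change f _ = _
    rw [hf, Finset.sum_eq_single i]
    · rw [coord_basisVec, if_pos rfl, map_one, one_smul]
    · intro k _ hk
      rw [coord_basisVec, if_neg hk, map_zero, zero_smul]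
    · exact fun h => absurd (Finset.mem_univ _) h

end MatrixRep

end MatrixRep

/-! ### Walks and homotopy letters -/

section Words

variable {V E : Type u} {Q : BoundQuiver V E}

namespace Letter

/-- In a gentle algebra, an arrow `a` which starts at the vertex between the letters `v` and `u` of
a string `v u` is one of these letters, or it is annihilated by one of them. -/
theorem arrow_cases {K : Type u} [Field K] (hQ : Q.IsGentle K) {u v : Letter E}
    (h : Compatible Q u v) {a : E} (ha : Q.s a = tgt Q u) :
    v = direct a ∨ u = inverse a ∨ (∃ b, u = direct b ∧ Q.rel a b) ∨
      ∃ b, v = inverse b ∧ Q.rel a b := by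
  obtain ⟨⟨hst, hne⟩, hnr⟩ := h
  rcases u with b | b <;> rcases v with c | c
  · by_cases hab : Q.rel a b
    · exact .inr (.inr (.inl ⟨b, rfl, hab⟩))
    · rw [hQ.nonrel_left b (show c ∈ _ from ⟨hst, hnr⟩) (show a ∈ _ from ⟨ha, hab⟩)]
      exact .inl rfl
  · by_cases hab : Q.rel a b
    · exact .inr (.inr (.inl ⟨b, rfl, hab⟩))
    · by_cases hac : Q.rel a c
      · exact .inr (.inr (.inr ⟨c, rfl, hac⟩))
      · refine absurd ?_ hne
        rw [hQ.nonrel_right a (show b ∈ _ from ⟨ha, hab⟩)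
          (show c ∈ _ from ⟨ha.trans hst.symm, hac⟩)]
        rfl
  · by_contra hcon
    push Not at hcon
    have h3 : ({a, b, c} : Set E).encard ≤ {d | Q.s d = tgt Q (inverse b)}.encard := by
      refine Set.encard_le_encard ?_
      rintro d (rfl | rfl | rfl)
      · exact ha
      · rfl
      · exact hst
    have h4 : ({a, b, c} : Set E).encard = 3 := by
      refine Set.encard_eq_three.2 ⟨a, b, c, ?_, ?_, ?_, rfl⟩
      · rintro rfl; exact hcon.2.1 rfl
      · rintro rfl; exact hcon.1 rfl
      · rintro rfl; exact hne rfl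
    rw [h4] at h3
    exact absurd (h3.trans (hQ.card_start _)) (by decide)
  · by_cases hac : Q.rel a c
    · exact .inr (.inr (.inr ⟨c, rfl, hac⟩))
    · rw [hQ.nonrel_left c (show b ∈ _ from ⟨hst.symm, hnr⟩)
        (show a ∈ _ from ⟨ha.trans hst.symm, hac⟩)]
      exact .inr (.inl rfl)

theorem straight_of_compatible {u v : Letter E} (h : Compatible Q u v)
    (hd : u.isDirect = v.isDirect) : Straight Q u v := by
  obtain ⟨⟨hst, -⟩, hnr⟩ := h
  rcases u with b | b <;> rcases v with c | c
  · exact ⟨hst, hnr⟩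
  · cases hd
  · cases hd
  · exact ⟨hst.symm, hnr⟩

theorem isDirect_eq_of_straight {u v : Letter E} (h : Straight Q u v) :
    u.isDirect = v.isDirect := by
  rcases u with b | b <;> rcases v with c | c
  · rfl
  · exact h.elim
  · exact h.elim
  · rfl

end Letter

namespace Word

variable {σ : Word Q}

theorem IsWalk.mem_pos (hσ : σ.IsWalk) {i : ℤ} {u : Letter E} (h : σ.letter i = some u) :
    i ∈ σ.pos := ((hσ.isSome_iff i).1 (by rw [h]; rfl)).1

theorem IsWalk.mem_pos_succ (hσ : σ.IsWalk) {i : ℤ} {u : Letter E} (h : σ.letter i = some u) :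
    i + 1 ∈ σ.pos := ((hσ.isSome_iff i).1 (by rw [h]; rfl)).2

theorem exists_straight_of_not_isBreak {i : ℤ} (hi : i ∈ σ.pos) (h : ¬ σ.IsBreak i) :
    ∃ u v, σ.letter (i - 1) = some u ∧ σ.letter i = some v ∧ Letter.Straight Q u v := by
  by_contra hn
  push Not at hn
  exact h ⟨hi, hn⟩

theorem IsWalk.exists_isDirectLetter (hσ : σ.IsWalk) {i : ℤ} {a : E} (hi : σ.IsBreak i)
    (ha : σ.letter (i - 1) = some (.direct a)) (h : ∃ j < i, σ.IsBreak j) :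
    ∃ j, σ.IsDirectLetter j i := by
  obtain ⟨j, ⟨hji, hj⟩, hmax⟩ := Int.exists_greatest_of_bdd
    (P := fun j => j < i ∧ σ.IsBreak j) ⟨i, fun z hz => hz.1.le⟩ (by
      obtain ⟨j, h⟩ := h
      exact ⟨j, h⟩)
  refine ⟨j, ⟨hji, hj, hi, fun k hjk hki hk => ?_⟩, ?_⟩
  · have := hmax k ⟨hki, hk⟩
    omega
  · suffices h' : ∀ m : ℕ, j ≤ i - 1 - m → ∃ a, σ.letter (i - 1 - m) = some (.direct a) by
      intro k hjk hki
      have := h' (i - 1 - k).toNat (by omega)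
      rwa [show i - 1 - ((i - 1 - k).toNat : ℤ) = k by omega] at this
    intro m
    induction m with
    | zero => intro _; exact ⟨a, by simpa using ha⟩
    | succ m ih =>
      intro hm
      obtain ⟨b, hb⟩ := ih (by omega)
      have hnb : ¬ σ.IsBreak (i - 1 - m) := fun hk => by
        have := hmax _ ⟨by omega, hk⟩
        omega
      obtain ⟨u, v, hu, hv, huv⟩ := exists_straight_of_not_isBreak (hσ.mem_pos hb) hnb
      rw [hb] at hv
      obtain rfl := Option.some.inj hv
      rw [show i - 1 - ((m + 1 : ℕ) : ℤ) = i - 1 - m - 1 by push_cast; ring]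
      rcases u with c | c
      · exact ⟨c, hu⟩
      · exact huv.elim

theorem IsWalk.exists_isInverseLetter (hσ : σ.IsWalk) {i : ℤ} {a : E} (hi : σ.IsBreak i)
    (ha : σ.letter i = some (.inverse a)) (h : ∃ j, i < j ∧ σ.IsBreak j) :
    ∃ j, σ.IsInverseLetter i j := by
  obtain ⟨j, ⟨hij, hj⟩, hmin⟩ := Int.exists_least_of_bdd
    (P := fun j => i < j ∧ σ.IsBreak j) ⟨i, fun z hz => hz.1.le⟩ h
  refine ⟨j, ⟨hij, hi, hj, fun k hik hkj hk => ?_⟩, ?_⟩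
  · have := hmin k ⟨hik, hk⟩
    omega
  · suffices h' : ∀ m : ℕ, i + m < j → ∃ a, σ.letter (i + m) = some (.inverse a) by
      intro k hik hkj
      have := h' (k - i).toNat (by omega)
      rwa [show i + ((k - i).toNat : ℤ) = k by omega] at this
    intro m
    induction m with
    | zero => intro _; exact ⟨a, by simpa using ha⟩
    | succ m ih =>
      intro hm
      obtain ⟨b, hb⟩ := ih (by omega)
      have hnb : ¬ σ.IsBreak (i + m + 1) := fun hk => by
        have := hmin _ ⟨by omega, hk⟩
        omega
      obtain ⟨u, v, hu, hv, huv⟩ := exists_straight_of_not_isBreak (hσ.mem_pos_succ hb) hnb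
      rw [show i + m + 1 - 1 = i + m by ring, hb] at hu
      obtain rfl := Option.some.inj hu
      rw [show i + ((m + 1 : ℕ) : ℤ) = i + m + 1 by push_cast; ring]
      rcases v with c | c
      · exact huv.elim
      · exact ⟨c, hv⟩

theorem IsHomotopyLetter.eq_left {i j j' : ℤ} (h : σ.IsHomotopyLetter j i)
    (h' : σ.IsHomotopyLetter j' i) : j = j' := by
  obtain ⟨h1, h2, -, h3⟩ := h
  obtain ⟨h1', h2', -, h3'⟩ := h'
  rcases lt_trichotomy j j' with hlt | rfl | hlt
  · exact absurd h2' (h3 _ hlt h1')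
  · rfl
  · exact absurd h2 (h3' _ hlt h1)

theorem IsHomotopyLetter.eq_right {i j j' : ℤ} (h : σ.IsHomotopyLetter i j)
    (h' : σ.IsHomotopyLetter i j') : j = j' := by
  obtain ⟨h1, -, h2, h3⟩ := h
  obtain ⟨h1', -, h2', h3'⟩ := h'
  rcases lt_trichotomy j j' with hlt | rfl | hlt
  · exact absurd h2 (h3' _ h1 hlt)
  · rfl
  · exact absurd h2' (h3 _ h1' hlt)

theorem IsDirectLetter.letter_left {i j : ℤ} (h : σ.IsDirectLetter j i) :
    ∃ a, σ.letter j = some (.direct a) := h.2 j le_rfl h.1.1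

theorem IsDirectLetter.letter_right {i j : ℤ} (h : σ.IsDirectLetter j i) :
    ∃ a, σ.letter (i - 1) = some (.direct a) :=
  h.2 (i - 1) (by have := h.1.1; omega) (by omega)

theorem IsInverseLetter.letter_left {i j : ℤ} (h : σ.IsInverseLetter i j) :
    ∃ a, σ.letter i = some (.inverse a) := h.2 i le_rfl h.1.1

theorem IsInverseLetter.letter_right {i j : ℤ} (h : σ.IsInverseLetter i j) :
    ∃ a, σ.letter (j - 1) = some (.inverse a) :=
  h.2 (j - 1) (by have := h.1.1; omega) (by omega)

/-- Consecutive letters inside of a direct homotopy letter do not form a relation. -/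
theorem IsDirectLetter.not_rel (hσ : σ.IsWalk) {i j k : ℤ} (h : σ.IsDirectLetter j i)
    (hj : j < k) (hk : k < i) {a b : E} (ha : σ.letter (k - 1) = some (.direct a))
    (hb : σ.letter k = some (.direct b)) : Q.s b = Q.t a ∧ ¬ Q.rel b a := by
  obtain ⟨u, v, hu, hv, huv⟩ :=
    exists_straight_of_not_isBreak (hσ.mem_pos hb) (h.1.2.2.2 k hj hk)
  rw [ha] at hu
  rw [hb] at hv
  obtain rfl := Option.some.inj hu
  obtain rfl := Option.some.inj hv
  exact huv

theorem IsInverseLetter.not_rel (hσ : σ.IsWalk) {i j k : ℤ} (h : σ.IsInverseLetter i j)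
    (hi : i < k) (hk : k < j) {a b : E} (ha : σ.letter (k - 1) = some (.inverse a))
    (hb : σ.letter k = some (.inverse b)) : Q.s a = Q.t b ∧ ¬ Q.rel a b := by
  obtain ⟨u, v, hu, hv, huv⟩ :=
    exists_straight_of_not_isBreak (hσ.mem_pos hb) (h.1.2.2.2 k hi hk)
  rw [ha] at hu
  rw [hb] at hv
  obtain rfl := Option.some.inj hu
  obtain rfl := Option.some.inj hv
  exact huv

theorem degree_self (p : ℤ) : σ.degree p p = 0 := by simp [degree]

theorem degree_succ (p i : ℤ) : σ.degree p (i + 1) = σ.degree p i + σ.step i := by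
  unfold degree
  rcases le_or_gt p i with h | h
  · rw [Finset.Ico_eq_empty (a := i + 1) (b := p) (by omega),
      Finset.Ico_eq_empty (a := i) (b := p) (by omega)]
    have : Finset.Ico p (i + 1) = insert i (Finset.Ico p i) := by ext; simp; omega
    rw [this, Finset.sum_insert (by simp)]
    ring
  · rw [Finset.Ico_eq_empty (a := p) (b := i + 1) (by omega),
      Finset.Ico_eq_empty (a := p) (b := i) (by omega)]
    have : Finset.Ico i p = insert i (Finset.Ico (i + 1) p) := by ext; simp; omega
    rw [this, Finset.sum_insert (by simp)]
    ring

/-- A function with the same increments as the degree computes it. -/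
theorem degree_eq_sub {g : ℤ → ℤ} {p q : ℤ}
    (hg : ∀ i, min p q ≤ i → i < max p q → g (i + 1) = g i + σ.step i) :
    σ.degree p q = g q - g p := by
  rcases le_total p q with h | h
  · obtain ⟨n, rfl⟩ : ∃ n : ℕ, q = p + n := ⟨(q - p).toNat, by omega⟩
    clear h
    induction n with
    | zero => simp [degree_self]
    | succ n ih =>
      have h1 := ih fun i hi hi' => hg i (by push_cast; omega) (by push_cast; omega)
      have h2 := hg (p + n) (by push_cast; omega) (by push_cast; omega)
      have h3 := σ.degree_succ p (p + n)
      push_cast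
      rw [← add_assoc, h3, h1, h2]
      ring
  · obtain ⟨n, rfl⟩ : ∃ n : ℕ, q = p - n := ⟨(p - q).toNat, by omega⟩
    clear h
    induction n with
    | zero => simp [degree_self]
    | succ n ih =>
      have h1 := ih fun i hi hi' => hg i (by push_cast; omega) (by push_cast; omega)
      have h2 := hg (p - n - 1) (by push_cast; omega) (by push_cast; omega)
      have h3 := σ.degree_succ p (p - n - 1)
      rw [sub_add_cancel] at h2 h3
      push_cast
      rw [← sub_sub]
      linarith

theorem step_of_not_isBreak {i : ℤ} (h : ¬ σ.IsBreak i) : σ.step i = 0 := if_neg h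

theorem step_direct {i : ℤ} (h : σ.IsBreak i) {a : E} (ha : σ.letter i = some (.direct a)) :
    σ.step i = -1 := by rw [step, if_pos h, ha]; rfl

theorem step_inverse {i : ℤ} (h : σ.IsBreak i) {a : E} (ha : σ.letter i = some (.inverse a)) :
    σ.step i = 1 := by rw [step, if_pos h, ha]; rfl

/-- The degree drops by one along a homotopy letter, in the direction of its arrows. -/
theorem IsDirectLetter.degree_eq {i j : ℤ} (h : σ.IsDirectLetter j i) (p : ℤ) :
    σ.degree p j = σ.degree p i + 1 := by
  suffices h' : ∀ m : ℕ, j + (m + 1) ≤ i → σ.degree p (j + (m + 1)) = σ.degree p j - 1 by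
    have := h' (i - j - 1).toNat (by have := h.1.1; omega)
    rw [show j + (((i - j - 1).toNat : ℤ) + 1) = i by have := h.1.1; omega] at this
    omega
  intro m
  induction m with
  | zero =>
    intro _
    obtain ⟨a, ha⟩ := h.letter_left
    have := σ.degree_succ p j
    rw [step_direct h.1.2.1 ha] at this
    simpa [sub_eq_add_neg] using this
  | succ m ih =>
    intro hm
    push_cast at hm ⊢
    rw [← add_assoc, σ.degree_succ, ih (by omega),
      step_of_not_isBreak (h.1.2.2.2 _ (by omega) (by omega)), add_zero]

theorem IsInverseLetter.degree_eq {i j : ℤ} (h : σ.IsInverseLetter i j) (p : ℤ) :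
    σ.degree p j = σ.degree p i + 1 := by
  suffices h' : ∀ m : ℕ, i + (m + 1) ≤ j → σ.degree p (i + (m + 1)) = σ.degree p i + 1 by
    have := h' (j - i - 1).toNat (by have := h.1.1; omega)
    rwa [show i + (((j - i - 1).toNat : ℤ) + 1) = j by have := h.1.1; omega] at this
  intro m
  induction m with
  | zero =>
    intro _
    obtain ⟨a, ha⟩ := h.letter_left
    have := σ.degree_succ p i
    rw [step_inverse h.1.2.1 ha] at this
    simpa using this
  | succ m ih =>
    intro hm
    push_cast at hm ⊢
    rw [← add_assoc, σ.degree_succ, ih (by omega),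
      step_of_not_isBreak (h.1.2.2.2 _ (by omega) (by omega)), add_zero]

/-! ### The paths along homotopy letters -/

variable {K : Type u} [Field K] [Fintype V]

theorem arrowAt_eq {i : ℤ} {u : Letter E} (h : σ.letter i = some u) :
    σ.arrowAt K i = Q.arrow K u.arrow := by
  rw [arrowAt, h]
  rfl

theorem directPath_mul_idem (i : ℤ) (n : ℕ) :
    σ.directPath K i n * Q.idem K (σ.vert i) = σ.directPath K i n := by
  induction n with
  | zero => exact idem_mul_idem K _
  | succ n ih => rw [directPath, mul_assoc, ih]

theorem idem_mul_inversePath (i : ℤ) (n : ℕ) :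
    Q.idem K (σ.vert i) * σ.inversePath K i n = σ.inversePath K i n := by
  induction n with
  | zero => exact idem_mul_idem K _
  | succ n ih => rw [inversePath, ← mul_assoc, ih]

theorem IsWalk.idem_mul_arrow_direct (hσ : σ.IsWalk) {i : ℤ} {a : E}
    (h : σ.letter i = some (.direct a)) :
    Q.idem K (σ.vert (i + 1)) * Q.arrow K a = Q.arrow K a := by
  rw [← hσ.tgt_eq i _ h]
  exact idem_mul_arrow a

theorem IsWalk.arrow_mul_idem_direct (hσ : σ.IsWalk) {i : ℤ} {a : E}
    (h : σ.letter i = some (.direct a)) :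
    Q.arrow K a * Q.idem K (σ.vert i) = Q.arrow K a := by
  rw [← hσ.src_eq i _ h]
  exact arrow_mul_idem_self a

theorem IsWalk.idem_mul_arrow_inverse (hσ : σ.IsWalk) {i : ℤ} {a : E}
    (h : σ.letter i = some (.inverse a)) :
    Q.idem K (σ.vert i) * Q.arrow K a = Q.arrow K a := by
  rw [← hσ.src_eq i _ h]
  exact idem_mul_arrow a

theorem IsWalk.arrow_mul_idem_inverse (hσ : σ.IsWalk) {i : ℤ} {a : E}
    (h : σ.letter i = some (.inverse a)) :
    Q.arrow K a * Q.idem K (σ.vert (i + 1)) = Q.arrow K a := by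
  rw [← hσ.tgt_eq i _ h]
  exact arrow_mul_idem_self a

theorem mul_directPath_eq_zero (hQ : Q.IsGentle K) (hσ : σ.IsWalk) {i j : ℤ}
    (h : σ.IsDirectLetter j i) (n : ℕ) (hn : j + (n + 1) ≤ i) (x : Q.BoundPathAlgebra K)
    (hx : x * σ.directPath K j (n + 1) = 0) : x * σ.arrowAt K (j + n) = 0 := by
  induction n generalizing x with
  | zero =>
    obtain ⟨a, ha⟩ := h.letter_left
    rw [directPath, directPath] at hx
    simp only [Nat.cast_zero, add_zero] at hx ⊢
    rw [arrowAt_eq ha, Letter.arrow, hσ.arrow_mul_idem_direct ha] at hx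
    rw [arrowAt_eq ha]
    exact hx
  | succ n ih =>
    rw [directPath, ← mul_assoc] at hx
    have h' := ih (by push_cast at hn; omega) _ hx
    obtain ⟨a, ha⟩ := h.2 (j + n) (by omega) (by push_cast at hn; omega)
    obtain ⟨b, hb⟩ := h.2 (j + (n + 1 : ℕ)) (by omega) (by push_cast at hn ⊢; omega)
    rw [arrowAt_eq ha, arrowAt_eq hb] at h'
    rw [arrowAt_eq hb]
    obtain ⟨h1, h2⟩ := h.not_rel hσ (k := j + (n + 1 : ℕ)) (by push_cast; omega)
      (by push_cast at hn ⊢; omega) (by rwa [show j + ((n + 1 : ℕ) : ℤ) - 1 = j + n by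
        push_cast; ring]) hb
    exact mul_arrow_eq_zero_of_mul hQ h1 h2 h'

theorem mul_inversePath_eq_zero (hQ : Q.IsGentle K) (hσ : σ.IsWalk) {i j : ℤ}
    (h : σ.IsInverseLetter i j) (n : ℕ) (hn : i + (n + 1) ≤ j) (x : Q.BoundPathAlgebra K)
    (hx : x * σ.inversePath K i (n + 1) = 0) : x * σ.arrowAt K i = 0 := by
  induction n with
  | zero =>
    obtain ⟨a, ha⟩ := h.letter_left
    rw [inversePath, inversePath] at hx
    simp only [Nat.cast_zero, add_zero] at hx
    rw [arrowAt_eq ha, Letter.arrow, hσ.idem_mul_arrow_inverse ha] at hx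
    rw [arrowAt_eq ha]
    exact hx
  | succ n ih =>
    refine ih (by push_cast at hn; omega) ?_
    obtain ⟨a, ha⟩ := h.2 (i + n) (by omega) (by push_cast at hn; omega)
    obtain ⟨b, hb⟩ := h.2 (i + (n + 1 : ℕ)) (by omega) (by push_cast at hn ⊢; omega)
    obtain ⟨h1, h2⟩ := h.not_rel hσ (k := i + (n + 1 : ℕ)) (by push_cast; omega)
      (by push_cast at hn ⊢; omega) (by rwa [show i + ((n + 1 : ℕ) : ℤ) - 1 = i + n by
        push_cast; ring]) hb
    rw [inversePath, inversePath, arrowAt_eq ha, arrowAt_eq hb, ← mul_assoc, ← mul_assoc] at hx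
    rw [inversePath, arrowAt_eq ha, ← mul_assoc]
    exact mul_arrow_eq_zero_of_mul hQ h1 h2 hx

theorem IsWalk.inversePath_mul_idem (hσ : σ.IsWalk) (i : ℤ) (n : ℕ)
    (h : ∀ k, i ≤ k → k < i + n → ∃ a, σ.letter k = some (.inverse a)) :
    σ.inversePath K i n * Q.idem K (σ.vert (i + n)) = σ.inversePath K i n := by
  cases n with
  | zero => simp [inversePath, idem_mul_idem]
  | succ n =>
    obtain ⟨a, ha⟩ := h (i + n) (by omega) (by push_cast; omega)
    rw [inversePath, mul_assoc, arrowAt_eq ha, Letter.arrow, Nat.cast_succ, ← add_assoc,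
      hσ.arrow_mul_idem_inverse ha]

theorem IsWalk.idem_mul_directPath (hσ : σ.IsWalk) (i : ℤ) (n : ℕ)
    (h : ∀ k, i ≤ k → k < i + n → ∃ a, σ.letter k = some (.direct a)) :
    Q.idem K (σ.vert (i + n)) * σ.directPath K i n = σ.directPath K i n := by
  cases n with
  | zero => simp [directPath, idem_mul_idem]
  | succ n =>
    obtain ⟨a, ha⟩ := h (i + n) (by omega) (by push_cast; omega)
    rw [directPath, ← mul_assoc, arrowAt_eq ha, Letter.arrow, Nat.cast_succ, ← add_assoc,
      hσ.idem_mul_arrow_direct ha]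

/-! ### Families of vectors along a walk -/

variable {N : Type*} [AddCommGroup N] [Module (Q.BoundPathAlgebra K) N]

/-- Moving a vector along a direct path, if every arrow moves it by one position, up to scalars. -/
theorem directPath_smul (X : ℤ → N) (lam : ℤ → K) (i : ℤ) (n : ℕ)
    (hi : Q.idem K (σ.vert i) • X i = X i)
    (h : ∀ k, i ≤ k → k < i + n → ∃ a, σ.letter k = some (.direct a) ∧
      Q.arrow K a • X k = algebraMap K (Q.BoundPathAlgebra K) (lam k) • X (k + 1)) :
    σ.directPath K i n • X i =
      algebraMap K (Q.BoundPathAlgebra K) (∏ t ∈ Finset.range n, lam (i + t)) • X (i + n) := by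
  induction n with
  | zero => simpa [directPath] using hi
  | succ n ih =>
    obtain ⟨a, ha, h'⟩ := h (i + n) (by omega) (by push_cast; omega)
    rw [directPath, mul_smul, ih fun k hk hk' => h k hk (by push_cast; omega), arrowAt_eq ha,
      algebraMap_smul_comm]
    change _ • Q.arrow K a • _ = _
    rw [h', ← mul_smul, ← map_mul, Finset.prod_range_succ]
    congr 2
    push_cast
    ring

theorem inversePath_smul (X : ℤ → N) (i : ℤ) (n : ℕ)
    (hi : Q.idem K (σ.vert i) • X i = X i)
    (h : ∀ k, i ≤ k → k < i + n → ∃ a, σ.letter k = some (.inverse a) ∧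
      Q.arrow K a • X (k + 1) = X k) : σ.inversePath K i n • X (i + n) = X i := by
  induction n with
  | zero => simpa [inversePath] using hi
  | succ n ih =>
    obtain ⟨a, ha, h'⟩ := h (i + n) (by omega) (by push_cast; omega)
    rw [inversePath, mul_smul, arrowAt_eq ha, Nat.cast_succ, ← add_assoc]
    change _ • Q.arrow K a • _ = _
    rw [h', ih fun k hk hk' => h k hk (by push_cast; omega)]

end Word

end Words

section HomotopyLetters

variable {V E : Type u} {Q : BoundQuiver V E}

namespace Word

variable {σ : Word Q}

variable (σ) in
/-- There is a homotopy letter that starts at the position `i`, to the right for `s = false` and to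
the left for `s = true`. -/
def HasLetter (i : ℤ) (s : Bool) : Prop :=
  if s then ∃ j, σ.IsInverseLetter i j else ∃ j, σ.IsDirectLetter j i

variable (σ) in
open scoped Classical in
/-- The end of the homotopy letter that starts at the position `i` to the side `s`. -/
noncomputable def letterEnd (i : ℤ) (s : Bool) : ℤ :=
  if s then if h : ∃ j, σ.IsInverseLetter i j then h.choose else i
  else if h : ∃ j, σ.IsDirectLetter j i then h.choose else i

theorem hasLetter_true {i : ℤ} : σ.HasLetter i true ↔ ∃ j, σ.IsInverseLetter i j := by
  simp [HasLetter]

theorem hasLetter_false {i : ℤ} : σ.HasLetter i false ↔ ∃ j, σ.IsDirectLetter j i := by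
  simp [HasLetter]

theorem IsInverseLetter.letterEnd_eq {i j : ℤ} (h : σ.IsInverseLetter i j) :
    σ.letterEnd i true = j := by
  have h' : ∃ j, σ.IsInverseLetter i j := ⟨j, h⟩
  rw [letterEnd, if_pos rfl, dif_pos h']
  exact h'.choose_spec.1.eq_right h.1

theorem IsDirectLetter.letterEnd_eq {i j : ℤ} (h : σ.IsDirectLetter j i) :
    σ.letterEnd i false = j := by
  have h' : ∃ j, σ.IsDirectLetter j i := ⟨j, h⟩
  rw [letterEnd, if_neg (by simp), dif_pos h']
  exact h'.choose_spec.1.eq_left h.1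

theorem HasLetter.isInverseLetter {i : ℤ} (h : σ.HasLetter i true) :
    σ.IsInverseLetter i (σ.letterEnd i true) := by
  obtain ⟨j, hj⟩ := hasLetter_true.1 h
  rwa [hj.letterEnd_eq]

theorem HasLetter.isDirectLetter {i : ℤ} (h : σ.HasLetter i false) :
    σ.IsDirectLetter (σ.letterEnd i false) i := by
  obtain ⟨j, hj⟩ := hasLetter_false.1 h
  rwa [hj.letterEnd_eq]

end Word

end HomotopyLetters

/-! ### Vectors spread along a walk -/

section Families

variable {V E : Type u} {Q : BoundQuiver V E} {K : Type u} [Field K] [Fintype V]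

namespace Word

variable {σ : Word Q} {N : Type*} [AddCommGroup N] [Module (Q.BoundPathAlgebra K) N]

variable (σ) in
open scoped Classical in
/-- Starting from the value of `B` at a position reached from `i` by following at most `n` direct
letters backwards, the vector at the position `i` obtained by acting with these letters; the action
of the letter at position `k` is divided by `lam k`. -/
noncomputable def ascend (lam : ℤ → K) (B : ℤ → N) : ℕ → ℤ → N
  | 0, i => B i
  | n + 1, i =>
    if h : ∃ a, σ.letter (i - 1) = some (.direct a) then
      algebraMap K (Q.BoundPathAlgebra K) (lam (i - 1))⁻¹ •
        Q.arrow K h.choose • ascend lam B n (i - 1)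
    else B i

variable (σ K) in
open scoped Classical in
/-- The analogue of `Word.ascend` for the inverse letters that follow the position `i`. -/
noncomputable def descend (B : ℤ → N) : ℕ → ℤ → N
  | 0, i => B i
  | n + 1, i =>
    if h : ∃ a, σ.letter i = some (.inverse a) then Q.arrow K h.choose • descend B n (i + 1)
    else B i

theorem ascend_succ_of_direct (lam : ℤ → K) (B : ℤ → N) (n : ℕ) {i : ℤ} {a : E}
    (h : σ.letter (i - 1) = some (.direct a)) : σ.ascend lam B (n + 1) i =
      algebraMap K (Q.BoundPathAlgebra K) (lam (i - 1))⁻¹ •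
        Q.arrow K a • σ.ascend lam B n (i - 1) := by
  have h' : ∃ a, σ.letter (i - 1) = some (.direct a) := ⟨a, h⟩
  have e : h'.choose = a := Letter.direct.inj (Option.some.inj (h'.choose_spec.symm.trans h))
  rw [ascend, dif_pos h', e]

theorem ascend_of_not_direct (lam : ℤ → K) (B : ℤ → N) (n : ℕ) {i : ℤ}
    (h : ∀ a, σ.letter (i - 1) ≠ some (.direct a)) : σ.ascend lam B n i = B i := by
  cases n with
  | zero => rfl
  | succ n => exact dif_neg fun ⟨a, ha⟩ => h a ha

theorem descend_succ_of_inverse (B : ℤ → N) (n : ℕ) {i : ℤ} {a : E}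
    (h : σ.letter i = some (.inverse a)) :
    σ.descend K B (n + 1) i = Q.arrow K a • σ.descend K B n (i + 1) := by
  have h' : ∃ a, σ.letter i = some (.inverse a) := ⟨a, h⟩
  have e : h'.choose = a := Letter.inverse.inj (Option.some.inj (h'.choose_spec.symm.trans h))
  rw [descend, dif_pos h', e]

theorem descend_of_not_inverse (B : ℤ → N) (n : ℕ) {i : ℤ}
    (h : ∀ a, σ.letter i ≠ some (.inverse a)) : σ.descend K B n i = B i := by
  cases n with
  | zero => rfl
  | succ n => exact dif_neg fun ⟨a, ha⟩ => h a ha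

theorem ascend_succ (lam : ℤ → K) (B : ℤ → N) (n : ℕ) (i : ℤ)
    (h : ∃ k < n, ∀ a, σ.letter (i - k - 1) ≠ some (.direct a)) :
    σ.ascend lam B (n + 1) i = σ.ascend lam B n i := by
  induction n generalizing i with
  | zero => obtain ⟨k, hk, -⟩ := h; omega
  | succ n ih =>
    obtain ⟨k, hk, h⟩ := h
    by_cases h' : ∃ a, σ.letter (i - 1) = some (.direct a)
    · obtain ⟨a, ha⟩ := h'
      rw [ascend_succ_of_direct lam B _ ha, ascend_succ_of_direct lam B _ ha, ih]
      have hk0 : k ≠ 0 := by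
        rintro rfl
        exact h a (by simpa using ha)
      refine ⟨k - 1, by omega, fun b => ?_⟩
      rw [show i - 1 - ((k - 1 : ℕ) : ℤ) - 1 = i - k - 1 by omega]
      exact h b
    · push Not at h'
      rw [ascend_of_not_direct lam B _ h', ascend_of_not_direct lam B _ h']

theorem descend_succ (B : ℤ → N) (n : ℕ) (i : ℤ)
    (h : ∃ k < n, ∀ a, σ.letter (i + k) ≠ some (.inverse a)) :
    σ.descend K B (n + 1) i = σ.descend K B n i := by
  induction n generalizing i with
  | zero => obtain ⟨k, hk, -⟩ := h; omega
  | succ n ih =>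
    obtain ⟨k, hk, h⟩ := h
    by_cases h' : ∃ a, σ.letter i = some (.inverse a)
    · obtain ⟨a, ha⟩ := h'
      rw [descend_succ_of_inverse B _ ha, descend_succ_of_inverse B _ ha, ih]
      have hk0 : k ≠ 0 := by
        rintro rfl
        exact h a (by simpa using ha)
      refine ⟨k - 1, by omega, fun b => ?_⟩
      rw [show i + 1 + ((k - 1 : ℕ) : ℤ) = i + k by omega]
      exact h b
    · push Not at h'
      rw [descend_of_not_inverse B _ h', descend_of_not_inverse B _ h']

/-- Vectors at the peaks of a walk spread along the walk, if the lengths of the runs of direct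
letters and of inverse letters are bounded. At the remaining positions, where a direct letter is
followed by an inverse one, the vector is determined by the direct letter. -/
theorem exists_family (hsrc : ∀ i u, σ.letter i = some u → u.src Q = σ.vert i)
    (htgt : ∀ i u, σ.letter i = some u → u.tgt Q = σ.vert (i + 1)) (n : ℕ)
    (hd : ∀ i, ∃ k < n, ∀ a, σ.letter (i - k - 1) ≠ some (.direct a))
    (hi : ∀ i, ∃ k < n, ∀ a, σ.letter (i + k) ≠ some (.inverse a))
    (lam : ℤ → K) (hlam : ∀ i, lam i ≠ 0) (B : ℤ → N)
    (hB : ∀ i, Q.idem K (σ.vert i) • B i = B i) (m : ℤ)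
    (hm : ∀ i, σ.letter (i + m) = σ.letter i) (hlm : ∀ i, lam (i + m) = lam i)
    (hBm : ∀ i, B (i + m) = B i) :
    ∃ Y : ℤ → N, (∀ i, Q.idem K (σ.vert i) • Y i = Y i) ∧
      (∀ i, (∀ a, σ.letter (i - 1) ≠ some (.direct a)) →
        (∀ a, σ.letter i ≠ some (.inverse a)) → Y i = B i) ∧
      (∀ i a, σ.letter i = some (.direct a) →
        Q.arrow K a • Y i = algebraMap K (Q.BoundPathAlgebra K) (lam i) • Y (i + 1)) ∧
      (∀ i a, σ.letter i = some (.inverse a) → (∀ b, σ.letter (i - 1) ≠ some (.direct b)) →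
        Q.arrow K a • Y (i + 1) = Y i) ∧ ∀ i, Y (i + m) = Y i := by
  classical
  -- by the bounds on the runs, `n` steps always reach the end of the run, so that the recursion
  -- equations hold for the same `n` on both sides
  let Y : ℤ → N := fun i => if ∃ a, σ.letter (i - 1) = some (.direct a) then σ.ascend lam B n i
    else σ.descend K B n i
  have hYd : ∀ i a, σ.letter (i - 1) = some (.direct a) → Y i = σ.ascend lam B n i :=
    fun i a ha => if_pos ⟨a, ha⟩
  have hYi : ∀ i, (∀ a, σ.letter (i - 1) ≠ some (.direct a)) → Y i = σ.descend K B n i :=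
    fun i h => if_neg fun ⟨a, ha⟩ => h a ha
  refine ⟨Y, ?_, ?_, ?_, ?_, ?_⟩
  · have h1 : ∀ k i, Q.idem K (σ.vert i) • σ.ascend lam B k i = σ.ascend lam B k i := by
      intro k i
      by_cases h : ∃ a, σ.letter (i - 1) = some (.direct a)
      · obtain ⟨a, ha⟩ := h
        cases k with
        | zero => exact hB i
        | succ k =>
          have := htgt _ _ ha
          rw [sub_add_cancel] at this
          rw [ascend_succ_of_direct lam B k ha, algebraMap_smul_comm, ← mul_smul (Q.idem K _),
            ← this]
          congr 2
          exact idem_mul_arrow a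
      · push Not at h
        rw [ascend_of_not_direct lam B k h, hB]
    have h2 : ∀ k i, Q.idem K (σ.vert i) • σ.descend K B k i = σ.descend K B k i := by
      intro k i
      by_cases h : ∃ a, σ.letter i = some (.inverse a)
      · obtain ⟨a, ha⟩ := h
        cases k with
        | zero => exact hB i
        | succ k =>
          rw [descend_succ_of_inverse B k ha, ← mul_smul (Q.idem K _), ← hsrc _ _ ha]
          congr 1
          exact idem_mul_arrow a
      · push Not at h
        rw [descend_of_not_inverse B k h, hB]
    intro i
    by_cases h : ∃ a, σ.letter (i - 1) = some (.direct a)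
    · obtain ⟨a, ha⟩ := h
      rw [hYd i a ha, h1]
    · push Not at h
      rw [hYi i h, h2]
  · intro i h h'
    rw [hYi i h, descend_of_not_inverse B n h']
  · intro i a ha
    have ha' : σ.letter (i + 1 - 1) = some (.direct a) := by rwa [add_sub_cancel_right]
    have hni : ∀ b, σ.letter i ≠ some (.inverse b) := by
      intro b hb
      rw [ha] at hb
      cases hb
    have h1 : Y i = σ.ascend lam B n i := by
      by_cases h : ∃ a, σ.letter (i - 1) = some (.direct a)
      · obtain ⟨b, hb⟩ := h
        exact hYd i b hb
      · push Not at h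
        rw [hYi i h, descend_of_not_inverse B n hni, ascend_of_not_direct lam B n h]
    rw [hYd _ a ha', ← ascend_succ lam B n (i + 1) (hd _), ascend_succ_of_direct lam B n ha',
      add_sub_cancel_right, ← mul_smul, ← map_mul, mul_inv_cancel₀ (hlam i), map_one, one_smul, h1]
  · intro i a ha h
    have h1 : ∀ b, σ.letter (i + 1 - 1) ≠ some (.direct b) := by
      intro b hb
      rw [add_sub_cancel_right, ha] at hb
      cases hb
    rw [hYi i h, hYi _ h1, ← descend_succ B n i (hi _), descend_succ_of_inverse B n ha]
  · have e : ∀ i, σ.letter (i + m - 1) = σ.letter (i - 1) := fun i => by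
      rw [← hm (i - 1)]
      congr 1
      ring
    have h1 : ∀ k i, σ.ascend lam B k (i + m) = σ.ascend lam B k i := by
      intro k
      induction k with
      | zero => exact hBm
      | succ k ih =>
        intro i
        by_cases h : ∃ a, σ.letter (i - 1) = some (.direct a)
        · obtain ⟨a, ha⟩ := h
          rw [ascend_succ_of_direct lam B k ha, ascend_succ_of_direct lam B k ((e i).trans ha),
            show i + m - 1 = i - 1 + m by ring, hlm, ih]
        · push Not at h
          rw [ascend_of_not_direct lam B _ h, ascend_of_not_direct lam B _ (by simpa [e] using h),
            hBm]
    have h2 : ∀ k i, σ.descend K B k (i + m) = σ.descend K B k i := by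
      intro k
      induction k with
      | zero => exact hBm
      | succ k ih =>
        intro i
        by_cases h : ∃ a, σ.letter i = some (.inverse a)
        · obtain ⟨a, ha⟩ := h
          rw [descend_succ_of_inverse B k ha, descend_succ_of_inverse B k ((hm i).trans ha),
            show i + m + 1 = i + 1 + m by ring, ih]
        · push Not at h
          rw [descend_of_not_inverse B _ h, descend_of_not_inverse B _ (by simpa [hm] using h),
            hBm]
    intro i
    by_cases h : ∃ a, σ.letter (i - 1) = some (.direct a)
    · obtain ⟨a, ha⟩ := h
      rw [hYd i a ha, hYd _ a ((e i).trans ha), h1]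
    · push Not at h
      rw [hYi i h, hYi _ (by simpa [e] using h), h2]

/-! ### Complexes given by walks -/

variable (σ K) in
/-- The path given by the homotopy letter that starts at the position `i` to the side `s`. -/
noncomputable def letterPath (i : ℤ) (s : Bool) : Q.BoundPathAlgebra K :=
  if s then σ.inversePath K i (σ.letterEnd i true - i).toNat
  else σ.directPath K (σ.letterEnd i false) (i - σ.letterEnd i false).toNat

theorem letterPath_true (i : ℤ) :
    σ.letterPath K i true = σ.inversePath K i (σ.letterEnd i true - i).toNat := rfl

theorem letterPath_false (i : ℤ) : σ.letterPath K i false =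
    σ.directPath K (σ.letterEnd i false) (i - σ.letterEnd i false).toNat := rfl

open scoped Classical in
theorem component_eq (i j : ℤ) : σ.component K i j =
    ∑ s, if σ.HasLetter i s ∧ σ.letterEnd i s = j then σ.letterPath K i s else 0 := by
  rw [Fintype.sum_bool, component]
  by_cases h1 : σ.IsDirectLetter j i
  · rw [if_pos h1, if_pos (c := σ.HasLetter i false ∧ _) ⟨hasLetter_false.2 ⟨j, h1⟩,
      h1.letterEnd_eq⟩, if_neg, zero_add, letterPath_false, h1.letterEnd_eq]
    rintro ⟨h2, rfl⟩
    have h3 := h1.1.1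
    have h4 := h2.isInverseLetter.1.1
    omega
  · rw [if_neg h1, if_neg (c := σ.HasLetter i false ∧ _), add_zero]
    · by_cases h2 : σ.IsInverseLetter i j
      · rw [if_pos h2, if_pos ⟨hasLetter_true.2 ⟨j, h2⟩, h2.letterEnd_eq⟩, letterPath_true,
          h2.letterEnd_eq]
      · rw [if_neg h2, if_neg]
        rintro ⟨h3, rfl⟩
        exact h2 h3.isInverseLetter
    · rintro ⟨h3, rfl⟩
      exact h1 h3.isDirectLetter

theorem IsWalk.letterPath_mul_idem (hσ : σ.IsWalk) {i : ℤ} {s : Bool} (h : σ.HasLetter i s) :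
    σ.letterPath K i s * Q.idem K (σ.vert (σ.letterEnd i s)) = σ.letterPath K i s := by
  cases s with
  | false => exact directPath_mul_idem _ _
  | true =>
    have h' := h.isInverseLetter
    have e : i + ((σ.letterEnd i true - i).toNat : ℤ) = σ.letterEnd i true := by
      have := h'.1.1
      omega
    have := hσ.inversePath_mul_idem (K := K) i (σ.letterEnd i true - i).toNat fun k hk hk' =>
      h'.2 k hk (by omega)
    rwa [e] at this

theorem IsWalk.idem_mul_letterPath (hσ : σ.IsWalk) {i : ℤ} {s : Bool} (h : σ.HasLetter i s) :
    Q.idem K (σ.vert i) * σ.letterPath K i s = σ.letterPath K i s := by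
  cases s with
  | true => exact idem_mul_inversePath _ _
  | false =>
    have h' := h.isDirectLetter
    have e : σ.letterEnd i false + ((i - σ.letterEnd i false).toNat : ℤ) = i := by
      have := h'.1.1
      omega
    have := hσ.idem_mul_directPath (K := K) (σ.letterEnd i false)
      (i - σ.letterEnd i false).toNat fun k hk hk' => h'.2 k hk (by omega)
    rwa [e] at this

variable (σ) in
/-- The first letter of the path given by a homotopy letter starting at `i`. -/
noncomputable def firstLetter (i : ℤ) (s : Bool) : Option (Letter E) :=
  if s then σ.letter (σ.letterEnd i true - 1) else σ.letter (σ.letterEnd i false)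

variable (σ) in
/-- The last letter of the path given by a homotopy letter starting at `i`. -/
def lastLetter (i : ℤ) (s : Bool) : Option (Letter E) :=
  if s then σ.letter i else σ.letter (i - 1)

theorem IsWalk.letterPath_eq_mul (hσ : σ.IsWalk) {i : ℤ} {s : Bool} (h : σ.HasLetter i s) :
    ∃ a y, σ.firstLetter i s = some (if s then .inverse a else .direct a) ∧
      σ.letterPath K i s = y * Q.arrow K a := by
  cases s with
  | true =>
    have h' := h.isInverseLetter
    obtain ⟨a, ha⟩ := h'.letter_right
    obtain ⟨n, hn⟩ : ∃ n : ℕ, (σ.letterEnd i true - i).toNat = n + 1 :=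
      ⟨(σ.letterEnd i true - i).toNat - 1, by have := h'.1.1; omega⟩
    refine ⟨a, σ.inversePath K i n, ha, ?_⟩
    rw [letterPath_true, hn, inversePath, arrowAt_eq (u := .inverse a)]
    · rfl
    · rw [← ha]
      congr 1
      omega
  | false =>
    have h' := h.isDirectLetter
    obtain ⟨a, ha⟩ := h'.letter_left
    obtain ⟨n, hn⟩ : ∃ n : ℕ, (i - σ.letterEnd i false).toNat = n + 1 :=
      ⟨(i - σ.letterEnd i false).toNat - 1, by have := h'.1.1; omega⟩
    obtain ⟨y, hy⟩ := σ.directPath_succ (K := K) (σ.letterEnd i false) n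
    refine ⟨a, y, ha, ?_⟩
    rw [letterPath_false, hn, hy, mul_assoc, arrowAt_eq ha]
    congr 1
    exact hσ.arrow_mul_idem_direct ha

theorem IsWalk.mul_letterPath_eq_zero (hσ : σ.IsWalk) (hQ : Q.IsGentle K) {i : ℤ} {s : Bool}
    (h : σ.HasLetter i s) {u : Letter E} (hu : σ.lastLetter i s = some u)
    (x : Q.BoundPathAlgebra K) (hx : x * σ.letterPath K i s = 0) :
    x * Q.arrow K u.arrow = 0 := by
  cases s with
  | true =>
    have h' := h.isInverseLetter
    obtain ⟨n, hn⟩ : ∃ n : ℕ, (σ.letterEnd i true - i).toNat = n + 1 :=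
      ⟨(σ.letterEnd i true - i).toNat - 1, by have := h'.1.1; omega⟩
    rw [letterPath_true, hn] at hx
    rw [← arrowAt_eq hu]
    exact mul_inversePath_eq_zero hQ hσ h' n (by have := h'.1.1; omega) x hx
  | false =>
    have h' := h.isDirectLetter
    obtain ⟨n, hn⟩ : ∃ n : ℕ, (i - σ.letterEnd i false).toNat = n + 1 :=
      ⟨(i - σ.letterEnd i false).toNat - 1, by have := h'.1.1; omega⟩
    rw [letterPath_false, hn] at hx
    have := mul_directPath_eq_zero hQ hσ h' n (by have := h'.1.1; omega) x hx
    rwa [show σ.letterEnd i false + (n : ℤ) = i - 1 by have := h'.1.1; omega,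
      arrowAt_eq hu] at this

variable (σ) in
/-- The summands of a complex of projectives represent the breaks of the walk `σ`: the summand `i`
represents the position `val i`, and `rep k j` says that the summand `j` represents the position
`k`. In the complex of a homotopy string every break is a summand of its own; in the complex of a
band the positions are identified modulo the length of the band. -/
structure Covering (S : ProjSystem Q K) where
  val : S.ι → ℤ
  rep : ℤ → S.ι → Prop
  scal : ℤ → ℤ → K
  vert_eq : ∀ i, S.vert i = σ.vert (val i)
  exists_rep : ∀ k, σ.IsBreak k → ∃ j, rep k j
  rep_unique : ∀ {k j j'}, rep k j → rep k j' → j = j'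
  rep_letter : ∀ {k j}, rep k j → σ.letter k = σ.letter (val j)
  rep_letter' : ∀ {k j}, rep k j → σ.letter (k - 1) = σ.letter (val j - 1)
  rep_deg : ∀ {i j s}, σ.HasLetter (val i) s → rep (σ.letterEnd (val i) s) j →
    S.deg j = S.deg i + 1
  rep_inj : ∀ {i i' j s}, σ.HasLetter (val i) s → σ.HasLetter (val i') s →
    rep (σ.letterEnd (val i) s) j → rep (σ.letterEnd (val i') s) j → i = i'
  scal_ne : ∀ i j, scal i j ≠ 0
  coef_eq : ∀ i j, S.coef i j * Q.idem K (S.vert j) = ∑ s, open scoped Classical in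
    if σ.HasLetter (val i) s ∧ rep (σ.letterEnd (val i) s) j then
      scal (val i) (σ.letterEnd (val i) s) • σ.letterPath K (val i) s else 0

namespace Covering

variable {S : ProjSystem Q K} (C : σ.Covering S)

/-- The homotopy letters of a walk as homotopy letters of the associated complex. -/
noncomputable def outgoing (hσ : σ.IsWalk) (hQ : Q.IsGentle K) : S.Outgoing where
  out i s j := σ.HasLetter (C.val i) s ∧ C.rep (σ.letterEnd (C.val i) s) j
  map i s := C.scal (C.val i) (σ.letterEnd (C.val i) s) • σ.letterPath K (C.val i) s
  first i s a := σ.firstLetter (C.val i) s = some (if s then .inverse a else .direct a)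
  last i s a := σ.lastLetter (C.val i) s = some (if s then .inverse a else .direct a)
  out_unique h h' := C.rep_unique h.2 h'.2
  deg_eq h := C.rep_deg h.1 h.2
  idem_mul_map {i s j} h := by
    rw [mul_smul_comm, C.vert_eq, hσ.idem_mul_letterPath h.1]
  coef_eq i j := by convert C.coef_eq i j
  exists_first {i s j} h := by
    obtain ⟨a, y, ha, hy⟩ := hσ.letterPath_eq_mul (K := K) h.1
    exact ⟨a, C.scal (C.val i) (σ.letterEnd (C.val i) s) • y, ha, by rw [hy, smul_mul_assoc]⟩
  first_ne {i s i' s' j a a'} h h' hne ha ha' := by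
    -- two letters arriving at a peak from different sides do so with different arrows, as the walk
    -- is reduced
    have key : ∀ {i i' b b'}, σ.HasLetter (C.val i) true → σ.HasLetter (C.val i') false →
        C.rep (σ.letterEnd (C.val i) true) j → C.rep (σ.letterEnd (C.val i') false) j →
        σ.firstLetter (C.val i) true = some (.inverse b) →
        σ.firstLetter (C.val i') false = some (.direct b') → b ≠ b' := by
      intro i i' b b' _ _ hr hr' hb hb' hbb
      have h1 : σ.letter (C.val j - 1) = some (.inverse b) := (C.rep_letter' hr).symm.trans hb
      have h2 : σ.letter (C.val j - 1 + 1) = some (.direct b') := by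
        rw [sub_add_cancel]
        exact (C.rep_letter hr').symm.trans hb'
      exact (hσ.adjacent _ _ _ h1 h2).2 (by rw [hbb]; rfl)
    -- letters on the same side of their sources have the same source by `rep_inj`
    cases s <;> cases s'
    · exact absurd (by rw [C.rep_inj h.1 h'.1 h.2 h'.2]) hne
    · exact (key h'.1 h.1 h'.2 h.2 ha' ha).symm
    · exact key h.1 h'.1 h.2 h'.2 ha ha'
    · exact absurd (by rw [C.rep_inj h.1 h'.1 h.2 h'.2]) hne
  exists_last {i s j} h := by
    cases s with
    | true => exact h.1.isInverseLetter.letter_left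
    | false => exact h.1.isDirectLetter.letter_right
  t_last {i s j a} h ha := by
    rw [C.vert_eq]
    cases s with
    | true => exact hσ.src_eq _ _ ha
    | false =>
      have := hσ.tgt_eq _ _ ha
      rwa [sub_add_cancel] at this
  cancel {i s j a} h ha x hx := by
    rw [mul_smul_comm] at hx
    have := hσ.mul_letterPath_eq_zero hQ h.1 ha x ((smul_eq_zero_iff_right (C.scal_ne _ _)).1 hx)
    cases s <;> exact this
  last_ne {i j j' a a'} h h' ha ha' haa := by
    have h2 : σ.letter (C.val i - 1 + 1) = some (.inverse a) := by
      rw [sub_add_cancel]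
      exact ha
    exact (hσ.adjacent _ _ _ ha' h2).2 (by rw [haa]; rfl)

variable {M : Type*} [AddCommGroup M] [Module (Q.BoundPathAlgebra K) M]

theorem eval_of_not (hσ : σ.IsWalk) (hQ : Q.IsGentle K) (F : S.ι → M) {i : S.ι} {s : Bool}
    (h : ¬ σ.HasLetter (C.val i) s) : (C.outgoing hσ hQ).eval F i s = 0 :=
  (C.outgoing hσ hQ).eval_of_not F fun _ hj => h hj.1

/-- The contribution of a direct homotopy letter to the relation at its source, for generators that
are multiples of vectors in a family along the walk. -/
theorem eval_direct (hσ : σ.IsWalk) (hQ : Q.IsGentle K) (F : S.ι → M) (X : ℤ → M)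
    (lam om : ℤ → K) {i j : S.ι} {k : ℤ} (h : σ.IsDirectLetter k (C.val i)) (hr : C.rep k j)
    (hF : F j = algebraMap K (Q.BoundPathAlgebra K) (om k) • X k)
    (hXk : Q.idem K (σ.vert k) • X k = X k)
    (hX : ∀ l, k ≤ l → l < C.val i → ∀ a, σ.letter l = some (.direct a) →
      Q.arrow K a • X l = algebraMap K (Q.BoundPathAlgebra K) (lam l) • X (l + 1))
    (hom : C.scal (C.val i) k * om k * ∏ t ∈ Finset.range (C.val i - k).toNat, lam (k + t) =
      om (C.val i)) :
    (C.outgoing hσ hQ).eval F i false =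
      algebraMap K (Q.BoundPathAlgebra K) (om (C.val i)) • X (C.val i) := by
  have h' : σ.HasLetter (C.val i) false := hasLetter_false.2 ⟨k, h⟩
  have hlt := h.1.1
  have e : k + ((C.val i - k).toNat : ℤ) = C.val i := by omega
  rw [(C.outgoing hσ hQ).eval_of_out F (j := j) ⟨h', by rwa [h.letterEnd_eq]⟩]
  change (C.scal (C.val i) (σ.letterEnd (C.val i) false) • σ.letterPath K (C.val i) false) • F j = _
  rw [letterPath_false, h.letterEnd_eq, smul_eq_algebraMap_smul, hF, algebraMap_smul_comm,
    directPath_smul X lam k _ hXk fun l hl hl' => ?_, ← mul_smul, ← map_mul, ← mul_smul,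
    ← map_mul, e, hom]
  obtain ⟨a, ha⟩ := h.2 l hl (by omega)
  exact ⟨a, ha, hX l hl (by omega) a ha⟩

/-- The contribution of an inverse homotopy letter to the relation at its source. -/
theorem eval_inverse (hσ : σ.IsWalk) (hQ : Q.IsGentle K) (F : S.ι → M) (X : ℤ → M)
    (om : ℤ → K) {i j : S.ι} {k : ℤ} (h : σ.IsInverseLetter (C.val i) k) (hr : C.rep k j)
    (hF : F j = algebraMap K (Q.BoundPathAlgebra K) (om k) • X k)
    (hXi : Q.idem K (σ.vert (C.val i)) • X (C.val i) = X (C.val i))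
    (hX : ∀ l, C.val i ≤ l → l < k → ∀ a, σ.letter l = some (.inverse a) →
      Q.arrow K a • X (l + 1) = X l)
    (hom : C.scal (C.val i) k * om k = - om (C.val i)) :
    (C.outgoing hσ hQ).eval F i true =
      - (algebraMap K (Q.BoundPathAlgebra K) (om (C.val i)) • X (C.val i)) := by
  have h' : σ.HasLetter (C.val i) true := hasLetter_true.2 ⟨k, h⟩
  have hlt := h.1.1
  have e : C.val i + ((k - C.val i).toNat : ℤ) = k := by omega
  rw [(C.outgoing hσ hQ).eval_of_out F (j := j) ⟨h', by rwa [h.letterEnd_eq]⟩]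
  change (C.scal (C.val i) (σ.letterEnd (C.val i) true) • σ.letterPath K (C.val i) true) • F j = _
  have := inversePath_smul X (C.val i) (k - C.val i).toNat hXi fun l hl hl' => by
    obtain ⟨a, ha⟩ := h.2 l hl (by omega)
    exact ⟨a, ha, hX l hl (by omega) a ha⟩
  rw [e] at this
  rw [letterPath_true, h.letterEnd_eq, smul_eq_algebraMap_smul, hF, algebraMap_smul_comm,
    this, ← mul_smul, ← map_mul, hom, map_neg, neg_smul]

end Covering

end Word

end Families

/-! ### The homotopy string of a string -/

section StringWords

theorem exists_append_dropWhile {α : Type*} (p : α → Bool) (l : List α) :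
    ∃ m, l = m ++ l.dropWhile p ∧ (∀ x ∈ m, p x = true) ∧
      ∀ x ∈ (l.dropWhile p).head?, p x = false := by
  refine ⟨l.takeWhile p, List.takeWhile_append_dropWhile.symm,
    fun x hx => List.mem_takeWhile_imp hx, fun x hx => ?_⟩
  have := List.head?_dropWhile_not p l
  rw [Option.mem_def.1 hx] at this
  exact this

theorem exists_rdropWhile_append {α : Type*} (p : α → Bool) (l : List α) :
    ∃ m, l = l.rdropWhile p ++ m ∧ (∀ x ∈ m, p x = true) ∧
      ∀ x ∈ (l.rdropWhile p).getLast?, p x = false := by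
  obtain ⟨m, h1, h2, h3⟩ := exists_append_dropWhile p l.reverse
  refine ⟨m.reverse, ?_, fun x hx => h2 x (List.mem_reverse.1 hx), fun x hx => h3 x ?_⟩
  · rw [List.rdropWhile, ← List.reverse_append, ← h1, List.reverse_reverse]
  · rwa [List.rdropWhile, List.getLast?_reverse] at hx

variable {V E : Type u} {Q : BoundQuiver V E}

theorem Letter.isDirect_eq_true {u : Letter E} : u.isDirect = true ↔ ∃ a, u = .direct a := by
  cases u <;> simp [Letter.isDirect]

theorem Letter.isDirect_eq_false {u : Letter E} : u.isDirect = false ↔ ∃ a, u = .inverse a := by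
  cases u <;> simp [Letter.isDirect]

theorem rel_of_nextRel {a b : E} (h : Q.nextRel a = some b) : Q.rel b a := by
  classical
  rw [nextRel] at h
  split_ifs at h with h'
  exact Option.some.inj h ▸ h'.choose_spec

theorem nextRel_of_rel {K : Type u} [Field K] (hQ : Q.IsGentle K) {a b : E} (h : Q.rel b a) :
    Q.nextRel a = some b := by
  classical
  have h' : ∃ b, Q.rel b a := ⟨b, h⟩
  rw [nextRel, dif_pos h']
  exact congrArg some (hQ.rel_left a h'.choose_spec h)

theorem antipath_succ {o : Option E} {n : ℕ} {b : E} (h : Q.antipath o (n + 1) = some b) :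
    ∃ a, Q.antipath o n = some a ∧ Q.rel b a := by
  rw [antipath, Option.bind_eq_some_iff] at h
  obtain ⟨a, ha, hb⟩ := h
  exact ⟨a, ha, rel_of_nextRel hb⟩

namespace GString

variable (w : Q.GString) (β γ : Option E)

/-- The module part of the homotopy string `π(w)` consists of the `L` letters of `w` that follow the
first `o` letters, which are removed. -/
structure IsTrim (o L : ℕ) : Prop where
  le : o + L ≤ w.letters.length
  length : (w.modulePart β γ).length = L
  getElem : ∀ k < L, (w.modulePart β γ)[k]? = w.letters[o + k]?
  start : w.modulePartStart γ = w.vertex o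
  o_eq : γ ≠ none → o = 0
  lt_o : ∀ k < o, ∃ a, w.letters[k]? = some (.inverse a)
  at_o : γ = none → ∀ a, w.letters[o]? ≠ some (.inverse a)
  L_eq : β ≠ none → o + L = w.letters.length
  ge_L : ∀ k, o + L ≤ k → k < w.letters.length → ∃ a, w.letters[k]? = some (.direct a)
  at_L : β = none → ∀ k, o + k + 1 = o + L → ∀ a, w.letters[o + k]? ≠ some (.direct a)

/-- The letters of `w` are those of the removed inverse prefix, of the module part and of the
removed direct suffix. -/
theorem exists_isTrim : ∃ o L, w.IsTrim β γ o L := by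
  obtain ⟨m, h1, h2, h3, h4⟩ : ∃ m, w.letters = m ++ w.trimRight γ ∧ (γ ≠ none → m = []) ∧
      (∀ u ∈ m, u.isDirect = false) ∧ (γ = none → ∀ u ∈ (w.trimRight γ).head?, u.isDirect) := by
    cases γ with
    | none =>
      obtain ⟨m, h1, h2, h3⟩ := exists_append_dropWhile (fun u : Letter E => !u.isDirect) w.letters
      exact ⟨m, h1, fun h => absurd rfl h, by simpa using h2, fun _ u hu => by
        have := h3 u hu
        simpa using this⟩
    | some c => exact ⟨[], rfl, fun _ => rfl, by simp, fun h => by cases h⟩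
  obtain ⟨m', h1', h2', h3', h4'⟩ : ∃ m, w.trimRight γ = w.modulePart β γ ++ m ∧
      (β ≠ none → m = []) ∧ (∀ u ∈ m, u.isDirect = true) ∧
      (β = none → ∀ u ∈ (w.modulePart β γ).getLast?, u.isDirect = false) := by
    cases β with
    | none =>
      obtain ⟨m, h1, h2, h3⟩ := exists_rdropWhile_append Letter.isDirect (w.trimRight γ)
      exact ⟨m, h1, fun h => absurd rfl h, h2, fun _ => h3⟩
    | some c => exact ⟨[], (List.append_nil _).symm, fun _ => rfl, by simp, fun h => by cases h⟩
  have hlen : w.letters.length = m.length + ((w.modulePart β γ).length + m'.length) := by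
    rw [h1, h1']
    simp
  refine ⟨m.length, (w.modulePart β γ).length, by omega, rfl, ?_, ?_, ?_, ?_, ?_, ?_, ?_, ?_⟩
  · intro k hk
    rw [h1, h1', List.getElem?_append_right (by omega), List.getElem?_append_left (by omega)]
    congr 1
    omega
  · rw [modulePartStart]
    congr 1
    rw [hlen, h1']
    simp
  · intro h
    rw [h2 h]
    rfl
  · intro k hk
    have := h3 m[k] (List.getElem_mem hk)
    obtain ⟨a, ha⟩ := Letter.isDirect_eq_false.1 this
    refine ⟨a, ?_⟩
    rw [h1, List.getElem?_append_left hk, List.getElem?_eq_getElem hk, ha]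
  · intro h a ha
    have := h4 h (.inverse a) (by
      rw [h1, List.getElem?_append_right le_rfl, Nat.sub_self, ← List.head?_eq_getElem?] at ha
      exact ha)
    cases this
  · intro h
    rw [hlen, h2' h]
    simp
  · intro k hk hk'
    obtain ⟨j, rfl⟩ : ∃ j, k = m.length + ((w.modulePart β γ).length + j) :=
      ⟨k - (m.length + (w.modulePart β γ).length), by omega⟩
    have hj : j < m'.length := by omega
    obtain ⟨a, ha⟩ := Letter.isDirect_eq_true.1 (h3' m'[j] (List.getElem_mem hj))
    refine ⟨a, ?_⟩
    rw [h1, h1', List.getElem?_append_right (by omega), List.getElem?_append_right (by omega),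
      show m.length + ((w.modulePart β γ).length + j) - m.length - (w.modulePart β γ).length = j by
        omega, List.getElem?_eq_getElem hj, ha]
  · intro h k hk a ha
    have := h4' h (.direct a) (by
      rw [h1, h1', List.getElem?_append_right (by omega), List.getElem?_append_left (by omega)]
        at ha
      rw [List.getLast?_eq_getElem?, Option.mem_def, ← ha]
      congr 1
      omega)
    cases this

/-- The finite walk `b w c⁻¹`, with `w` at the positions from `0` to the length of `w`. -/
def extended : Word Q where
  pos := Set.univ
  vert i := if i < 0 then γ.elim w.start Q.t else
    if i ≤ w.letters.length then w.vertex i.toNat else β.elim w.start Q.t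
  letter i := if i = -1 then γ.map .inverse else if i < 0 then none else
    if i = w.letters.length then β.map .direct else w.letters[i.toNat]?

variable {w β γ}

theorem extended_letter_neg_one : (w.extended β γ).letter (-1) = γ.map .inverse := rfl

theorem extended_letter_of_lt {i : ℤ} (h : i < -1) : (w.extended β γ).letter i = none := by
  simp only [extended]
  rw [if_neg (by omega), if_pos (by omega)]

theorem extended_letter_length :
    (w.extended β γ).letter w.letters.length = β.map .direct := by
  simp only [extended]
  rw [if_neg (by omega), if_neg (by omega), if_pos trivial]

theorem extended_letter {k : ℕ} (h : k < w.letters.length) :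
    (w.extended β γ).letter k = w.letters[k]? := by
  simp only [extended]
  rw [if_neg (by omega), if_neg (by omega), if_neg (by omega), Int.toNat_natCast]

theorem extended_letter_of_gt {i : ℤ} (h : w.letters.length < i) :
    (w.extended β γ).letter i = none := by
  simp only [extended]
  rw [if_neg (by omega), if_neg (by omega), if_neg (by omega), List.getElem?_eq_none (by omega)]

theorem extended_vert {k : ℕ} (h : k ≤ w.letters.length) :
    (w.extended β γ).vert k = w.vertex k := by
  simp only [extended]
  rw [if_neg (by omega), if_pos (by omega), Int.toNat_natCast]

/-- The positions of the letters of `b w c⁻¹`. -/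
theorem extended_cases (i : ℤ) : (w.extended β γ).letter i = none ∨ i = -1 ∨
    (∃ k : ℕ, i = k ∧ k < w.letters.length) ∨ i = w.letters.length := by
  by_cases h1 : i < -1
  · exact .inl (extended_letter_of_lt h1)
  by_cases h2 : i = -1
  · exact .inr (.inl h2)
  by_cases h3 : i < w.letters.length
  · exact .inr (.inr (.inl ⟨i.toNat, by omega, by omega⟩))
  by_cases h4 : i = w.letters.length
  · exact .inr (.inr (.inr h4))
  · exact .inl (extended_letter_of_gt (by omega))

theorem extended_src (hw : w.Extends β γ) {i : ℤ} {u : Letter E}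
    (h : (w.extended β γ).letter i = some u) : u.src Q = (w.extended β γ).vert i := by
  rcases extended_cases (w := w) (β := β) (γ := γ) i with h0 | rfl | ⟨k, rfl, hk⟩ | rfl
  · rw [h0] at h
    cases h
  · rw [extended_letter_neg_one, Option.map_eq_some_iff] at h
    obtain ⟨c, rfl, rfl⟩ := h
    rfl
  · rw [extended_letter hk] at h
    rw [extended_vert hk.le]
    exact w.src_getElem h
  · rw [extended_letter_length, Option.map_eq_some_iff] at h
    obtain ⟨b, rfl, rfl⟩ := h
    rw [extended_vert le_rfl]
    exact hw.2.1 b rfl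

theorem extended_tgt (hw : w.Extends β γ) {i : ℤ} {u : Letter E}
    (h : (w.extended β γ).letter i = some u) : u.tgt Q = (w.extended β γ).vert (i + 1) := by
  rcases extended_cases (w := w) (β := β) (γ := γ) i with h0 | rfl | ⟨k, rfl, hk⟩ | rfl
  · rw [h0] at h
    cases h
  · rw [extended_letter_neg_one, Option.map_eq_some_iff] at h
    obtain ⟨c, rfl, rfl⟩ := h
    exact (hw.2.2 c rfl).trans (extended_vert (k := 0) (by omega)).symm
  · rw [extended_letter hk] at h
    exact (w.tgt_getElem h).trans (extended_vert (k := k + 1) hk).symm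
  · rw [extended_letter_length, Option.map_eq_some_iff] at h
    obtain ⟨b, rfl, rfl⟩ := h
    simp only [extended]
    rw [if_neg (by omega), if_neg (by omega)]
    rfl

theorem extended_compatible (hw : w.Extends β γ) {i : ℤ} {u v : Letter E}
    (h : (w.extended β γ).letter i = some u) (h' : (w.extended β γ).letter (i + 1) = some v) :
    Letter.Compatible Q u v := by
  have hc := hw.1
  rw [List.append_assoc, List.isChain_append] at hc
  obtain ⟨-, hc, hc'⟩ := hc
  rw [List.isChain_append] at hc
  rcases extended_cases (w := w) (β := β) (γ := γ) i with h0 | rfl | ⟨k, rfl, hk⟩ | rfl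
  · rw [h0] at h
    cases h
  · rw [extended_letter_neg_one, Option.map_eq_some_iff] at h
    obtain ⟨c, rfl, rfl⟩ := h
    refine hc' (.inverse c) rfl v ?_
    rw [neg_add_cancel] at h'
    by_cases hn : 0 < w.letters.length
    · have := extended_letter (w := w) (β := β) (γ := some c) hn
      rw [Nat.cast_zero, h', ← List.head?_eq_getElem?] at this
      rw [List.head?_append, ← this]
      rfl
    · have h0 : w.letters = [] := List.eq_nil_of_length_eq_zero (by omega)
      have := extended_letter_length (w := w) (β := β) (γ := some c)
      rw [h0, List.length_nil, Nat.cast_zero, h', eq_comm, Option.map_eq_some_iff] at this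
      obtain ⟨b, rfl, rfl⟩ := this
      rw [h0]
      rfl
  · rw [extended_letter hk] at h
    by_cases hk' : k + 1 < w.letters.length
    · rw [← Nat.cast_succ, extended_letter hk'] at h'
      exact w.compatible_getElem h h'
    · have e : k + 1 = w.letters.length := by omega
      rw [← Nat.cast_succ, Nat.succ_eq_add_one, e, extended_letter_length,
        Option.map_eq_some_iff] at h'
      obtain ⟨b, rfl, rfl⟩ := h'
      refine hc.2.2 u ?_ (.direct b) rfl
      rw [List.getLast?_eq_getElem?, show w.letters.length - 1 = k by omega]
      exact h
  · rw [extended_letter_of_gt (by omega)] at h'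
    cases h'

end GString

theorem Word.isWalk_ofLetters (x : V) (f : ℤ → Option (Letter E))
    (hadj : ∀ i u v, f i = some u → f (i + 1) = some v → Letter.Adjacent Q u v)
    (hpos : ∀ i, 0 ≤ i → (f (i + 1)).isSome → (f i).isSome)
    (hneg : ∀ i, i < -1 → (f i).isSome → (f (i + 1)).isSome) :
    (Word.ofLetters (Q := Q) x f).IsWalk where
  nonempty := ⟨0, .inl rfl⟩
  ordConnected := by
    have hp : ∀ (n : ℕ) (i : ℤ), 0 ≤ i → (f (i + n)).isSome → (f i).isSome := by
      intro n
      induction n with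
      | zero => intro i _ h; simpa using h
      | succ n ih =>
        intro i hi h
        exact ih i hi (hpos _ (by omega) (by rwa [Nat.cast_succ, ← add_assoc] at h))
    have hn : ∀ (n : ℕ) (i : ℤ), i + n < 0 → (f i).isSome → (f (i + n)).isSome := by
      intro n
      induction n with
      | zero => intro i _ h; simpa using h
      | succ n ih =>
        intro i hi h
        rw [Nat.cast_succ, ← add_assoc]
        exact hneg _ (by push_cast at hi; omega) (ih i (by push_cast at hi; omega) h)
    refine ⟨fun i hi k hk j hj => ?_⟩
    obtain ⟨hij, hjk⟩ := hj
    rcases lt_trichotomy j 0 with h0 | h0 | h0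
    · refine .inr (.inl ?_)
      rcases hi with rfl | hi | hi
      · omega
      · have := hn (j - i).toNat i (by omega) hi
        rwa [show i + ((j - i).toNat : ℤ) = j by omega] at this
      · have := hn (j - i + 1).toNat (i - 1) (by omega) hi
        rwa [show i - 1 + ((j - i + 1).toNat : ℤ) = j by omega] at this
    · exact .inl h0
    · refine .inr (.inr ?_)
      rcases hk with rfl | hk | hk
      · omega
      · exact hp (k - j + 1).toNat (j - 1) (by omega)
          (by rwa [show j - 1 + ((k - j + 1).toNat : ℤ) = k by omega])
      · exact hp (k - j).toNat (j - 1) (by omega)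
          (by rwa [show j - 1 + ((k - j).toNat : ℤ) = k - 1 by omega])
  isSome_iff i := by
    change (f i).isSome ↔ (i = 0 ∨ (f i).isSome ∨ (f (i - 1)).isSome) ∧
      (i + 1 = 0 ∨ (f (i + 1)).isSome ∨ (f (i + 1 - 1)).isSome)
    rw [add_sub_cancel_right]
    constructor
    · intro h
      exact ⟨.inr (.inl h), .inr (.inr h)⟩
    · rintro ⟨h1 | h1 | h1, h2 | h2 | h2⟩ <;> try assumption
      · omega
      · exact hpos _ (by omega) h2
      · have := hneg (i - 1) (by omega) h1
        rwa [sub_add_cancel] at this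
      · by_cases hi : 0 ≤ i
        · exact hpos _ hi h2
        · have := hneg (i - 1) (by omega) h1
          rwa [sub_add_cancel] at this
  src_eq i u h := by
    change f i = some u at h
    simp [Word.ofLetters, h]
  tgt_eq i u h := by
    change f i = some u at h
    simp only [Word.ofLetters]
    cases h' : f (i + 1) with
    | none => simp [h]
    | some v => exact (hadj i u v h h').1.symm
  adjacent := hadj

namespace GString

variable {w : Q.GString} {β γ : Option E} {o L : ℕ}

theorem homotopyString_letter_neg {i : ℤ} (h : i < 0) :
    (w.homotopyString β γ).letter i = (Q.antipath γ (-1 - i).toNat).map .inverse := if_pos h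

namespace IsTrim

variable (T : w.IsTrim β γ o L)

include T

theorem letter_mid {k : ℕ} (h : k < L) :
    (w.homotopyString β γ).letter k = (w.extended β γ).letter (k + o : ℕ) := by
  rw [extended_letter (by have := T.le; omega), add_comm k o, ← T.getElem k h]
  simp only [homotopyString, Word.ofLetters]
  rw [if_neg (by omega), if_pos (by rw [T.length]; omega), Int.toNat_natCast]

theorem letter_top (k : ℕ) :
    (w.homotopyString β γ).letter (L + k) = (Q.antipath β k).map .direct := by
  simp only [homotopyString, Word.ofLetters]
  rw [if_neg (by omega), if_neg (by rw [T.length]; omega), T.length]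
  congr 2
  omega

theorem letter_of_ge {i : ℤ} (h : L ≤ i) :
    (w.homotopyString β γ).letter i = (Q.antipath β (i - L).toNat).map .direct := by
  rw [← T.letter_top]
  congr 1
  omega

/-- Near the module part, the letters of `π(w)` are letters of `b w c⁻¹`. -/
theorem extended_letter_eq {i : ℤ} {u : Letter E} (h1 : -1 ≤ i) (h2 : i ≤ L)
    (hu : (w.homotopyString β γ).letter i = some u) :
    (w.extended β γ).letter (i + o) = some u := by
  rcases lt_trichotomy i (-1) with h | rfl | h
  · omega
  · rw [homotopyString_letter_neg (by omega), Option.map_eq_some_iff] at hu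
    obtain ⟨c, hc, rfl⟩ := hu
    have hc' : γ = some c := hc
    rw [T.o_eq (by simp [hc'])]
    change γ.map _ = _
    rw [hc']
    rfl
  · obtain ⟨k, rfl⟩ := Int.eq_ofNat_of_zero_le (show 0 ≤ i by omega)
    by_cases hk : k < L
    · rw [← hu, T.letter_mid hk]
      push_cast
      rfl
    · obtain rfl : k = L := by omega
      have h' := T.letter_top 0
      rw [Nat.cast_zero, add_zero, hu] at h'
      have hβ : β ≠ none := by
        rintro rfl
        cases h'
      rw [show ((k : ℤ) + o) = (w.letters.length : ℤ) by rw [← T.L_eq hβ]; push_cast; ring,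
        extended_letter_length, h']
      rfl

theorem compatible (hw : w.Extends β γ) {i : ℤ} {u v : Letter E} (h1 : -1 ≤ i) (h2 : i < L)
    (hu : (w.homotopyString β γ).letter i = some u)
    (hv : (w.homotopyString β γ).letter (i + 1) = some v) : Letter.Compatible Q u v := by
  refine extended_compatible hw (T.extended_letter_eq h1 h2.le hu) ?_
  have := T.extended_letter_eq (by omega) (by omega) hv
  rwa [add_right_comm] at this

theorem rel_top {i : ℤ} (h : L ≤ i) {v : Letter E}
    (hv : (w.homotopyString β γ).letter (i + 1) = some v) :
    ∃ a b, v = .direct b ∧ (w.homotopyString β γ).letter i = some (.direct a) ∧ Q.rel b a := by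
  rw [T.letter_of_ge (by omega), Option.map_eq_some_iff] at hv
  obtain ⟨b, hb, rfl⟩ := hv
  rw [show (i + 1 - L).toNat = (i - L).toNat + 1 by omega] at hb
  obtain ⟨a, ha, hba⟩ := antipath_succ hb
  exact ⟨a, b, rfl, by rw [T.letter_of_ge h, ha]; rfl, hba⟩

omit T in
theorem _root_.BoundQuiver.GString.rel_neg {i : ℤ} (h : i < -1) {u : Letter E}
    (hu : (w.homotopyString β γ).letter i = some u) :
    ∃ a b, u = .inverse b ∧ (w.homotopyString β γ).letter (i + 1) = some (.inverse a) ∧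
      Q.rel b a := by
  rw [homotopyString_letter_neg (by omega), Option.map_eq_some_iff] at hu
  obtain ⟨b, hb, rfl⟩ := hu
  rw [show (-1 - i).toNat = (-1 - (i + 1)).toNat + 1 by omega] at hb
  obtain ⟨a, ha, hba⟩ := antipath_succ hb
  exact ⟨a, b, rfl, by rw [homotopyString_letter_neg (by omega), ha]; rfl, hba⟩

end IsTrim

end GString

end StringWords

section StringComplexes

variable {V E : Type u} {Q : BoundQuiver V E}

/-! ### Breaks and degrees of the homotopy string -/

namespace GString.IsTrim

variable {w : Q.GString} {β γ : Option E} {o L : ℕ} (T : w.IsTrim β γ o L)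

omit T in
theorem _root_.BoundQuiver.GString.letter_neg_eq_inverse {i : ℤ} (h : i < 0) {u : Letter E}
    (hu : (w.homotopyString β γ).letter i = some u) : ∃ a, u = .inverse a := by
  rw [homotopyString_letter_neg h, Option.map_eq_some_iff] at hu
  obtain ⟨a, -, rfl⟩ := hu
  exact ⟨a, rfl⟩

include T

theorem letter_top_eq_direct {i : ℤ} (h : L ≤ i) {u : Letter E}
    (hu : (w.homotopyString β γ).letter i = some u) : ∃ a, u = .direct a := by
  rw [T.letter_of_ge h, Option.map_eq_some_iff] at hu
  obtain ⟨a, -, rfl⟩ := hu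
  exact ⟨a, rfl⟩

theorem exists_letter {i : ℤ} (h : 0 ≤ i) (h' : i < L) :
    ∃ u, (w.homotopyString β γ).letter i = some u ∧ (w.extended β γ).letter (i + o) = some u := by
  obtain ⟨k, rfl⟩ := Int.eq_ofNat_of_zero_le h
  have hk : k + o < w.letters.length := by
    have := T.le
    omega
  have h1 := extended_letter (β := β) (γ := γ) hk
  rw [List.getElem?_eq_getElem hk] at h1
  exact ⟨_, (T.letter_mid (by omega)).trans h1, by exact_mod_cast h1⟩

theorem extended_letter_ne_direct (a : E) : (w.extended β γ).letter (o - 1) ≠ some (.direct a) := by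
  intro h
  rcases Nat.eq_zero_or_pos o with h0 | h0
  · rw [h0, Nat.cast_zero, zero_sub, extended_letter_neg_one, Option.map_eq_some_iff] at h
    obtain ⟨c, -, h⟩ := h
    cases h
  · obtain ⟨b, hb⟩ := T.lt_o (o - 1) (by omega)
    have := extended_letter (w := w) (β := β) (γ := γ) (k := o - 1) (by have := T.le; omega)
    rw [show ((o - 1 : ℕ) : ℤ) = o - 1 by omega, h, hb] at this
    cases this

theorem extended_letter_ne_inverse (a : E) :
    (w.extended β γ).letter (L + o) ≠ some (.inverse a) := by
  intro h
  have hle := T.le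
  rcases hle.eq_or_lt with h0 | h0
  · rw [show (L : ℤ) + o = w.letters.length by omega, extended_letter_length,
      Option.map_eq_some_iff] at h
    obtain ⟨c, -, h⟩ := h
    cases h
  · obtain ⟨b, hb⟩ := T.ge_L (o + L) le_rfl h0
    have := extended_letter (w := w) (β := β) (γ := γ) h0
    rw [show ((o + L : ℕ) : ℤ) = L + o by omega, h, hb] at this
    cases this

/-- If `π(w)` ends with its module part on the right, then it does not start with an inverse
letter. -/
theorem letter_zero_ne (h : (w.homotopyString β γ).letter (-1) = none) (a : E) :
    (w.homotopyString β γ).letter 0 ≠ some (.inverse a) := by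
  intro ha
  have hγ : γ = none := by
    rw [homotopyString_letter_neg (by omega)] at h
    exact Option.map_eq_none_iff.1 h
  rcases Nat.eq_zero_or_pos L with h0 | h0
  · obtain ⟨b, hb⟩ := T.letter_top_eq_direct (by omega) ha
    cases hb
  · have h1 := T.letter_mid h0
    rw [Nat.cast_zero, zero_add, extended_letter (by have := T.le; omega), ha] at h1
    exact T.at_o hγ a h1.symm

theorem letter_last_ne (h : (w.homotopyString β γ).letter L = none) (a : E) :
    (w.homotopyString β γ).letter (L - 1) ≠ some (.direct a) := by
  intro ha
  have hβ : β = none := by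
    rw [T.letter_of_ge le_rfl, sub_self] at h
    exact Option.map_eq_none_iff.1 h
  rcases Nat.eq_zero_or_pos L with h0 | h0
  · obtain ⟨b, hb⟩ := letter_neg_eq_inverse (by omega) ha
    cases hb
  · have h1 := T.letter_mid (k := L - 1) (by omega)
    rw [show ((L - 1 : ℕ) : ℤ) = L - 1 by omega, extended_letter (by have := T.le; omega), ha,
      add_comm] at h1
    exact T.at_L hβ (L - 1) (by omega) a h1.symm

theorem adjacent (hw : w.Extends β γ) (i : ℤ) (u v : Letter E)
    (hu : (w.homotopyString β γ).letter i = some u)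
    (hv : (w.homotopyString β γ).letter (i + 1) = some v) : Letter.Adjacent Q u v := by
  by_cases h1 : i < -1
  · obtain ⟨a, b, rfl, h, hr⟩ := rel_neg h1 hu
    rw [hv] at h
    obtain rfl := Option.some.inj h
    refine ⟨(Q.rel_comp hr).symm, fun h => ?_⟩
    cases h
  by_cases h2 : i < L
  · exact (T.compatible hw (by omega) h2 hu hv).1
  · obtain ⟨a, b, rfl, h, hr⟩ := T.rel_top (by omega) hv
    rw [hu] at h
    obtain rfl := Option.some.inj h
    refine ⟨Q.rel_comp hr, fun h => ?_⟩
    cases h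

theorem isWalk (hw : w.Extends β γ) : (w.homotopyString β γ).IsWalk := by
  refine Word.isWalk_ofLetters _ _ (T.adjacent hw) (fun i hi h => ?_) fun i hi h => ?_
  · change ((w.homotopyString β γ).letter i).isSome
    obtain ⟨v, hv⟩ := Option.isSome_iff_exists.1 h
    by_cases h2 : i < L
    · obtain ⟨u, hu, -⟩ := T.exists_letter hi h2
      rw [hu]
      rfl
    · obtain ⟨a, b, -, h, -⟩ := T.rel_top (by omega) hv
      rw [h]
      rfl
  · change ((w.homotopyString β γ).letter (i + 1)).isSome
    obtain ⟨v, hv⟩ := Option.isSome_iff_exists.1 h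
    obtain ⟨a, b, -, h, -⟩ := rel_neg hi hv
    rw [h]
    rfl

theorem vert_eq (hw : w.Extends β γ) {k : ℤ} (h : 0 ≤ k) (h' : k ≤ L) :
    (w.homotopyString β γ).vert k = (w.extended β γ).vert (k + o) := by
  have hσ := T.isWalk hw
  cases h1 : (w.homotopyString β γ).letter k with
  | some u => rw [← hσ.src_eq _ _ h1, extended_src hw (T.extended_letter_eq (by omega) h' h1)]
  | none =>
    cases h2 : (w.homotopyString β γ).letter (k - 1) with
    | some u =>
      have h3 := hσ.tgt_eq _ _ h2
      have h4 := extended_tgt hw (T.extended_letter_eq (by omega) (by omega) h2)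
      rw [sub_add_cancel] at h3
      rw [← h3, h4]
      congr 1
      omega
    | none =>
      obtain rfl : k = 0 := by
        by_contra h0
        obtain ⟨u, hu, -⟩ := T.exists_letter (i := k - 1) (by omega) (by omega)
        rw [h2] at hu
        cases hu
      have h3 : (w.homotopyString β γ).vert 0 = w.modulePartStart γ := by
        simp only [homotopyString, Word.ofLetters] at h1 h2 ⊢
        rw [h1, h2]
        rfl
      rw [h3, T.start, zero_add, extended_vert (by have := T.le; omega)]

omit T in
theorem _root_.BoundQuiver.GString.zero_mem_pos : 0 ∈ (w.homotopyString β γ).pos := .inl rfl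

theorem mem_pos (hw : w.Extends β γ) {i : ℤ} (h : 0 ≤ i) (h' : i ≤ L) :
    i ∈ (w.homotopyString β γ).pos := by
  rcases h.eq_or_lt with rfl | h
  · exact zero_mem_pos
  · obtain ⟨u, hu, -⟩ := T.exists_letter (i := i - 1) (by omega) (by omega)
    have := (T.isWalk hw).mem_pos_succ hu
    rwa [sub_add_cancel] at this

theorem exists_letter_of_le (hw : w.Extends β γ) {i j : ℤ} (hi : i ∈ (w.homotopyString β γ).pos)
    (hj : j ∈ (w.homotopyString β γ).pos) {k : ℤ} (h : i ≤ k) (h' : k < j) :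
    ∃ u, (w.homotopyString β γ).letter k = some u :=
  Option.isSome_iff_exists.1 (((T.isWalk hw).isSome_iff k).2
    ⟨(T.isWalk hw).ordConnected.out hi hj ⟨h, h'.le⟩,
      (T.isWalk hw).ordConnected.out hi hj ⟨by omega, by omega⟩⟩)

theorem isHomotopyString (hw : w.Extends β γ) : (w.homotopyString β γ).IsHomotopyString where
  toIsWalk := T.isWalk hw
  left h := by
    refine ⟨L, fun i hi => ?_⟩
    obtain ⟨j, hj, hij⟩ := not_bddAbove_iff.1 h (i + 1)
    obtain ⟨v, hv⟩ := T.exists_letter_of_le hw zero_mem_pos hj (k := i + 1) (by omega) hij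
    obtain ⟨a, b, rfl, ha, hba⟩ := T.rel_top hi hv
    exact ⟨a, b, hba, ha, hv⟩
  right h := by
    refine ⟨-1, fun i hi => ?_⟩
    obtain ⟨j, hj, hij⟩ := not_bddBelow_iff.1 h (i - 1)
    obtain ⟨v, hv⟩ := T.exists_letter_of_le hw hj zero_mem_pos (k := i - 1) hij.le (by omega)
    obtain ⟨a, b, rfl, ha, hba⟩ := rel_neg (by omega) hv
    rw [sub_add_cancel] at ha
    exact ⟨a, b, hba, ha, hv⟩

theorem isBreak_of_gt {i : ℤ} (h : L < i) (hi : i ∈ (w.homotopyString β γ).pos) :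
    (w.homotopyString β γ).IsBreak i := by
  refine ⟨hi, fun u v hu hv hs => ?_⟩
  obtain ⟨a, b, rfl, ha, hba⟩ := T.rel_top (i := i - 1) (by omega) (by rwa [sub_add_cancel])
  rw [hu] at ha
  obtain rfl := Option.some.inj ha
  exact hs.2 hba

omit T in
theorem _root_.BoundQuiver.GString.isBreak_of_neg {i : ℤ} (h : i < 0)
    (hi : i ∈ (w.homotopyString β γ).pos) : (w.homotopyString β γ).IsBreak i := by
  refine ⟨hi, fun u v hu hv hs => ?_⟩
  obtain ⟨a, b, rfl, ha, hba⟩ := rel_neg (i := i - 1) (by omega) hu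
  rw [sub_add_cancel, hv] at ha
  obtain rfl := Option.some.inj ha
  exact hs.2 hba

theorem isBreak_iff (hw : w.Extends β γ) {i : ℤ} (h : 0 ≤ i) (h' : i ≤ L) :
    (w.homotopyString β γ).IsBreak i ↔ ∀ u v, (w.homotopyString β γ).letter (i - 1) = some u →
      (w.homotopyString β γ).letter i = some v → u.isDirect ≠ v.isDirect := by
  constructor
  · intro hb u v hu hv huv
    exact hb.2 u v hu hv (Letter.straight_of_compatible
      (T.compatible hw (by omega) (by omega) hu (by rwa [sub_add_cancel])) huv)
  · exact fun hb => ⟨T.mem_pos hw h h', fun u v hu hv hs =>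
      hb u v hu hv (Letter.isDirect_eq_of_straight hs)⟩

theorem exists_isBreak_lower (hw : w.Extends β γ) :
    ∃ j ≤ 0, (w.homotopyString β γ).IsBreak j := by
  cases h : (w.homotopyString β γ).letter (-1) with
  | none => exact ⟨0, le_rfl, zero_mem_pos, fun u v hu => by
      rw [zero_sub, h] at hu
      cases hu⟩
  | some u => exact ⟨-1, by omega, isBreak_of_neg (by omega) ((T.isWalk hw).mem_pos h)⟩

theorem exists_isBreak_upper (hw : w.Extends β γ) :
    ∃ j : ℤ, L ≤ j ∧ (w.homotopyString β γ).IsBreak j := by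
  cases h : (w.homotopyString β γ).letter L with
  | none => exact ⟨L, le_rfl, T.mem_pos hw (by omega) le_rfl, fun u v _ hv => by
      rw [h] at hv
      cases hv⟩
  | some u => exact ⟨L + 1, by omega, T.isBreak_of_gt (by omega) ((T.isWalk hw).mem_pos_succ h)⟩

theorem exists_isDirectLetter (hw : w.Extends β γ) {i : ℤ} {a : E}
    (hi : (w.homotopyString β γ).IsBreak i)
    (ha : (w.homotopyString β γ).letter (i - 1) = some (.direct a)) :
    ∃ j, (w.homotopyString β γ).IsDirectLetter j i := by
  refine (T.isWalk hw).exists_isDirectLetter hi ha ?_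
  obtain ⟨j, hj, hj'⟩ := T.exists_isBreak_lower hw
  refine ⟨j, ?_, hj'⟩
  by_contra h
  obtain ⟨b, hb⟩ := letter_neg_eq_inverse (by omega) ha
  cases hb

theorem exists_isInverseLetter (hw : w.Extends β γ) {i : ℤ} {a : E}
    (hi : (w.homotopyString β γ).IsBreak i)
    (ha : (w.homotopyString β γ).letter i = some (.inverse a)) :
    ∃ j, (w.homotopyString β γ).IsInverseLetter i j := by
  refine (T.isWalk hw).exists_isInverseLetter hi ha ?_
  obtain ⟨j, hj, hj'⟩ := T.exists_isBreak_upper hw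
  refine ⟨j, ?_, hj'⟩
  by_contra h
  obtain ⟨b, hb⟩ := T.letter_top_eq_direct (by omega) ha
  cases hb

omit T in
open scoped Classical in
variable (w β γ L) in
/-- The degree of the position `i` of `π(w)`, if the peaks are in degree `0`. -/
noncomputable def _root_.BoundQuiver.GString.piDegree (i : ℤ) : ℤ :=
  if i < 0 then i else if i ≤ L then
    if ∃ a, (w.homotopyString β γ).letter (i - 1) = some (.direct a) then -1 else 0
  else L - i

omit T in
theorem _root_.BoundQuiver.GString.piDegree_of_neg {i : ℤ} (h : i < 0) :
    w.piDegree β γ L i = i := if_pos h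

omit T in
theorem _root_.BoundQuiver.GString.piDegree_of_direct {i : ℤ} (h : i ≤ L) {a : E}
    (ha : (w.homotopyString β γ).letter (i - 1) = some (.direct a)) :
    w.piDegree β γ L i = -1 := by
  have h0 : ¬ i < 0 := fun h0 => by
    obtain ⟨b, hb⟩ := letter_neg_eq_inverse (by omega) ha
    cases hb
  rw [piDegree, if_neg h0, if_pos h, if_pos ⟨a, ha⟩]

omit T in
theorem _root_.BoundQuiver.GString.piDegree_of_not_direct {i : ℤ} (h0 : 0 ≤ i) (h : i ≤ L)
    (ha : ∀ a, (w.homotopyString β γ).letter (i - 1) ≠ some (.direct a)) :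
    w.piDegree β γ L i = 0 := by
  rw [piDegree, if_neg (by omega), if_pos h, if_neg fun ⟨a, h⟩ => ha a h]

omit T in
theorem _root_.BoundQuiver.GString.piDegree_of_gt {i : ℤ} (h : L < i) :
    w.piDegree β γ L i = L - i := by
  rw [piDegree, if_neg (by omega), if_neg (by omega)]

theorem piDegree_succ (hw : w.Extends β γ) {i : ℤ} {u : Letter E}
    (hu : (w.homotopyString β γ).letter i = some u) :
    w.piDegree β γ L (i + 1) = w.piDegree β γ L i + (w.homotopyString β γ).step i := by
  have hpos := (T.isWalk hw).mem_pos hu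
  -- on the antipaths every position is a break, and the degree drops by one with every step
  -- away from the module part
  rcases lt_or_ge i 0 with h0 | h0
  · obtain ⟨a, rfl⟩ := letter_neg_eq_inverse h0 hu
    rw [Word.step_inverse (isBreak_of_neg h0 hpos) hu, piDegree_of_neg h0]
    rcases (show i + 1 ≤ 0 by omega).eq_or_lt with h1 | h1
    · rw [h1, piDegree_of_not_direct le_rfl (by omega)]
      intro a ha
      obtain ⟨b, hb⟩ := letter_neg_eq_inverse (by omega) ha
      cases hb
    · exact piDegree_of_neg h1
  rcases lt_or_ge (L : ℤ) i with h1 | h1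
  · obtain ⟨a, rfl⟩ := T.letter_top_eq_direct h1.le hu
    rw [Word.step_direct (T.isBreak_of_gt h1 hpos) hu, piDegree_of_gt h1, piDegree_of_gt (by omega)]
    ring
  have hu' : (w.homotopyString β γ).letter (i + 1 - 1) = some u := by
    rwa [add_sub_cancel_right]
  cases u with
  | direct a =>
    have h2 : w.piDegree β γ L (i + 1) = -1 := by
      rcases h1.eq_or_lt with h1 | h1
      · rw [piDegree_of_gt (by omega)]
        omega
      · exact piDegree_of_direct (by omega) hu'
    rw [h2]
    by_cases hb : (w.homotopyString β γ).IsBreak i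
    · rw [Word.step_direct hb hu, piDegree_of_not_direct h0 h1, zero_add]
      exact fun b hb' => (T.isBreak_iff hw h0 h1).1 hb _ _ hb' hu rfl
    · obtain ⟨v, v', hv, hv', hvv⟩ := Word.exists_straight_of_not_isBreak hpos hb
      rw [hu] at hv'
      obtain rfl := Option.some.inj hv'
      obtain ⟨b, rfl⟩ := Letter.isDirect_eq_true.1 (Letter.isDirect_eq_of_straight hvv)
      rw [Word.step_of_not_isBreak hb, piDegree_of_direct h1 hv, add_zero]
  | inverse a =>
    have h1 : i < L := by
      by_contra h1
      obtain ⟨b, hb⟩ := T.letter_top_eq_direct (by omega) hu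
      cases hb
    rw [piDegree_of_not_direct (i := i + 1) (by omega) (by omega) (by simp [hu])]
    by_cases hb : (w.homotopyString β γ).IsBreak i
    · cases hv : (w.homotopyString β γ).letter (i - 1) with
      | none =>
        obtain rfl : i = 0 := by
          by_contra hi
          obtain ⟨u, hu, -⟩ := T.exists_letter (i := i - 1) (by omega) (by omega)
          rw [hv] at hu
          cases hu
        exact absurd hu (T.letter_zero_ne hv a)
      | some v =>
        have h2 := (T.isBreak_iff hw h0 h1.le).1 hb _ _ hv hu
        obtain ⟨b, rfl⟩ : ∃ b, v = .direct b := Letter.isDirect_eq_true.1 (by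
          simpa [Letter.isDirect] using h2)
        rw [Word.step_inverse hb hu, piDegree_of_direct h1.le hv]
        rfl
    · obtain ⟨v, v', hv, hv', hvv⟩ := Word.exists_straight_of_not_isBreak hpos hb
      rw [hu] at hv'
      obtain rfl := Option.some.inj hv'
      obtain ⟨b, rfl⟩ := Letter.isDirect_eq_false.1 (Letter.isDirect_eq_of_straight hvv)
      rw [Word.step_of_not_isBreak hb, piDegree_of_not_direct h0 h1.le (by simp [hv]), add_zero]

theorem piDegree_isPeak (hw : w.Extends β γ) {p : ℤ} (hp : (w.homotopyString β γ).IsPeak p) :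
    w.piDegree β γ L p = 0 := by
  obtain ⟨hpos, h1, h2⟩ := hp
  refine piDegree_of_not_direct ?_ ?_ fun a ha => by cases h2 _ ha
  · by_contra h
    obtain ⟨u, hu⟩ := T.exists_letter_of_le hw hpos zero_mem_pos le_rfl (by omega)
    obtain ⟨a, rfl⟩ := letter_neg_eq_inverse (by omega) hu
    cases h1 _ hu
  · by_contra h
    obtain ⟨u, hu⟩ := T.exists_letter_of_le hw zero_mem_pos hpos (k := p - 1) (by omega) (by omega)
    obtain ⟨a, rfl⟩ := T.letter_top_eq_direct (by omega) hu
    cases h2 _ hu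

theorem degree_eq (hw : w.Extends β γ) {p i : ℤ} (hp : (w.homotopyString β γ).IsPeak p)
    (hi : i ∈ (w.homotopyString β γ).pos) :
    (w.homotopyString β γ).degree p i = w.piDegree β γ L i := by
  rw [Word.degree_eq_sub (g := w.piDegree β γ L), T.piDegree_isPeak hw hp, sub_zero]
  intro k hk hk'
  have hp' := hp.1
  obtain ⟨u, hu⟩ : ∃ u, (w.homotopyString β γ).letter k = some u := by
    rcases le_total p i with h | h
    · exact T.exists_letter_of_le hw hp' hi (by omega) (by omega)
    · exact T.exists_letter_of_le hw hi hp' (by omega) (by omega)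
  exact T.piDegree_succ hw hu

theorem exists_isPeak (hw : w.Extends β γ) : ∃ p, (w.homotopyString β γ).IsPeak p := by
  obtain ⟨p, ⟨hp, hp'⟩, hmin⟩ := Int.exists_least_of_bdd
    (P := fun i => 0 ≤ i ∧ ∀ a, (w.homotopyString β γ).letter i ≠ some (.inverse a))
    ⟨0, fun i hi => hi.1⟩ ⟨L, by omega, fun a ha => by
      obtain ⟨b, hb⟩ := T.letter_top_eq_direct le_rfl ha
      cases hb⟩
  have hpL : p ≤ L := hmin L ⟨by omega, fun a ha => by
      obtain ⟨b, hb⟩ := T.letter_top_eq_direct le_rfl ha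
      cases hb⟩
  refine ⟨p, T.mem_pos hw hp hpL, fun u hu => ?_, fun u hu => ?_⟩
  · cases u with
    | direct a => rfl
    | inverse a => exact absurd hu (hp' a)
  · cases u with
    | inverse a => rfl
    | direct a =>
      by_cases h : 0 ≤ p - 1
      · have := hmin (p - 1) ⟨h, fun b hb => by
          rw [hu] at hb
          cases hb⟩
        omega
      · obtain ⟨b, hb⟩ := letter_neg_eq_inverse (by omega) hu
        cases hb

end GString.IsTrim

end StringComplexes

section StringResolutions

variable {V E : Type u} {Q : BoundQuiver V E}

/-- Nonzero weights with given quotients of successive values. -/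
theorem exists_weights {K : Type*} [Field K] (f : ℤ → K) (hf : ∀ k, f k ≠ 0) :
    ∃ om : ℤ → K, (∀ k, om k ≠ 0) ∧ ∀ k, om (k + 1) = f k * om k := by
  refine ⟨fun k => (∏ t ∈ Finset.Ico 0 k, f t) * (∏ t ∈ Finset.Ico k 0, f t)⁻¹, fun k => ?_,
    fun k => ?_⟩
  · exact mul_ne_zero (Finset.prod_ne_zero_iff.2 fun _ _ => hf _)
      (inv_ne_zero (Finset.prod_ne_zero_iff.2 fun _ _ => hf _))
  · dsimp only
    rcases le_or_gt 0 k with h | h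
    · have e : Finset.Ico 0 (k + 1) = insert k (Finset.Ico 0 k) := by ext; simp; omega
      rw [e, Finset.prod_insert (by simp), Finset.Ico_eq_empty (a := k + 1) (by omega),
        Finset.Ico_eq_empty (a := k) (by omega)]
      ring
    · have e : Finset.Ico k 0 = insert k (Finset.Ico (k + 1) 0) := by ext; simp; omega
      rw [e, Finset.prod_insert (by simp), Finset.Ico_eq_empty (b := k + 1) (by omega),
        Finset.Ico_eq_empty (b := k) (by omega), mul_inv]
      have := hf k
      field_simp

namespace Word

variable {σ : Word Q}

theorem HasLetter.degree_letterEnd {i : ℤ} {s : Bool} (h : σ.HasLetter i s) (p : ℤ) :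
    σ.degree p (σ.letterEnd i s) = σ.degree p i + 1 := by
  cases s with
  | true => exact h.isInverseLetter.degree_eq p
  | false => exact h.isDirectLetter.degree_eq p

theorem HasLetter.eq_of_letterEnd_eq {i i' : ℤ} {s : Bool} (h : σ.HasLetter i s)
    (h' : σ.HasLetter i' s) (e : σ.letterEnd i s = σ.letterEnd i' s) : i = i' := by
  cases s with
  | true =>
    have h1 := h.isInverseLetter.1
    rw [e] at h1
    exact h1.eq_left h'.isInverseLetter.1
  | false =>
    have h1 := h.isDirectLetter.1
    rw [e] at h1
    exact h1.eq_right h'.isDirectLetter.1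

end Word

namespace GString.IsTrim

variable {w : Q.GString} {β γ : Option E} {o L : ℕ} (T : w.IsTrim β γ o L)

include T

omit T in
theorem _root_.BoundQuiver.GString.piDegree_le (i : ℤ) : w.piDegree β γ L i ≤ 0 := by
  rw [piDegree]
  split_ifs <;> omega

omit T in
/-- The summands of degree `0` are the ones in the module part that do not follow a direct
letter. -/
theorem _root_.BoundQuiver.GString.piDegree_eq_zero_iff {i : ℤ} : w.piDegree β γ L i = 0 ↔
    0 ≤ i ∧ i ≤ L ∧ ∀ a, (w.homotopyString β γ).letter (i - 1) ≠ some (.direct a) := by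
  constructor
  · intro h
    rw [piDegree] at h
    split_ifs at h with h1 h2 h3
    · omega
    · push Not at h3
      exact ⟨by omega, h2, h3⟩
    · omega
  · rintro ⟨h1, h2, h3⟩
    exact piDegree_of_not_direct h1 h2 h3

omit T in
/-- At a summand of degree `-1` two homotopy letters of the module part start, or it is the first
summand in one of the two antipaths. -/
theorem eq_of_piDegree_eq {i : ℤ} (h : w.piDegree β γ L i = -1) :
    (i = -1) ∨ (i = L + 1) ∨
      (0 ≤ i ∧ i ≤ L ∧ ∃ a, (w.homotopyString β γ).letter (i - 1) = some (.direct a)) := by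
  rw [piDegree] at h
  split_ifs at h with h1 h2 h3
  · exact .inl h
  · exact .inr (.inr ⟨by omega, h2, h3⟩)
  · exact .inr (.inl (by omega))

/-- A break of the module part which follows a direct letter precedes an inverse letter. -/
theorem exists_inverse_of_deep (hw : w.Extends β γ) {i : ℤ} (h : i ≤ L)
    (hi : (w.homotopyString β γ).IsBreak i) {a : E}
    (ha : (w.homotopyString β γ).letter (i - 1) = some (.direct a)) :
    0 < i ∧ i < L ∧ ∃ b, (w.homotopyString β γ).letter i = some (.inverse b) := by
  have h0 : 0 < i := by
    by_contra h0
    obtain ⟨b, hb⟩ := letter_neg_eq_inverse (by omega) ha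
    cases hb
  cases hv : (w.homotopyString β γ).letter i with
  | none =>
    rcases h.eq_or_lt with rfl | h
    · exact absurd ha (T.letter_last_ne hv a)
    · obtain ⟨u, hu, -⟩ := T.exists_letter (i := i) (by omega) h
      rw [hv] at hu
      cases hu
  | some v =>
    have h2 := (T.isBreak_iff hw h0.le h).1 hi _ _ ha hv
    obtain ⟨b, rfl⟩ : ∃ b, v = .inverse b := Letter.isDirect_eq_false.1 (by
      simpa [Letter.isDirect] using h2.symm)
    refine ⟨h0, ?_, b, rfl⟩
    by_contra hL
    obtain ⟨c, hc⟩ := T.letter_top_eq_direct (by omega) hv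
    cases hc

omit T in
variable (w β γ) in
/-- The weights used for the homotopy string: the sign changes at every inverse homotopy letter. -/
theorem _root_.BoundQuiver.GString.exists_signs (K : Type*) [Field K] :
    ∃ om : ℤ → K, (∀ k, om k ≠ 0) ∧
    (∀ i j, (w.homotopyString β γ).IsDirectLetter j i → om j = om i) ∧
    ∀ i j, (w.homotopyString β γ).IsInverseLetter i j → om j = - om i := by
  classical
  obtain ⟨om, h0, h1⟩ := exists_weights (K := K) (fun k => if (w.homotopyString β γ).IsBreak k ∧
    ∃ a, (w.homotopyString β γ).letter k = some (.inverse a) then -1 else 1) (fun k => by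
      split_ifs <;> simp)
  have hstep : ∀ i j, i ≤ j → (∀ k, i ≤ k → k < j → om (k + 1) = om k) → om j = om i := by
    intro i j hij
    obtain ⟨m, rfl⟩ : ∃ m : ℕ, j = i + m := ⟨(j - i).toNat, by omega⟩
    clear hij
    induction m with
    | zero => intro _; simp
    | succ m ih =>
      intro h
      have := h (i + m) (by omega) (by push_cast; omega)
      rw [add_assoc, ← Nat.cast_succ] at this
      rw [this]
      exact ih fun k hk hk' => h k hk (by push_cast; omega)
  refine ⟨om, h0, fun i j h => (hstep j i h.1.1.le fun k hk hk' => ?_).symm, fun i j h => ?_⟩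
  · rw [h1, if_neg, one_mul]
    rintro ⟨-, a, ha⟩
    obtain ⟨b, hb⟩ := h.2 k hk hk'
    rw [ha] at hb
    cases hb
  · have hlt := h.1.1
    rw [hstep (i + 1) j (by omega), h1, if_pos ⟨h.1.2.1, h.letter_left⟩, neg_one_mul]
    intro k hk hk'
    rw [h1, if_neg, one_mul]
    rintro ⟨hk'', -⟩
    exact h.1.2.2.2 k (by omega) hk' hk''

/-- A position of `w` which is not the end of an arrow of `w` lies in the module part and is a
summand of degree `0` of the string complex. -/
theorem isBreak_of_extended (hw : w.Extends β γ) {q : ℕ} (hq : q ≤ w.letters.length)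
    (h1 : ∀ a, (w.extended β γ).letter (q - 1) ≠ some (.direct a))
    (h2 : ∀ a, (w.extended β γ).letter q ≠ some (.inverse a)) :
    ∃ k : ℕ, q = k + o ∧ (w.homotopyString β γ).IsBreak k ∧ w.piDegree β γ L k = 0 := by
  have hle := T.le
  have hoq : o ≤ q := by
    by_contra h
    obtain ⟨a, ha⟩ := T.lt_o q (by omega)
    exact h2 a ((extended_letter (by omega)).trans ha)
  obtain ⟨k, rfl⟩ : ∃ k, q = k + o := ⟨q - o, by omega⟩
  have hkL : k ≤ L := by
    by_contra h
    obtain ⟨a, ha⟩ := T.ge_L (k + o - 1) (by omega) (by omega)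
    refine h1 a ?_
    rw [show ((k + o : ℕ) : ℤ) - 1 = (k + o - 1 : ℕ) by omega]
    exact (extended_letter (by omega)).trans ha
  have h1' : ∀ a, (w.homotopyString β γ).letter (k - 1) ≠ some (.direct a) := by
    intro a ha
    have := T.extended_letter_eq (by omega) (by omega) ha
    refine h1 a ?_
    rw [← this]
    congr 1
    push_cast
    ring
  have h2' : ∀ a, (w.homotopyString β γ).letter k ≠ some (.inverse a) := by
    intro a ha
    exact h2 a (by exact_mod_cast T.extended_letter_eq (by omega) (by omega) ha)
  refine ⟨k, rfl, (T.isBreak_iff hw (by omega) (by omega)).2 fun u v hu hv => ?_,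
    piDegree_of_not_direct (by omega) (by omega) h1'⟩
  cases u with
  | direct a => exact absurd hu (h1' a)
  | inverse a =>
    cases v with
    | inverse b => exact absurd hv (h2' b)
    | direct b => simp [Letter.isDirect]

omit T in
theorem _root_.BoundQuiver.GString.extended_direct_bound {q : ℤ} {a : E}
    (h : (w.extended β γ).letter q = some (.direct a)) : 0 ≤ q ∧ q ≤ w.letters.length := by
  rcases extended_cases (w := w) (β := β) (γ := γ) q with h0 | rfl | ⟨k, rfl, hk⟩ | rfl
  · rw [h0] at h
    cases h
  · rw [extended_letter_neg_one, Option.map_eq_some_iff] at h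
    obtain ⟨c, -, h⟩ := h
    cases h
  · exact ⟨by omega, by omega⟩
  · exact ⟨by omega, le_rfl⟩

omit T in
theorem _root_.BoundQuiver.GString.extended_inverse_bound {q : ℤ} {a : E}
    (h : (w.extended β γ).letter q = some (.inverse a)) : -1 ≤ q ∧ q < w.letters.length := by
  rcases extended_cases (w := w) (β := β) (γ := γ) q with h0 | rfl | ⟨k, rfl, hk⟩ | rfl
  · rw [h0] at h
    cases h
  · exact ⟨le_rfl, by omega⟩
  · exact ⟨by omega, by omega⟩
  · rw [extended_letter_length, Option.map_eq_some_iff] at h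
    obtain ⟨c, -, h⟩ := h
    cases h

omit T in
theorem _root_.BoundQuiver.GString.Extends.some_left (hw : w.Extends none γ) {a : E}
    (ha : Q.s a = w.vertex w.letters.length)
    (h : ∀ u, (w.extended none γ).letter (w.letters.length - 1) = some u →
      Letter.Compatible Q u (.direct a)) : w.Extends (some a) γ := by
  refine ⟨List.isChain_append.2 ⟨by simpa using hw.1, List.isChain_singleton _, fun u hu v hv => ?_⟩,
    fun b hb => Option.some.inj hb ▸ ha, hw.2.2⟩
  obtain rfl : v = .direct a := (Option.some.inj hv).symm
  refine h u ?_
  rcases Nat.eq_zero_or_pos w.letters.length with h0 | h0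
  · rw [h0, Nat.cast_zero, zero_sub, extended_letter_neg_one]
    rw [List.eq_nil_of_length_eq_zero h0, List.append_nil] at hu
    cases γ with
    | none => cases hu
    | some c => exact hu
  · rw [show (w.letters.length : ℤ) - 1 = (w.letters.length - 1 : ℕ) by omega,
      extended_letter (by omega), ← List.getLast?_eq_getElem?]
    rw [List.getLast?_append_of_ne_nil _ (List.ne_nil_of_length_pos h0)] at hu
    exact hu

omit T in
theorem _root_.BoundQuiver.GString.Extends.some_right (hw : w.Extends β none) {a : E}
    (ha : Q.s a = w.start) (h : ∀ v, (w.extended β none).letter 0 = some v →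
      Letter.Compatible Q (.inverse a) v) : w.Extends β (some a) := by
  refine ⟨?_, hw.2.1, fun b hb => Option.some.inj hb ▸ ha⟩
  rw [List.append_assoc]
  refine List.isChain_append.2 ⟨List.isChain_singleton _, by simpa using hw.1, fun u hu v hv => ?_⟩
  obtain rfl : u = .inverse a := (Option.some.inj hu).symm
  refine h v ?_
  rcases Nat.eq_zero_or_pos w.letters.length with h0 | h0
  · have h1 := extended_letter_length (w := w) (β := β) (γ := none)
    rw [h0, Nat.cast_zero] at h1
    rw [h1]
    rw [List.eq_nil_of_length_eq_zero h0, List.nil_append] at hv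
    cases β with
    | none => cases hv
    | some c => exact hv
  · have h1 := extended_letter (w := w) (β := β) (γ := none) h0
    rw [Nat.cast_zero] at h1
    rw [h1, ← List.head?_eq_getElem?]
    rw [List.head?_append_of_ne_nil _ (List.ne_nil_of_length_pos h0)] at hv
    exact hv

omit T in
/-- An arrow which starts at a position of `w` is a letter of `b w c⁻¹` at this position, or it is
annihilated by one of them, if `b w c⁻¹` is a maximal extension. -/
theorem _root_.BoundQuiver.GString.IsMaximalExtension.arrow_cases {K : Type u} [Field K]
    (hQ : Q.IsGentle K) (hm : w.IsMaximalExtension β γ) {q : ℕ} (hq : q ≤ w.letters.length) {a : E}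
    (ha : Q.s a = (w.extended β γ).vert q) :
    (w.extended β γ).letter q = some (.direct a) ∨
      (w.extended β γ).letter (q - 1) = some (.inverse a) ∨
      (∃ b, (w.extended β γ).letter (q - 1) = some (.direct b) ∧ Q.rel a b) ∨
      ∃ b, (w.extended β γ).letter q = some (.inverse b) ∧ Q.rel a b := by
  obtain ⟨hw, hβ, hγ⟩ := hm
  have htu : ∀ u, (w.extended β γ).letter (q - 1) = some u → u.tgt Q = Q.s a := by
    intro u hu
    rw [extended_tgt hw hu, ha, sub_add_cancel]
  cases hv : (w.extended β γ).letter q with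
  | none =>
    obtain rfl : q = w.letters.length := by
      by_contra hn
      rw [extended_letter (by omega), List.getElem?_eq_getElem (by omega)] at hv
      cases hv
    rw [extended_letter_length, Option.map_eq_none_iff] at hv
    subst hv
    by_contra hcon
    push Not at hcon
    obtain ⟨-, h2, h3, -⟩ := hcon
    -- otherwise `a` could be added on the left, against the maximality
    refine hβ rfl a (hw.some_left (by rwa [extended_vert le_rfl] at ha) fun u hu => ?_)
    refine ⟨⟨(htu u hu).symm, ?_⟩, ?_⟩
    · rintro h
      refine h2 ?_
      rw [hu]
      cases u with
      | direct b => cases h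
      | inverse b => exact congrArg some (by rw [Letter.direct.inj h])
    · cases u with
      | direct b => exact h3 b hu
      | inverse b => trivial
  | some v =>
    have hsv := extended_src hw hv
    cases hu : (w.extended β γ).letter (q - 1) with
    | some u =>
      have hc := extended_compatible hw hu (by rwa [sub_add_cancel])
      rcases Letter.arrow_cases hQ hc (htu u hu).symm with rfl | rfl | ⟨b, rfl, hb⟩ | ⟨b, rfl, hb⟩
      · exact .inl rfl
      · exact .inr (.inl rfl)
      · exact .inr (.inr (.inl ⟨b, rfl, hb⟩))
      · exact .inr (.inr (.inr ⟨b, rfl, hb⟩))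
    | none =>
      obtain rfl : q = 0 := by
        by_contra hn
        rw [show (q : ℤ) - 1 = (q - 1 : ℕ) by omega, extended_letter (by omega),
          List.getElem?_eq_getElem (by omega)] at hu
        cases hu
      rw [Nat.cast_zero, zero_sub, extended_letter_neg_one, Option.map_eq_none_iff] at hu
      subst hu
      by_contra hcon
      push Not at hcon
      obtain ⟨h1, -, -, h4⟩ := hcon
      -- otherwise `a⁻¹` could be added on the right, against the maximality
      refine hγ rfl a (hw.some_right (by rwa [extended_vert (Nat.zero_le _)] at ha) fun v' hv' => ?_)
      obtain rfl : v = v' := Option.some.inj (hv.symm.trans hv')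
      refine ⟨⟨hsv.trans ha.symm, ?_⟩, ?_⟩
      · rintro rfl
        exact h1 rfl
      · cases v with
        | direct b => trivial
        | inverse b => exact h4 b rfl

end GString.IsTrim

variable {K : Type u} [Field K] [Fintype V]

/-! ### The complex of a homotopy string -/

namespace Word

variable (σ : Word Q)

variable (K) in
/-- The data defining the string complex. -/
noncomputable def stringSystem (p : ℤ) : ProjSystem Q K where
  ι := {i : ℤ // σ.IsBreak i}
  vert i := σ.vert i
  deg i := σ.degree p i
  coef i j := σ.component K i j
  sq _ _ _ := σ.component_mul_component rfl rfl _

theorem stringComplex_eq (p : ℤ) : σ.stringComplex K p = (σ.stringSystem K p).complex := rfl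

variable {σ}

/-- In the string complex every break is a summand of its own. -/
noncomputable def stringCovering (hσ : σ.IsWalk) (p : ℤ) : σ.Covering (σ.stringSystem K p) where
  val i := i.1
  rep k j := j.1 = k
  scal _ _ := 1
  vert_eq _ := rfl
  exists_rep k hk := ⟨⟨k, hk⟩, rfl⟩
  rep_unique h h' := Subtype.ext (h.trans h'.symm)
  rep_letter h := by rw [h]
  rep_letter' h := by rw [h]
  rep_deg {i j s} h hj := by
    change σ.degree p j.1 = _
    rw [hj, h.degree_letterEnd]
    rfl
  rep_inj h h' hj hj' := Subtype.ext (h.eq_of_letterEnd_eq h' (hj.symm.trans hj'))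
  scal_ne _ _ := one_ne_zero
  coef_eq i j := by
    classical
    change σ.component K i.1 j.1 * Q.idem K (σ.vert j.1) = _
    rw [component_eq, Finset.sum_mul]
    refine Finset.sum_congr rfl fun s _ => ?_
    rw [one_smul]
    by_cases h : σ.HasLetter i.1 s ∧ σ.letterEnd i.1 s = j.1
    · rw [if_pos h, if_pos ⟨h.1, h.2.symm⟩, ← h.2, hσ.letterPath_mul_idem h.1]
    · rw [if_neg h, if_neg fun h' => h ⟨h'.1, h'.2.symm⟩, zero_mul]

end Word

namespace GString.IsTrim

variable {w : Q.GString} {β γ : Option E} {o L : ℕ} (T : w.IsTrim β γ o L)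

include T

theorem finite_idx (hw : w.Extends β γ) {p : ℤ} (hp : (w.homotopyString β γ).IsPeak p) (n : ℤ) :
    Finite (((w.homotopyString β γ).stringSystem K p).Idx n) := by
  refine Finite.of_injective (β := Set.Icc (min n 0) (max L (L - n))) (fun i => ⟨i.1.1, ?_⟩) ?_
  · have h : (w.homotopyString β γ).degree p i.1.1 = n := i.2
    rw [T.degree_eq hw hp i.1.2.1] at h
    rcases lt_or_ge i.1.1 0 with h0 | h0
    · rw [piDegree_of_neg h0] at h
      exact ⟨by omega, by omega⟩
    rcases lt_or_ge (L : ℤ) i.1.1 with h1 | h1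
    · rw [piDegree_of_gt h1] at h
      exact ⟨by omega, by omega⟩
    · exact ⟨by omega, by omega⟩
  · intro i j h
    exact Subtype.ext (Subtype.ext (congrArg (fun x => x.1) h))

/-- The string complex of `π(w)` is exact in negative degrees. -/
theorem isExact (hQ : Q.IsGentle K) (hw : w.Extends β γ) {p : ℤ}
    (hp : (w.homotopyString β γ).IsPeak p) :
    ((Word.stringCovering (K := K) (T.isWalk hw) p).outgoing (T.isWalk hw) hQ).IsExact := by
  have hσ := T.isWalk hw
  rintro ⟨i, hi⟩ hdeg
  change (w.homotopyString β γ).degree p i < 0 at hdeg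
  rw [T.degree_eq hw hp hi.1] at hdeg
  -- on the left antipath, the next arrow of the antipath is the only one that gives a relation
  rcases lt_or_ge i 0 with h0 | h0
  · right
    obtain ⟨u, hu⟩ := T.exists_letter_of_le hw hi.1 zero_mem_pos le_rfl h0
    obtain ⟨a, rfl⟩ := letter_neg_eq_inverse h0 hu
    obtain ⟨j, hj⟩ := T.exists_isInverseLetter hw hi hu
    refine ⟨true, ⟨j, hj.1.2.2.1⟩, a, ⟨Word.hasLetter_true.2 ⟨j, hj⟩, hj.letterEnd_eq.symm⟩, hu,
      fun b hba => ?_⟩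
    have hb : (w.homotopyString β γ).letter (i - 1) = some (.inverse b) := by
      rw [homotopyString_letter_neg h0, Option.map_eq_some_iff] at hu
      obtain ⟨a', ha', haa⟩ := hu
      obtain rfl := Letter.inverse.inj haa
      rw [homotopyString_letter_neg (by omega),
        show (-1 - (i - 1)).toNat = (-1 - i).toNat + 1 by omega, antipath, ha', Option.bind_some,
        nextRel_of_rel hQ hba]
      rfl
    have hi' := isBreak_of_neg (i := i - 1) (by omega) (hσ.mem_pos hb)
    have hl : (w.homotopyString β γ).IsInverseLetter (i - 1) i :=
      ⟨⟨by omega, hi', hi, fun k hk hk' => by omega⟩, fun k hk hk' => ⟨b, by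
        rw [show k = i - 1 by omega]
        exact hb⟩⟩
    refine ⟨⟨i - 1, hi'⟩, true, (hσ.src_eq _ _ hb).symm,
      ⟨Word.hasLetter_true.2 ⟨i, hl⟩, hl.letterEnd_eq.symm⟩, ?_, fun j' hj' => ?_⟩
    · change (1 : K) • (w.homotopyString β γ).letterPath K (i - 1) true = _
      rw [one_smul, Word.letterPath_true, hl.letterEnd_eq,
        show (i - (i - 1)).toNat = 0 + 1 by omega, Word.inversePath, Word.inversePath,
        Nat.cast_zero, add_zero, Word.arrowAt_eq hb]
      exact hσ.idem_mul_arrow_inverse hb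
    · obtain ⟨c, hc⟩ := hj'.1.isDirectLetter.letter_right
      obtain ⟨d, hd⟩ := letter_neg_eq_inverse (by change i - 1 - 1 < 0; omega) hc
      cases hd
  -- on the right antipath likewise
  rcases lt_or_ge (L : ℤ) i with h1 | h1
  · right
    obtain ⟨u, hu⟩ := T.exists_letter_of_le hw zero_mem_pos hi.1 (k := i - 1) (by omega) (by omega)
    obtain ⟨a, rfl⟩ := T.letter_top_eq_direct (by omega) hu
    obtain ⟨j, hj⟩ := T.exists_isDirectLetter hw hi hu
    refine ⟨false, ⟨j, hj.1.2.1⟩, a, ⟨Word.hasLetter_false.2 ⟨j, hj⟩, hj.letterEnd_eq.symm⟩, hu,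
      fun b hba => ?_⟩
    have hb : (w.homotopyString β γ).letter i = some (.direct b) := by
      rw [T.letter_of_ge (by omega), Option.map_eq_some_iff] at hu
      obtain ⟨a', ha', haa⟩ := hu
      obtain rfl := Letter.direct.inj haa
      rw [T.letter_of_ge (by omega), show (i - L).toNat = (i - 1 - L).toNat + 1 by omega,
        antipath, ha', Option.bind_some, nextRel_of_rel hQ hba]
      rfl
    have hi' := T.isBreak_of_gt (i := i + 1) (by omega) (hσ.mem_pos_succ hb)
    have hl : (w.homotopyString β γ).IsDirectLetter i (i + 1) :=
      ⟨⟨by omega, hi, hi', fun k hk hk' => by omega⟩, fun k hk hk' => ⟨b, by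
        rw [show k = i by omega]
        exact hb⟩⟩
    refine ⟨⟨i + 1, hi'⟩, false, (hσ.tgt_eq _ _ hb).symm,
      ⟨Word.hasLetter_false.2 ⟨i, hl⟩, hl.letterEnd_eq.symm⟩, ?_, fun j' hj' => ?_⟩
    · change (1 : K) • (w.homotopyString β γ).letterPath K (i + 1) false = _
      rw [one_smul, Word.letterPath_false, hl.letterEnd_eq,
        show (i + 1 - i).toNat = 0 + 1 by omega, Word.directPath, Word.directPath,
        Nat.cast_zero, add_zero, Word.arrowAt_eq hb]
      exact hσ.arrow_mul_idem_direct hb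
    · obtain ⟨c, hc⟩ := hj'.1.isInverseLetter.letter_left
      obtain ⟨d, hd⟩ := T.letter_top_eq_direct (by change (L : ℤ) ≤ i + 1; omega) hc
      cases hd
  -- in the module part, homotopy letters start on both sides of a summand of negative degree
  · left
    obtain ⟨a, ha⟩ : ∃ a, (w.homotopyString β γ).letter (i - 1) = some (.direct a) := by
      by_contra hn
      push Not at hn
      rw [piDegree_of_not_direct h0 h1 hn] at hdeg
      omega
    obtain ⟨-, -, b, hb⟩ := T.exists_inverse_of_deep hw h1 hi ha
    obtain ⟨j, hj⟩ := T.exists_isInverseLetter hw hi hb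
    obtain ⟨k, hk⟩ := T.exists_isDirectLetter hw hi ha
    exact ⟨⟨j, hj.1.2.2.1⟩, ⟨k, hk.1.2.1⟩, ⟨Word.hasLetter_true.2 ⟨j, hj⟩, hj.letterEnd_eq.symm⟩,
      ⟨Word.hasLetter_false.2 ⟨k, hk⟩, hk.letterEnd_eq.symm⟩⟩

/-! ### Generators of a module along a homotopy string -/

variable {N : Type*} [AddCommGroup N] [Module (Q.BoundPathAlgebra K) N]

variable {om : ℤ → K}

/-- The contribution of the homotopy letter to the left of a summand, in the module part or at its
upper end. -/
theorem eval_false (hQ : Q.IsGentle K) (hw : w.Extends β γ) {p : ℤ}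
    (hd : ∀ i j, (w.homotopyString β γ).IsDirectLetter j i → om j = om i)
    {F : ((w.homotopyString β γ).stringSystem K p).ι → N} {X : ℤ → N}
    (hF : ∀ j, w.piDegree β γ L j.1 = 0 →
      F j = algebraMap K (Q.BoundPathAlgebra K) (om j.1) • X j.1)
    (hXe : ∀ k : ℤ, 0 ≤ k → k ≤ L → Q.idem K ((w.homotopyString β γ).vert k) • X k = X k)
    {i : ℤ} (hi : (w.homotopyString β γ).IsBreak i) (hiL : i ≤ L + 1) {a : E}
    (hX : ∀ l : ℤ, 0 ≤ l → l < i → ∀ a, (w.homotopyString β γ).letter l = some (.direct a) →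
      Q.arrow K a • X l = X (l + 1))
    (ha : (w.homotopyString β γ).letter (i - 1) = some (.direct a)) :
    ((Word.stringCovering (K := K) (T.isWalk hw) p).outgoing (T.isWalk hw) hQ).eval F ⟨i, hi⟩ false
      = algebraMap K (Q.BoundPathAlgebra K) (om i) • X i := by
  obtain ⟨k, hk⟩ := T.exists_isDirectLetter hw hi ha
  have hlt := hk.1.1
  obtain ⟨c, hc⟩ := hk.letter_left
  have hk0 : 0 ≤ k := by
    by_contra h0
    obtain ⟨b, hb⟩ := letter_neg_eq_inverse (by omega) hc
    cases hb
  have hkd : w.piDegree β γ L k = 0 := piDegree_of_not_direct hk0 (by omega) fun b hb =>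
    (T.isBreak_iff hw hk0 (by omega)).1 hk.1.2.1 _ _ hb hc rfl
  refine (Word.stringCovering (K := K) (T.isWalk hw) p).eval_direct (T.isWalk hw) hQ F X
    (fun _ => 1) om (i := ⟨i, hi⟩) (j := ⟨k, hk.1.2.1⟩) hk rfl (hF _ hkd)
    (hXe k hk0 (by omega)) (fun l hl hl' b hb => ?_) ?_
  · rw [map_one, one_smul]
    exact hX l (by omega) hl' b hb
  · rw [Finset.prod_const_one, mul_one]
    exact (one_mul _).trans (hd _ _ hk)

/-- The contribution of the homotopy letter to the right of a summand, in the module part or at its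
lower end; the condition on the vectors is not needed at positions which follow a direct letter,
except for the summand itself. -/
theorem eval_true (hQ : Q.IsGentle K) (hw : w.Extends β γ) {p : ℤ}
    (hd : ∀ i j, (w.homotopyString β γ).IsInverseLetter i j → om j = - om i)
    {F : ((w.homotopyString β γ).stringSystem K p).ι → N} {X : ℤ → N}
    (hF : ∀ j, w.piDegree β γ L j.1 = 0 →
      F j = algebraMap K (Q.BoundPathAlgebra K) (om j.1) • X j.1)
    {i : ℤ} (hi : (w.homotopyString β γ).IsBreak i) (hi0 : -1 ≤ i) {a : E}
    (hXe : Q.idem K ((w.homotopyString β γ).vert i) • X i = X i)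
    (hX : ∀ l, i ≤ l → l < L → ∀ a, (w.homotopyString β γ).letter l = some (.inverse a) →
      (i < l → ∀ b, (w.homotopyString β γ).letter (l - 1) ≠ some (.direct b)) →
      Q.arrow K a • X (l + 1) = X l)
    (ha : (w.homotopyString β γ).letter i = some (.inverse a)) :
    ((Word.stringCovering (K := K) (T.isWalk hw) p).outgoing (T.isWalk hw) hQ).eval F ⟨i, hi⟩ true
      = - (algebraMap K (Q.BoundPathAlgebra K) (om i) • X i) := by
  obtain ⟨k, hk⟩ := T.exists_isInverseLetter hw hi ha
  have hlt := hk.1.1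
  obtain ⟨c, hc⟩ := hk.letter_right
  have hkL : k ≤ L := by
    by_contra h0
    obtain ⟨b, hb⟩ := T.letter_top_eq_direct (by omega) hc
    cases hb
  have hkd : w.piDegree β γ L k = 0 := piDegree_of_not_direct (by omega) hkL (by simp [hc])
  refine (Word.stringCovering (K := K) (T.isWalk hw) p).eval_inverse (T.isWalk hw) hQ F X
    om (i := ⟨i, hi⟩) (j := ⟨k, hk.1.2.2.1⟩) hk rfl (hF _ hkd) hXe
    (fun l hl hl' b hb => ?_) ?_
  · refine hX l hl (lt_of_lt_of_le hl' hkL) b hb fun hil d hd' => ?_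
    obtain ⟨e, he⟩ := hk.2 (l - 1) (by omega) (by omega)
    rw [hd'] at he
    cases he
  · exact (one_mul _).trans (hd _ _ hk)

theorem eval_true_eq_zero (hQ : Q.IsGentle K) (hw : w.Extends β γ) {p : ℤ}
    (F : ((w.homotopyString β γ).stringSystem K p).ι → N) {i : ℤ}
    (hi : (w.homotopyString β γ).IsBreak i) (h : L ≤ i) :
    ((Word.stringCovering (K := K) (T.isWalk hw) p).outgoing (T.isWalk hw) hQ).eval F ⟨i, hi⟩ true
      = 0 := by
  refine Word.Covering.eval_of_not _ _ _ _ fun h' => ?_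
  obtain ⟨c, hc⟩ := h'.isInverseLetter.letter_left
  obtain ⟨d, hd⟩ := T.letter_top_eq_direct h hc
  cases hd

theorem eval_false_eq_zero (hQ : Q.IsGentle K) (hw : w.Extends β γ) {p : ℤ}
    (F : ((w.homotopyString β γ).stringSystem K p).ι → N) {i : ℤ}
    (hi : (w.homotopyString β γ).IsBreak i) (h : i ≤ 0) :
    ((Word.stringCovering (K := K) (T.isWalk hw) p).outgoing (T.isWalk hw) hQ).eval F ⟨i, hi⟩ false
      = 0 := by
  refine Word.Covering.eval_of_not _ _ _ _ fun h' => ?_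
  obtain ⟨c, hc⟩ := h'.isDirectLetter.letter_right
  obtain ⟨d, hd⟩ := letter_neg_eq_inverse (by change i - 1 < 0; omega) hc
  cases hd

end GString.IsTrim

end StringResolutions

section StringModules

variable {V E : Type u} {Q : BoundQuiver V E} {K : Type u} [Field K] [Fintype V]

/-! ### The string module -/

theorem algebraMap_smul_injective {N : Type*} [AddCommGroup N] [Module (Q.BoundPathAlgebra K) N]
    {c : K} (hc : c ≠ 0) {x y : N} (h : algebraMap K (Q.BoundPathAlgebra K) c • x =
      algebraMap K (Q.BoundPathAlgebra K) c • y) : x = y := by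
  have := congrArg (fun z => algebraMap K (Q.BoundPathAlgebra K) c⁻¹ • z) h
  simpa only [← mul_smul, ← map_mul, inv_mul_cancel₀ hc, map_one, one_smul] using this

namespace GString

variable {w : Q.GString} {β γ : Option E}

variable {N : Type*} [AddCommGroup N] [Module (Q.BoundPathAlgebra K) N]

open scoped Classical in
/-- The action of an arrow on the basis of the string module, in terms of the letters of an
extension of `w` and of a family of vectors that vanishes outside of `w`. -/
theorem sum_coef_smul (Y : ℤ → N)
    (htop : ∀ b, (w.extended β γ).letter w.letters.length = some (.direct b) →
      Y (w.letters.length + 1) = 0)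
    (hbot : ∀ c, (w.extended β γ).letter (-1) = some (.inverse c) → Y (-1) = 0) (a : E)
    (i : Fin (w.letters.length + 1)) :
    ∑ j, algebraMap K (Q.BoundPathAlgebra K) ((w.rep K).coef a i j) • Y (j : ℕ) =
      (if (w.extended β γ).letter (i : ℕ) = some (.direct a) then Y ((i : ℕ) + 1) else 0) +
        if (w.extended β γ).letter ((i : ℕ) - 1) = some (.inverse a) then Y ((i : ℕ) - 1) else 0 := by
  have hi := i.2
  have key : ∀ j : Fin (w.letters.length + 1),
      algebraMap K (Q.BoundPathAlgebra K) ((w.rep K).coef a i j) • Y (j : ℕ) =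
        (if (j : ℕ) = i + 1 then if (w.extended β γ).letter (i : ℕ) = some (.direct a) then
          Y ((i : ℕ) + 1) else 0 else 0) +
        if (i : ℕ) = j + 1 then if (w.extended β γ).letter ((i : ℕ) - 1) = some (.inverse a) then
          Y ((i : ℕ) - 1) else 0 else 0 := by
    intro j
    have hj := j.2
    simp only [rep]
    by_cases h1 : (j : ℕ) = i + 1
    · rw [if_pos h1, if_neg (c := (i : ℕ) = j + 1) (by omega), add_zero,
        extended_letter (by omega), h1]
      by_cases h2 : w.letters[(i : ℕ)]? = some (.direct a)
      · rw [if_pos (.inl ⟨rfl, h2⟩), if_pos h2, map_one, one_smul]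
        push_cast
        rfl
      · rw [if_neg, if_neg h2, map_zero, zero_smul]
        rintro (⟨-, h⟩ | ⟨h, -⟩)
        · exact h2 h
        · omega
    · rw [if_neg h1, zero_add]
      by_cases h3 : (i : ℕ) = j + 1
      · rw [if_pos h3, show (i : ℕ) - (1 : ℤ) = (j : ℕ) by omega, extended_letter (by omega)]
        by_cases h2 : w.letters[(j : ℕ)]? = some (.inverse a)
        · rw [if_pos (.inr ⟨h3, h2⟩), if_pos h2, map_one, one_smul]
        · rw [if_neg, if_neg h2, map_zero, zero_smul]
          rintro (⟨h, -⟩ | ⟨-, h⟩)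
          · exact h1 h
          · exact h2 h
      · rw [if_neg h3, if_neg, map_zero, zero_smul]
        rintro (⟨h, -⟩ | ⟨h, -⟩)
        · exact h1 h
        · exact h3 h
  rw [Finset.sum_congr rfl fun j _ => key j, Finset.sum_add_distrib]
  congr 1
  · by_cases hin : (i : ℕ) < w.letters.length
    · rw [Finset.sum_eq_single ⟨i + 1, by omega⟩, if_pos rfl]
      · intro j _ hj
        exact if_neg fun h => hj (Fin.ext h)
      · exact fun h => absurd (Finset.mem_univ _) h
    · have e : (i : ℕ) = w.letters.length := by omega
      rw [e]
      have h0 : (if (w.extended β γ).letter (w.letters.length : ℕ) = some (.direct a) then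
          Y ((w.letters.length : ℕ) + 1) else 0) = 0 := by
        split_ifs with h
        · exact htop a h
        · rfl
      rw [h0]
      exact Finset.sum_eq_zero fun j _ => ite_self _
  · by_cases hin : 0 < (i : ℕ)
    · rw [Finset.sum_eq_single ⟨i - 1, by omega⟩, if_pos (by simp only; omega)]
      · intro j _ hj
        exact if_neg fun h => hj (Fin.ext (by simp only; omega))
      · exact fun h => absurd (Finset.mem_univ _) h
    · have e : (i : ℕ) = 0 := by omega
      rw [e]
      have h0 : (if (w.extended β γ).letter ((0 : ℕ) - 1) = some (.inverse a) then
          Y ((0 : ℕ) - 1) else 0) = 0 := by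
        rw [Nat.cast_zero, zero_sub]
        split_ifs with h
        · exact hbot a h
        · rfl
      rw [h0]
      exact Finset.sum_eq_zero fun j _ => ite_self _

omit [Fintype V] in
theorem letter_sub_one_ne (hw : w.Extends β γ) {q : ℤ} {a : E}
    (h : (w.extended β γ).letter q = some (.direct a)) :
    (w.extended β γ).letter (q - 1) ≠ some (.inverse a) := fun h' =>
  (extended_compatible hw h' (by rwa [sub_add_cancel])).1.2 rfl

variable (w K) in
/-- The basis vectors of the string module, together with zero vectors outside of `w`. -/
noncomputable def stringBasis (q : ℤ) : (w.rep K).toModule :=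
  if h : 0 ≤ q ∧ q ≤ w.letters.length then (w.rep K).basisVec ⟨q.toNat, by omega⟩ else 0

theorem stringBasis_coe (i : Fin (w.letters.length + 1)) :
    w.stringBasis K (i : ℕ) = (w.rep K).basisVec i := by
  have := i.2
  rw [stringBasis, dif_pos ⟨by omega, by omega⟩]
  rfl

theorem stringBasis_of_lt {q : ℤ} (h : q < 0) : w.stringBasis K q = 0 := dif_neg (by omega)

theorem stringBasis_of_gt {q : ℤ} (h : w.letters.length < q) : w.stringBasis K q = 0 :=
  dif_neg (by omega)

theorem idem_smul_stringBasis (q : ℤ) :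
    Q.idem K ((w.extended β γ).vert q) • w.stringBasis K q = w.stringBasis K q := by
  by_cases h : 0 ≤ q ∧ q ≤ w.letters.length
  · obtain ⟨k, rfl⟩ := Int.eq_ofNat_of_zero_le h.1
    rw [extended_vert (by omega)]
    have := (w.rep K).idem_smul_basisVec ⟨k, by omega⟩
    rw [← stringBasis_coe] at this
    exact this
  · rw [stringBasis, dif_neg h, smul_zero]

open scoped Classical in
theorem arrow_smul_stringBasis (β γ : Option E) (a : E) {q : ℕ} (hq : q ≤ w.letters.length) :
    Q.arrow K a • w.stringBasis K q =
      (if (w.extended β γ).letter q = some (.direct a) then w.stringBasis K (q + 1) else 0) +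
        if (w.extended β γ).letter (q - 1) = some (.inverse a) then w.stringBasis K (q - 1)
        else 0 := by
  rw [← sum_coef_smul (K := K) (w.stringBasis K) (fun _ _ => stringBasis_of_gt (by omega))
    (fun _ _ => stringBasis_of_lt (by omega)) a ⟨q, by omega⟩,
    stringBasis_coe ⟨q, by omega⟩]
  have := (w.rep K).sum_coord (Q.arrow K a • (w.rep K).basisVec ⟨q, by omega⟩)
  rw [← this]
  refine Finset.sum_congr rfl fun j _ => ?_
  rw [MatrixRep.coord_arrow_smul_basisVec, stringBasis_coe]

theorem arrow_smul_stringBasis_direct (hw : w.Extends β γ) {q : ℤ} {a : E}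
    (h : (w.extended β γ).letter q = some (.direct a)) :
    Q.arrow K a • w.stringBasis K q = w.stringBasis K (q + 1) := by
  obtain ⟨h0, h1⟩ := extended_direct_bound h
  obtain ⟨k, rfl⟩ := Int.eq_ofNat_of_zero_le h0
  rw [arrow_smul_stringBasis β γ a (by omega), if_pos h, if_neg (letter_sub_one_ne hw h), add_zero]

theorem arrow_smul_stringBasis_inverse (hw : w.Extends β γ) {q : ℤ} {a : E}
    (h : (w.extended β γ).letter q = some (.inverse a)) :
    Q.arrow K a • w.stringBasis K (q + 1) = w.stringBasis K q := by
  obtain ⟨h0, h1⟩ := extended_inverse_bound h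
  obtain ⟨k, hk⟩ := Int.eq_ofNat_of_zero_le (show 0 ≤ q + 1 by omega)
  obtain rfl : q = k - 1 := by omega
  rw [sub_add_cancel, arrow_smul_stringBasis β γ a (by omega), if_pos h, if_neg, zero_add]
  intro h'
  exact letter_sub_one_ne hw h' h

namespace IsTrim

variable {o L : ℕ} (T : w.IsTrim β γ o L)

include T

/-- The basis vectors at the summands of degree `0` generate the string module. -/
theorem eq_top_of_stringBasis_mem (hw : w.Extends β γ)
    (W : Submodule (Q.BoundPathAlgebra K) (w.rep K).toModule)
    (hW : ∀ k : ℕ, (w.homotopyString β γ).IsBreak k → w.piDegree β γ L k = 0 →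
      w.stringBasis K (k + o) ∈ W) : W = ⊤ := by
  have h1 : ∀ q : ℕ, q ≤ w.letters.length →
      (∀ a, (w.extended β γ).letter q ≠ some (.inverse a)) → w.stringBasis K q ∈ W := by
    intro q
    induction q with
    | zero =>
      intro hq h
      obtain ⟨k, hk, hk', hk''⟩ := T.isBreak_of_extended hw hq (fun a ha => by
        have := (extended_direct_bound ha).1
        omega) h
      rw [hk]
      exact_mod_cast hW k hk' hk''
    | succ q ih =>
      intro hq h
      by_cases hd : ∃ a, (w.extended β γ).letter q = some (.direct a)
      · obtain ⟨a, ha⟩ := hd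
        rw [Nat.cast_succ, ← arrow_smul_stringBasis_direct hw ha]
        exact W.smul_mem _ (ih (by omega) fun b hb => by
          rw [ha] at hb
          cases hb)
      · push Not at hd
        obtain ⟨k, hk, hk', hk''⟩ := T.isBreak_of_extended hw hq (by
          rw [Nat.cast_succ, add_sub_cancel_right]
          exact hd) h
        rw [hk]
        exact_mod_cast hW k hk' hk''
  have h2 : ∀ r q : ℕ, q + r = w.letters.length → w.stringBasis K q ∈ W := by
    intro r
    induction r with
    | zero =>
      intro q hq
      refine h1 q (by omega) fun a ha => ?_
      have := (extended_inverse_bound ha).2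
      omega
    | succ r ih =>
      intro q hq
      by_cases hd : ∃ a, (w.extended β γ).letter q = some (.inverse a)
      · obtain ⟨a, ha⟩ := hd
        rw [← arrow_smul_stringBasis_inverse hw ha, ← Nat.cast_succ]
        exact W.smul_mem _ (ih (q + 1) (by omega))
      · push Not at hd
        exact h1 q (by omega) hd
  refine (w.rep K).eq_top_of_basisVec_mem W fun i => ?_
  rw [← stringBasis_coe]
  exact h2 (w.letters.length - i) i (by have := i.2; omega)

variable {om : ℤ → K}

/-- Vectors along the module part satisfy the relations of the complex, if the arrows of `π(w)` move
them, up to the vectors beyond the module part, which have to vanish. -/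
theorem relations (hQ : Q.IsGentle K) (hw : w.Extends β γ) {p : ℤ}
    (hp : (w.homotopyString β γ).IsPeak p)
    (hd : ∀ i j, (w.homotopyString β γ).IsDirectLetter j i → om j = om i)
    (hi : ∀ i j, (w.homotopyString β γ).IsInverseLetter i j → om j = - om i)
    {F : ((w.homotopyString β γ).stringSystem K p).ι → N} {X : ℤ → N}
    (hF : ∀ j, w.piDegree β γ L j.1 = 0 →
      F j = algebraMap K (Q.BoundPathAlgebra K) (om j.1) • X j.1)
    (hXe : ∀ k : ℤ, 0 ≤ k → k ≤ L → Q.idem K ((w.homotopyString β γ).vert k) • X k = X k)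
    (hX : ∀ l : ℤ, 0 ≤ l → l ≤ L → ∀ a, (w.homotopyString β γ).letter l = some (.direct a) →
      Q.arrow K a • X l = X (l + 1))
    (hX' : ∀ l : ℤ, -1 ≤ l → l < L → ∀ a, (w.homotopyString β γ).letter l = some (.inverse a) →
      Q.arrow K a • X (l + 1) = X l)
    (htop : ∀ a, (w.homotopyString β γ).letter L = some (.direct a) → X (L + 1) = 0)
    (hbot : ∀ a, (w.homotopyString β γ).letter (-1) = some (.inverse a) → X (-1) = 0) :
    ((Word.stringCovering (K := K) (T.isWalk hw) p).outgoing (T.isWalk hw) hQ).Relations (-1)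
      F := by
  rintro ⟨i, hib⟩ hdeg
  change (w.homotopyString β γ).degree p i = -1 at hdeg
  rw [T.degree_eq hw hp hib.1] at hdeg
  rcases eq_of_piDegree_eq hdeg with rfl | rfl | ⟨h0, h1, a, ha⟩
  · obtain ⟨u, hu⟩ := T.exists_letter_of_le hw hib.1 zero_mem_pos le_rfl (by omega)
    obtain ⟨a, rfl⟩ := letter_neg_eq_inverse (by omega) hu
    rw [T.eval_false_eq_zero hQ hw F hib (by omega), add_zero,
      T.eval_true hQ hw hi hF hib le_rfl (by rw [hbot a hu, smul_zero])
        (fun l hl hl' b hb _ => hX' l hl hl' b hb) hu, hbot a hu, smul_zero, neg_zero]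
  · obtain ⟨u, hu⟩ := T.exists_letter_of_le hw zero_mem_pos hib.1 (k := L) (by omega) (by omega)
    obtain ⟨a, rfl⟩ := T.letter_top_eq_direct le_rfl hu
    rw [T.eval_true_eq_zero hQ hw F hib (by omega), zero_add,
      T.eval_false hQ hw hd hF hXe hib le_rfl (fun l hl hl' b hb => hX l hl (by omega) b hb)
        (by rwa [add_sub_cancel_right]), htop a hu, smul_zero]
  · obtain ⟨-, hL, b, hb⟩ := T.exists_inverse_of_deep hw h1 hib ha
    rw [T.eval_false hQ hw hd hF hXe hib (by omega)
        (fun l hl hl' b hb => hX l hl (by omega) b hb) ha,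
      T.eval_true hQ hw hi hF hib (by omega) (hXe i h0 h1)
        (fun l hl hl' b hb _ => hX' l (by omega) hl' b hb) hb, neg_add_cancel]

/-- A family of vectors on the positions of `w` with prescribed values at the summands of degree `0`
that satisfy the relations of the complex: it is moved by the letters of `b w c⁻¹` and vanishes
outside of `w`. -/
theorem exists_family_of_relations (hQ : Q.IsGentle K) (hw : w.Extends β γ) {p : ℤ}
    (hp : (w.homotopyString β γ).IsPeak p) (h0 : ∀ k, om k ≠ 0)
    (hd : ∀ i j, (w.homotopyString β γ).IsDirectLetter j i → om j = om i)
    (hi : ∀ i j, (w.homotopyString β γ).IsInverseLetter i j → om j = - om i)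
    {G : ((w.homotopyString β γ).stringSystem K p).ι → N}
    (hGe : ∀ i, Q.idem K ((w.homotopyString β γ).vert i.1) • G i = G i)
    (hG : ((Word.stringCovering (K := K) (T.isWalk hw) p).outgoing (T.isWalk hw) hQ).Relations
      (-1) G) :
    ∃ Y : ℤ → N, (∀ q, Q.idem K ((w.extended β γ).vert q) • Y q = Y q) ∧
      (∀ j, w.piDegree β γ L j.1 = 0 →
        G j = algebraMap K (Q.BoundPathAlgebra K) (om j.1) • Y (j.1 + o)) ∧
      (∀ q a, (w.extended β γ).letter q = some (.direct a) → Q.arrow K a • Y q = Y (q + 1)) ∧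
      (∀ q a, (w.extended β γ).letter q = some (.inverse a) → Q.arrow K a • Y (q + 1) = Y q) ∧
      (∀ a, (w.extended β γ).letter w.letters.length = some (.direct a) →
        Y (w.letters.length + 1) = 0) ∧
      ∀ a, (w.extended β γ).letter (-1) = some (.inverse a) → Y (-1) = 0 := by
  classical
  have hle := T.le
  -- the vectors at the summands of degree `0`, which are spread along `b w c⁻¹`
  let B : ℤ → N := fun q => if h : (0 ≤ q - o ∧ q - o ≤ L) ∧ (w.homotopyString β γ).IsBreak (q - o)
    then algebraMap K (Q.BoundPathAlgebra K) (om (q - o))⁻¹ • G ⟨q - o, h.2⟩ else 0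
  have hBe : ∀ q, Q.idem K ((w.extended β γ).vert q) • B q = B q := by
    intro q
    by_cases h : (0 ≤ q - o ∧ q - o ≤ L) ∧ (w.homotopyString β γ).IsBreak (q - o)
    · have h1 : B q = _ := dif_pos h
      have h2 := hGe ⟨q - o, h.2⟩
      rw [T.vert_eq hw h.1.1 h.1.2, sub_add_cancel] at h2
      rw [h1, algebraMap_smul_comm, h2]
    · rw [show B q = 0 from dif_neg h, smul_zero]
  obtain ⟨Y, hYe, hYp, hYd, hYi, -⟩ := Word.exists_family (σ := w.extended β γ) (K := K)
    (fun i u h => extended_src hw h) (fun i u h => extended_tgt hw h) (w.letters.length + 2)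
    (fun i => by
      by_cases h : i - 1 ≤ w.letters.length
      · refine ⟨w.letters.length + 1, by omega, fun a ha => ?_⟩
        have := (extended_direct_bound ha).1
        push_cast at this
        omega
      · refine ⟨0, by omega, fun a ha => ?_⟩
        have := (extended_direct_bound ha).2
        push_cast at this
        omega)
    (fun i => by
      by_cases h : -1 ≤ i
      · refine ⟨w.letters.length + 1, by omega, fun a ha => ?_⟩
        have := (extended_inverse_bound ha).2
        push_cast at this
        omega
      · refine ⟨0, by omega, fun a ha => ?_⟩
        have := (extended_inverse_bound ha).1
        push_cast at this
        omega)
    (fun _ => 1) (fun _ => one_ne_zero) B hBe 0 (fun i => by rw [add_zero]) (fun _ => rfl)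
    (fun i => by rw [add_zero])
  simp only [map_one, one_smul] at hYd
  have hYG : ∀ j : ((w.homotopyString β γ).stringSystem K p).ι, w.piDegree β γ L j.1 = 0 →
      G j = algebraMap K (Q.BoundPathAlgebra K) (om j.1) • Y (j.1 + o) := by
    rintro ⟨k, hk⟩ hkd
    change w.piDegree β γ L k = 0 at hkd
    obtain ⟨hk0, hkL, hkn⟩ := piDegree_eq_zero_iff.1 hkd
    have hB : B (k + o) = algebraMap K (Q.BoundPathAlgebra K) (om k)⁻¹ • G ⟨k, hk⟩ := by
      have h : (0 ≤ k + o - o ∧ k + o - o ≤ L) ∧ (w.homotopyString β γ).IsBreak (k + o - o) := by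
        rw [add_sub_cancel_right]
        exact ⟨⟨hk0, hkL⟩, hk⟩
      refine (dif_pos h).trans ?_
      congr 2
      · rw [add_sub_cancel_right]
      · exact Subtype.ext (add_sub_cancel_right _ _)
    change G ⟨k, hk⟩ = algebraMap K (Q.BoundPathAlgebra K) (om k) • Y (k + o)
    rw [hYp, hB, ← mul_smul, ← map_mul, mul_inv_cancel₀ (h0 k), map_one, one_smul]
    · intro a ha
      rcases hk0.eq_or_lt with rfl | hk0
      · rw [zero_add] at ha
        exact T.extended_letter_ne_direct a ha
      · obtain ⟨u, hu, hu'⟩ := T.exists_letter (i := k - 1) (by omega) (by omega)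
        rw [sub_add_eq_add_sub, ha] at hu'
        exact hkn a (hu.trans hu'.symm)
    · intro a ha
      rcases hkL.eq_or_lt with rfl | hkL
      · exact T.extended_letter_ne_inverse a ha
      · obtain ⟨u, hu, hu'⟩ := T.exists_letter hk0 hkL
        obtain rfl := Option.some.inj (hu'.symm.trans ha)
        cases hv : (w.homotopyString β γ).letter (k - 1) with
        | none =>
          obtain rfl : k = 0 := by
            by_contra hk
            obtain ⟨u, hu, -⟩ := T.exists_letter (i := k - 1) (by omega) (by omega)
            rw [hv] at hu
            cases hu
          exact T.letter_zero_ne hv a hu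
        | some v =>
          cases v with
          | direct b => exact hkn b hv
          | inverse b => exact (T.isBreak_iff hw hk0 hkL.le).1 hk _ _ hv hu rfl
  have hXe : ∀ k : ℤ, 0 ≤ k → k ≤ L →
      Q.idem K ((w.homotopyString β γ).vert k) • Y (k + o) = Y (k + o) := by
    intro k hk hk'
    rw [T.vert_eq hw hk hk']
    exact hYe _
  have hX : ∀ l : ℤ, 0 ≤ l → l ≤ L → ∀ a, (w.homotopyString β γ).letter l = some (.direct a) →
      Q.arrow K a • Y (l + o) = Y (l + 1 + o) := by
    intro l hl hl' a ha
    rw [hYd _ a (T.extended_letter_eq (by omega) hl' ha), add_right_comm]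
  have hX' : ∀ l : ℤ, -1 ≤ l → l < L → ∀ a, (w.homotopyString β γ).letter l = some (.inverse a) →
      (∀ b, (w.extended β γ).letter (l + o - 1) ≠ some (.direct b)) →
      Q.arrow K a • Y (l + 1 + o) = Y (l + o) := by
    intro l hl hl' a ha h
    rw [add_right_comm]
    exact hYi _ a (T.extended_letter_eq hl hl'.le ha) h
  have hprev : ∀ l : ℤ, 0 ≤ l → l < L →
      (∀ b, (w.homotopyString β γ).letter (l - 1) ≠ some (.direct b)) →
      ∀ b, (w.extended β γ).letter (l + o - 1) ≠ some (.direct b) := by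
    intro l hl hl' h b hb
    rcases hl.eq_or_lt with rfl | hl
    · rw [zero_add] at hb
      exact T.extended_letter_ne_direct b hb
    · obtain ⟨u, hu, hu'⟩ := T.exists_letter (i := l - 1) (by omega) (by omega)
      rw [sub_add_eq_add_sub, hb] at hu'
      exact h b (hu.trans hu'.symm)
  -- where a direct letter is followed by an inverse one, the relation says that the vectors reached
  -- from the two sides agree
  have hdeep : ∀ q a b, (w.extended β γ).letter q = some (.inverse a) →
      (w.extended β γ).letter (q - 1) = some (.direct b) → Q.arrow K a • Y (q + 1) = Y q := by
    intro q a b ha hb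
    have hq0 := (extended_direct_bound hb).1
    have hqn := (extended_inverse_bound ha).2
    obtain ⟨m, rfl⟩ := Int.eq_ofNat_of_zero_le (show 0 ≤ q by omega)
    have hom : o < m := by
      by_contra h
      rcases (show m ≤ o by omega).eq_or_lt with rfl | h
      · exact T.extended_letter_ne_direct b hb
      · obtain ⟨c, hc⟩ := T.lt_o (m - 1) (by omega)
        rw [show (m : ℤ) - 1 = (m - 1 : ℕ) by omega, extended_letter (by omega), hc] at hb
        cases hb
    have hmL : m < o + L := by
      by_contra h
      obtain ⟨c, hc⟩ := T.ge_L m (by omega) (by omega)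
      rw [extended_letter (by omega), hc] at ha
      cases ha
    obtain ⟨i, rfl⟩ : ∃ i : ℕ, m = i + o := ⟨m - o, by omega⟩
    obtain ⟨u, hu, hu'⟩ := T.exists_letter (i := i) (by omega) (by omega)
    rw [← Nat.cast_add, ha] at hu'
    obtain rfl := Option.some.inj hu'
    obtain ⟨v, hv, hv'⟩ := T.exists_letter (i := i - 1) (by omega) (by omega)
    rw [sub_add_eq_add_sub, ← Nat.cast_add, hb] at hv'
    obtain rfl := Option.some.inj hv'
    have hib : (w.homotopyString β γ).IsBreak i :=
      (T.isBreak_iff hw (by omega) (by omega)).2 fun u v hu' hv' => by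
        rw [hv] at hu'
        rw [hu] at hv'
        obtain rfl := Option.some.inj hu'
        obtain rfl := Option.some.inj hv'
        simp [Letter.isDirect]
    have hrel := hG ⟨i, hib⟩ (by
      change (w.homotopyString β γ).degree p i = -1
      rw [T.degree_eq hw hp hib.1, piDegree_of_direct (by omega) hv])
    -- the vector at the position `i` is replaced by the one that is reached from the left
    have h1 := T.eval_true hQ hw hi (F := G) (X := fun l => if l = i then
      Q.arrow K a • Y (i + 1 + o) else Y (l + o)) (i := i) (a := a) ?_ hib (by omega) ?_ ?_ hu
    · rw [T.eval_false hQ hw hd (X := fun l => Y (l + o)) hYG hXe hib (by omega)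
        (fun l hl hl' c hc => hX l hl (by omega) c hc) hv, h1, neg_add_eq_zero, if_pos rfl] at hrel
      push_cast
      rw [add_right_comm, algebraMap_smul_injective (h0 i) hrel]
    · rintro ⟨j, hj⟩ hjd
      have hne : j ≠ i := by
        rintro rfl
        rw [piDegree_of_direct (by omega) hv] at hjd
        omega
      change G ⟨j, hj⟩ = _ • (if j = i then _ else _)
      rw [if_neg hne]
      exact hYG ⟨j, hj⟩ hjd
    · rw [if_pos rfl, ← mul_smul, (T.isWalk hw).idem_mul_arrow_inverse hu]
    · intro l hl hl' c hc hlc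
      rw [if_neg (by omega)]
      rcases hl.eq_or_lt with rfl | hl
      · rw [if_pos rfl]
        rw [hu] at hc
        obtain rfl := Letter.inverse.inj (Option.some.inj hc)
        rfl
      · rw [if_neg (by omega)]
        exact hX' l (by omega) hl' c hc (hprev l (by omega) hl' (hlc hl))
  refine ⟨Y, hYe, hYG, hYd, fun q a ha => ?_, fun a ha => ?_, fun a ha => ?_⟩
  · by_cases h : ∃ b, (w.extended β γ).letter (q - 1) = some (.direct b)
    · obtain ⟨b, hb⟩ := h
      exact hdeep q a b ha hb
    · push Not at h
      exact hYi q a ha h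
  -- the relation at the first summand of the left antipath makes the vector beyond `w` vanish
  · have hβ : β = some a := by
      rw [extended_letter_length, Option.map_eq_some_iff] at ha
      obtain ⟨b, hb, h⟩ := ha
      rw [hb, Letter.direct.inj h]
    have hoL := T.L_eq (by simp [hβ])
    have hl : (w.homotopyString β γ).letter L = some (.direct a) := by
      rw [T.letter_of_ge le_rfl, sub_self, hβ]
      rfl
    have hib := T.isBreak_of_gt (i := L + 1) (by omega) ((T.isWalk hw).mem_pos_succ hl)
    have hrel := hG ⟨L + 1, hib⟩ (by
      change (w.homotopyString β γ).degree p (L + 1) = -1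
      rw [T.degree_eq hw hp hib.1, piDegree_of_gt (by omega)]
      ring)
    rw [T.eval_true_eq_zero hQ hw G hib (by omega), zero_add,
      T.eval_false hQ hw hd (X := fun l => Y (l + o)) hYG hXe hib le_rfl
        (fun l hl hl' c hc => hX l hl (by omega) c hc) (by rwa [add_sub_cancel_right])] at hrel
    have h2 := algebraMap_smul_injective (h0 _) (hrel.trans (smul_zero _).symm)
    rw [← h2, ← hoL]
    congr 1
    push_cast
    ring
  -- the relation at the first summand of the right antipath likewise
  · have hγ : γ = some a := by
      rw [extended_letter_neg_one, Option.map_eq_some_iff] at ha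
      obtain ⟨b, hb, h⟩ := ha
      rw [hb, Letter.inverse.inj h]
    have ho := T.o_eq (by simp [hγ])
    have hl : (w.homotopyString β γ).letter (-1) = some (.inverse a) := by
      rw [homotopyString_letter_neg (by omega), hγ]
      rfl
    have hib := isBreak_of_neg (i := -1) (by omega) ((T.isWalk hw).mem_pos hl)
    have hrel := hG ⟨-1, hib⟩ (by
      change (w.homotopyString β γ).degree p (-1) = -1
      rw [T.degree_eq hw hp hib.1, piDegree_of_neg (by omega)])
    rw [T.eval_false_eq_zero hQ hw G hib (by omega), add_zero,
      T.eval_true hQ hw hi (X := fun l => Y (l + o)) hYG hib le_rfl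
        (by
          have h1 := hYe (-1)
          have h2 := (T.isWalk hw).src_eq _ _ hl
          have h3 := extended_src hw ha
          rw [← h2, h3, ho, Nat.cast_zero, add_zero]
          exact h1)
        (fun l hl hl' c hc hlc => by
          refine hX' l hl hl' c hc ?_
          rcases hl.eq_or_lt with rfl | hl
          · intro b hb
            have := (extended_direct_bound hb).1
            omega
          · exact hprev l (by omega) hl' (hlc hl)) hl, neg_eq_zero] at hrel
    have h2 := algebraMap_smul_injective (h0 _) (hrel.trans (smul_zero _).symm)
    rw [← h2, ho, Nat.cast_zero, add_zero]

end IsTrim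

omit [Fintype V] in
/-- A maximal choice exists: a choice of `b` which is maximal for `w` alone stays maximal, when a
letter is added on the right. -/
theorem exists_isMaximalExtension (w : Q.GString) : ∃ β γ, w.IsMaximalExtension β γ := by
  have h0 : w.Extends none none := ⟨by simpa using w.chain, by simp, by simp⟩
  have h1 : ∃ β, w.Extends β none ∧ (β = none → ∀ b, ¬ w.Extends (some b) none) := by
    by_cases h : ∃ b, w.Extends (some b) none
    · obtain ⟨b, hb⟩ := h
      exact ⟨some b, hb, fun h => by cases h⟩
    · push Not at h
      exact ⟨none, h0, fun _ => h⟩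
  obtain ⟨β, hβ, hβ'⟩ := h1
  by_cases h : ∃ c, w.Extends β (some c)
  · obtain ⟨c, hc⟩ := h
    refine ⟨β, some c, hc, fun hn b hb => hβ' hn b ⟨?_, hb.2.1, by simp⟩, fun h => by cases h⟩
    have := hb.1
    rw [List.append_assoc] at this
    simpa using (List.isChain_append.1 this).2.1
  · push Not at h
    exact ⟨β, none, hβ, hβ', fun _ => h⟩

/-- The string complex of `π(w)` is a projective resolution of the string module `M(w)`. -/
theorem IsMaximalExtension.isProjectiveResolution (hQ : Q.IsGentle K)
    (hm : w.IsMaximalExtension β γ) {p : ℤ} (hp : (w.homotopyString β γ).IsPeak p) :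
    IsProjectiveResolution ((w.homotopyString β γ).stringComplex K p) (w.module K) := by
  classical
  have hw := hm.1
  obtain ⟨o, L, T⟩ := w.exists_isTrim β γ
  obtain ⟨om, h0, hd, hi⟩ := w.exists_signs β γ K
  have hle := T.le
  have hdeg : ∀ i : ((w.homotopyString β γ).stringSystem K p).ι,
      ((w.homotopyString β γ).stringSystem K p).deg i = w.piDegree β γ L i.1 :=
    fun i => T.degree_eq hw hp i.2.1
  rw [Word.stringComplex_eq]
  change IsProjectiveResolution _ (w.rep K).toModule
  refine ((Word.stringCovering (K := K) (T.isWalk hw) p).outgoing (T.isWalk hw)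
    hQ).isProjectiveResolution hQ (T.finite_idx hw hp)
    (fun i => by rw [hdeg]; exact piDegree_le _) (T.isExact hQ hw hp) _
    (fun j => algebraMap K (Q.BoundPathAlgebra K) (om j.1) • w.stringBasis K (j.1 + o))
    ?_ ?_ ?_ ?_
  · intro i hi0
    rw [hdeg] at hi0
    obtain ⟨h1, h2, -⟩ := piDegree_eq_zero_iff.1 hi0
    change Q.idem K ((w.homotopyString β γ).vert i.1) • _ = _
    rw [algebraMap_smul_comm, T.vert_eq hw h1 h2, idem_smul_stringBasis]
  · refine T.relations hQ hw hp hd hi (X := fun l => w.stringBasis K (l + o)) (fun _ _ => rfl)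
      ?_ ?_ ?_ ?_ ?_
    · intro k hk hk'
      rw [T.vert_eq hw hk hk', idem_smul_stringBasis]
    · intro l hl hl' a ha
      rw [arrow_smul_stringBasis_direct hw (T.extended_letter_eq (by omega) hl' ha),
        add_right_comm]
    · intro l hl hl' a ha
      rw [add_right_comm,
        arrow_smul_stringBasis_inverse hw (T.extended_letter_eq (by omega) hl'.le ha)]
    · intro a ha
      have := T.L_eq (by
        rintro rfl
        rw [T.letter_of_ge le_rfl, sub_self] at ha
        cases ha)
      exact stringBasis_of_gt (by omega)
    · intro a ha
      have := T.o_eq (by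
        rintro rfl
        rw [homotopyString_letter_neg (by omega)] at ha
        cases ha)
      exact stringBasis_of_lt (by omega)
  · intro W hW
    refine T.eq_top_of_stringBasis_mem hw W fun k hk hkd => ?_
    have h1 := hW ⟨k, hk⟩ ((hdeg ⟨k, hk⟩).trans hkd)
    have h2 := W.smul_mem (algebraMap K (Q.BoundPathAlgebra K) (om k)⁻¹) h1
    rwa [← mul_smul, ← map_mul, inv_mul_cancel₀ (h0 k), map_one, one_smul] at h2
  · intro N _ _ G hGe hG
    obtain ⟨Y, hYe, hYG, hYd, hYi, hYt, hYb⟩ :=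
      T.exists_family_of_relations hQ hw hp h0 hd hi hGe hG
    obtain ⟨f, hf⟩ := (w.rep K).exists_linearMap (fun i => Y (i : ℕ)) (fun i => by
        have := hYe (i : ℕ)
        rwa [extended_vert (by have := i.2; omega)] at this) (fun a i => by
      have hin : (i : ℕ) ≤ w.letters.length := by have := i.2; omega
      rw [sum_coef_smul Y hYt hYb]
      have hz : Q.idem K ((w.extended β γ).vert (i : ℕ)) • Y (i : ℕ) = Y (i : ℕ) := hYe _
      by_cases hd1 : (w.extended β γ).letter (i : ℕ) = some (.direct a)
      · rw [if_pos hd1, if_neg (letter_sub_one_ne hw hd1), add_zero, hYd _ a hd1]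
      by_cases hd2 : (w.extended β γ).letter ((i : ℕ) - 1) = some (.inverse a)
      · have := hYi _ a hd2
        rw [sub_add_cancel] at this
        rw [if_neg hd1, if_pos hd2, zero_add, this]
      rw [if_neg hd1, if_neg hd2, add_zero]
      -- the arrows that are not letters annihilate the vector, by the maximality of `b w c⁻¹`
      by_cases hs : Q.s a = (w.extended β γ).vert (i : ℕ)
      · rcases hm.arrow_cases hQ hin hs with h | h | ⟨b, hb, hab⟩ | ⟨b, hb, hab⟩
        · exact absurd h hd1
        · exact absurd h hd2
        · have := hYd _ b hb
          rw [sub_add_cancel] at this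
          rw [← this, ← mul_smul, arrow_mul_arrow_of_rel K hab, zero_smul]
        · rw [← hYi _ b hb, ← mul_smul, arrow_mul_arrow_of_rel K hab, zero_smul]
      · rw [← hz, ← mul_smul, arrow_mul_idem, if_neg (Ne.symm hs), zero_smul])
    refine ⟨f, fun i hi0 => ?_⟩
    rw [hdeg] at hi0
    obtain ⟨h1, h2, -⟩ := piDegree_eq_zero_iff.1 hi0
    obtain ⟨k, hk⟩ := Int.eq_ofNat_of_zero_le h1
    rw [hYG i hi0, hk, map_smul]
    congr 1
    have h3 := stringBasis_coe (w := w) (K := K) ⟨k + o, by omega⟩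
    have h4 := hf ⟨k + o, by omega⟩
    simp only [Nat.cast_add] at h3 h4
    rw [h3]
    exact h4

end GString

end StringModules

section CyclicWords

variable {V E : Type u} {Q : BoundQuiver V E}

/-! ### The periodic word of a band -/

theorem isPathFrom_map_range' (f : ℕ → E) (hf : ∀ k, Q.s (f (k + 1)) = Q.t (f k)) (m k : ℕ) :
    Q.IsPathFrom (Q.s (f k)) ((List.range' k m).map f) := by
  induction m generalizing k with
  | zero => trivial
  | succ m ih =>
    have := ih (k + 1)
    rw [hf] at this
    exact ⟨rfl, this⟩

/-- There is no infinite path without relations. -/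
theorem IsGentle.exists_rel {K : Type u} [Field K] [Fintype V] (hQ : Q.IsGentle K) (f : ℕ → E)
    (hf : ∀ k, Q.s (f (k + 1)) = Q.t (f k)) : ∃ k, Q.rel (f (k + 1)) (f k) := by
  by_contra h
  push Not at h
  obtain ⟨m, hm⟩ := hQ.admissible
  refine isChain_of_mem_relIdeal (hm ⟨Q.s (f 0), (List.range' 0 m).map f,
    isPathFrom_map_range' f hf m 0⟩ (by simp [Path.length])) ?_
  rw [List.isChain_iff_getElem]
  intro i hi
  simpa [add_comm] using h i

namespace GString

/-- The periodic two-sided infinite word `⋯ w w w ⋯`. -/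
abbrev cyclic (w : Q.GString) : Word Q := Word.periodic Q w.start w.letters

namespace IsBand

variable {w : Q.GString} (hw : w.IsBand)

theorem _root_.BoundQuiver.GString.cyclic_letter_emod (i : ℤ) :
    w.cyclic.letter (i % w.letters.length) = w.cyclic.letter i := by
  simp [Word.periodic]

theorem _root_.BoundQuiver.GString.cyclic_letter_add (i m : ℤ) :
    w.cyclic.letter (i + m * w.letters.length) = w.cyclic.letter i := by
  simp [Word.periodic]

theorem _root_.BoundQuiver.GString.cyclic_vert_add (i m : ℤ) :
    w.cyclic.vert (i + m * w.letters.length) = w.cyclic.vert i := by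
  simp [Word.periodic]

theorem _root_.BoundQuiver.GString.cyclic_letter_sub_add (i m : ℤ) :
    w.cyclic.letter (i + m * w.letters.length - 1) = w.cyclic.letter (i - 1) := by
  rw [add_sub_right_comm, cyclic_letter_add]

theorem _root_.BoundQuiver.GString.isBreak_cyclic_add (i m : ℤ) :
    w.cyclic.IsBreak (i + m * w.letters.length) ↔ w.cyclic.IsBreak i := by
  unfold Word.IsBreak
  rw [cyclic_letter_sub_add, cyclic_letter_add]
  exact Iff.rfl

theorem _root_.BoundQuiver.GString.IsDirectLetter.cyclic_add {i j : ℤ}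
    (h : w.cyclic.IsDirectLetter j i) (m : ℤ) :
    w.cyclic.IsDirectLetter (j + m * w.letters.length) (i + m * w.letters.length) := by
  obtain ⟨⟨h1, h2, h3, h4⟩, h5⟩ := h
  refine ⟨⟨by omega, (isBreak_cyclic_add _ _).2 h2, (isBreak_cyclic_add _ _).2 h3,
    fun k hk hk' hb => ?_⟩, fun k hk hk' => ?_⟩
  · refine h4 (k - m * w.letters.length) (by omega) (by omega) ?_
    rwa [← isBreak_cyclic_add _ m, sub_add_cancel]
  · obtain ⟨a, ha⟩ := h5 (k - m * w.letters.length) (by omega) (by omega)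
    rw [← cyclic_letter_add _ m, sub_add_cancel] at ha
    exact ⟨a, ha⟩

theorem _root_.BoundQuiver.GString.IsInverseLetter.cyclic_add {i j : ℤ}
    (h : w.cyclic.IsInverseLetter i j) (m : ℤ) :
    w.cyclic.IsInverseLetter (i + m * w.letters.length) (j + m * w.letters.length) := by
  obtain ⟨⟨h1, h2, h3, h4⟩, h5⟩ := h
  refine ⟨⟨by omega, (isBreak_cyclic_add _ _).2 h2, (isBreak_cyclic_add _ _).2 h3,
    fun k hk hk' hb => ?_⟩, fun k hk hk' => ?_⟩
  · refine h4 (k - m * w.letters.length) (by omega) (by omega) ?_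
    rwa [← isBreak_cyclic_add _ m, sub_add_cancel]
  · obtain ⟨a, ha⟩ := h5 (k - m * w.letters.length) (by omega) (by omega)
    rw [← cyclic_letter_add _ m, sub_add_cancel] at ha
    exact ⟨a, ha⟩

/-- Homotopy letters of a periodic word, moved by a multiple of the period. -/
theorem _root_.BoundQuiver.GString.hasLetter_cyclic_add {i : ℤ} {s : Bool}
    (h : w.cyclic.HasLetter i s) (m : ℤ) :
    w.cyclic.HasLetter (i + m * w.letters.length) s ∧
      w.cyclic.letterEnd (i + m * w.letters.length) s =
        w.cyclic.letterEnd i s + m * w.letters.length := by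
  cases s with
  | true =>
    have h' := IsInverseLetter.cyclic_add h.isInverseLetter m
    exact ⟨Word.hasLetter_true.2 ⟨_, h'⟩, h'.letterEnd_eq⟩
  | false =>
    have h' := IsDirectLetter.cyclic_add h.isDirectLetter m
    exact ⟨Word.hasLetter_false.2 ⟨_, h'⟩, h'.letterEnd_eq⟩

theorem _root_.BoundQuiver.GString.isBreak_cyclic_emod {i : ℤ} :
    w.cyclic.IsBreak (i % w.letters.length) ↔ w.cyclic.IsBreak i := by
  rw [← isBreak_cyclic_add (i % w.letters.length) (i / w.letters.length),
    Int.emod_add_ediv_mul]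

include hw

theorem length_pos : 0 < w.letters.length := List.length_pos_of_ne_nil hw.ne_nil

theorem exists_letter (i : ℤ) : ∃ u, w.cyclic.letter i = some u := by
  have := hw.length_pos
  have h1 := Int.emod_nonneg i (b := w.letters.length) (by omega)
  have h2 := Int.emod_lt_of_pos i (b := w.letters.length) (by omega)
  exact ⟨_, List.getElem?_eq_getElem (by omega)⟩

theorem compatible {i : ℤ} {u v : Letter E} (hu : w.cyclic.letter i = some u)
    (hv : w.cyclic.letter (i + 1) = some v) : Letter.Compatible Q u v := by
  have := hw.length_pos
  have h1 := Int.emod_nonneg i (b := w.letters.length) (by omega)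
  have h2 := Int.emod_lt_of_pos i (b := w.letters.length) (by omega)
  refine hw.compatible_getElem (i := (i % w.letters.length).toNat)
    (j := ((i + 1) % w.letters.length).toNat) (by omega) ?_ hu hv
  zify
  rw [Int.toNat_of_nonneg h1, Int.toNat_of_nonneg (Int.emod_nonneg _ (by omega)),
    Int.emod_add_emod]

theorem isWalk : w.cyclic.IsWalk where
  nonempty := ⟨0, trivial⟩
  ordConnected := Set.ordConnected_univ
  isSome_iff i := ⟨fun _ => ⟨trivial, trivial⟩, fun _ =>
    Option.isSome_iff_exists.2 (hw.exists_letter i)⟩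
  src_eq i u h := by
    change w.letters[(i % w.letters.length).toNat]? = some u at h
    simp only [Word.periodic]
    rw [h]
    rfl
  tgt_eq i u h := by
    obtain ⟨v, hv⟩ := hw.exists_letter (i + 1)
    rw [← (hw.compatible h hv).1.1]
    change w.letters[((i + 1) % w.letters.length).toNat]? = some v at hv
    simp only [Word.periodic]
    rw [hv]
    rfl
  adjacent i u v hu hv := (hw.compatible hu hv).1

theorem isBreak_iff {i : ℤ} : w.cyclic.IsBreak i ↔ ∀ u v, w.cyclic.letter (i - 1) = some u →
    w.cyclic.letter i = some v → u.isDirect ≠ v.isDirect := by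
  constructor
  · intro hb u v hu hv huv
    exact hb.2 u v hu hv (Letter.straight_of_compatible
      (hw.compatible hu (by rwa [sub_add_cancel])) huv)
  · exact fun hb => ⟨trivial, fun u v hu hv hs =>
      hb u v hu hv (Letter.isDirect_eq_of_straight hs)⟩

theorem exists_inverse {K : Type u} [Field K] [Fintype V] (hQ : Q.IsGentle K) :
    ∃ i a, w.cyclic.letter i = some (.inverse a) := by
  by_contra h
  push Not at h
  have hd : ∀ i, ∃ a, w.cyclic.letter i = some (.direct a) := by
    intro i
    obtain ⟨u, hu⟩ := hw.exists_letter i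
    cases u with
    | direct a => exact ⟨a, hu⟩
    | inverse a => exact absurd hu (h i a)
  choose f hf using hd
  have hc : ∀ k : ℕ, Letter.Compatible Q (.direct (f k)) (.direct (f (k + 1 : ℕ))) := fun k =>
    hw.compatible (hf k) (by exact_mod_cast hf (k + 1))
  obtain ⟨k, hk⟩ := hQ.exists_rel (fun k : ℕ => f k) fun k => (hc k).1.1
  exact (hc k).2 hk

theorem exists_direct {K : Type u} [Field K] [Fintype V] (hQ : Q.IsGentle K) :
    ∃ i a, w.cyclic.letter i = some (.direct a) := by
  by_contra h
  push Not at h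
  have hd : ∀ i, ∃ a, w.cyclic.letter i = some (.inverse a) := by
    intro i
    obtain ⟨u, hu⟩ := hw.exists_letter i
    cases u with
    | inverse a => exact ⟨a, hu⟩
    | direct a => exact absurd hu (h i a)
  choose f hf using hd
  have hc : ∀ k : ℕ, Letter.Compatible Q (.inverse (f (-(k + 1 : ℕ)))) (.inverse (f (-k))) :=
    fun k => hw.compatible (hf _) (by
      rw [Nat.cast_succ, neg_add, neg_add_cancel_right]
      exact hf _)
  obtain ⟨k, hk⟩ := hQ.exists_rel (fun k : ℕ => f (-k)) fun k => (hc k).1.1.symm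
  exact (hc k).2 hk

/-- Among as many consecutive letters as the band has, not all are direct. -/
theorem exists_inverse_window {K : Type u} [Field K] [Fintype V] (hQ : Q.IsGentle K) (i : ℤ) :
    ∃ k < w.letters.length, ∀ a, w.cyclic.letter (i - k - 1) ≠ some (.direct a) := by
  have hn := hw.length_pos
  obtain ⟨j, b, hb⟩ := hw.exists_inverse hQ
  have h1 := Int.emod_nonneg (i - 1 - j) (b := w.letters.length) (by omega)
  have h2 := Int.emod_lt_of_pos (i - 1 - j) (b := w.letters.length) (by omega)
  refine ⟨((i - 1 - j) % w.letters.length).toNat, by omega, fun a ha => ?_⟩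
  have h3 := Int.emod_add_ediv_mul (i - 1 - j) w.letters.length
  rw [show i - (((i - 1 - j) % w.letters.length).toNat : ℤ) - 1 =
    j + (i - 1 - j) / w.letters.length * w.letters.length by omega, cyclic_letter_add, hb] at ha
  cases ha

/-- Among as many consecutive letters as the band has, not all are inverse. -/
theorem exists_direct_window {K : Type u} [Field K] [Fintype V] (hQ : Q.IsGentle K) (i : ℤ) :
    ∃ k < w.letters.length, ∀ a, w.cyclic.letter (i + k) ≠ some (.inverse a) := by
  have hn := hw.length_pos
  obtain ⟨j, b, hb⟩ := hw.exists_direct hQ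
  have h1 := Int.emod_nonneg (j - i) (b := w.letters.length) (by omega)
  have h2 := Int.emod_lt_of_pos (j - i) (b := w.letters.length) (by omega)
  refine ⟨((j - i) % w.letters.length).toNat, by omega, fun a ha => ?_⟩
  have h3 := Int.emod_add_ediv_mul (j - i) w.letters.length
  rw [← cyclic_letter_add _ ((j - i) / w.letters.length),
    show i + (((j - i) % w.letters.length).toNat : ℤ) +
      (j - i) / w.letters.length * w.letters.length = j by omega, hb] at ha
  cases ha

theorem exists_isPeak {K : Type u} [Field K] [Fintype V] (hQ : Q.IsGentle K) :
    ∃ p, w.cyclic.IsPeak p := by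
  obtain ⟨i, a, ha⟩ := hw.exists_direct hQ
  obtain ⟨k, -, hk⟩ := hw.exists_inverse_window hQ i
  obtain ⟨j, ⟨hj, hj'⟩, hmax⟩ := Int.exists_greatest_of_bdd
    (P := fun j => j < i ∧ ∀ a, w.cyclic.letter j ≠ some (.direct a)) ⟨i, fun z hz => hz.1.le⟩
    ⟨i - k - 1, by omega, hk⟩
  refine ⟨j + 1, trivial, fun u hu => ?_, fun u hu => ?_⟩
  · cases u with
    | direct b => rfl
    | inverse b =>
      have hji : j + 1 ≠ i := by
        rintro rfl
        rw [ha] at hu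
        cases hu
      have := hmax (j + 1) ⟨by omega, fun c hc => by
        rw [hu] at hc
        cases hc⟩
      omega
  · rw [add_sub_cancel_right] at hu
    cases u with
    | inverse b => rfl
    | direct b => exact absurd hu (hj' b)

theorem isBreak_of_isPeak {p : ℤ} (hp : w.cyclic.IsPeak p) : w.cyclic.IsBreak p :=
  hw.isBreak_iff.2 fun u v hu hv huv => by
    rw [hp.2.1 v hv, hp.2.2 u hu] at huv
    cases huv

theorem exists_isBreak_lt {K : Type u} [Field K] [Fintype V] (hQ : Q.IsGentle K) (i : ℤ) :
    ∃ j < i, w.cyclic.IsBreak j := by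
  have hn := hw.length_pos
  obtain ⟨p, hp⟩ := hw.exists_isPeak hQ
  refine ⟨p + -(|p - i| + 1) * w.letters.length, ?_,
    (isBreak_cyclic_add _ _).2 (hw.isBreak_of_isPeak hp)⟩
  have h1 := le_abs_self (p - i)
  have h2 := abs_nonneg (p - i)
  nlinarith

theorem exists_isBreak_gt {K : Type u} [Field K] [Fintype V] (hQ : Q.IsGentle K) (i : ℤ) :
    ∃ j, i < j ∧ w.cyclic.IsBreak j := by
  have hn := hw.length_pos
  obtain ⟨p, hp⟩ := hw.exists_isPeak hQ
  refine ⟨p + (|p - i| + 1) * w.letters.length, ?_,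
    (isBreak_cyclic_add _ _).2 (hw.isBreak_of_isPeak hp)⟩
  have h1 := neg_abs_le (p - i)
  have h2 := abs_nonneg (p - i)
  nlinarith

omit hw in
open scoped Classical in
/-- The degree of the position `i` of the periodic word, if the peaks are in degree `0`. -/
noncomputable def _root_.BoundQuiver.GString.cyclicDegree (w : Q.GString) (i : ℤ) : ℤ :=
  if ∃ a, w.cyclic.letter (i - 1) = some (.direct a) then -1 else 0

omit hw in
theorem _root_.BoundQuiver.GString.cyclicDegree_add (i m : ℤ) :
    w.cyclicDegree (i + m * w.letters.length) = w.cyclicDegree i := by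
  unfold cyclicDegree
  rw [cyclic_letter_sub_add]

theorem cyclicDegree_succ (i : ℤ) :
    w.cyclicDegree (i + 1) = w.cyclicDegree i + w.cyclic.step i := by
  unfold cyclicDegree
  obtain ⟨u, hu⟩ := hw.exists_letter i
  obtain ⟨v, hv⟩ := hw.exists_letter (i - 1)
  rw [add_sub_cancel_right, hu, hv]
  by_cases hb : w.cyclic.IsBreak i
  · have huv := hw.isBreak_iff.1 hb _ _ hv hu
    cases u with
    | direct a =>
      rw [Word.step_direct hb hu]
      cases v with
      | direct b => exact absurd rfl huv
      | inverse b => simp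
    | inverse a =>
      rw [Word.step_inverse hb hu]
      cases v with
      | direct b => simp
      | inverse b => exact absurd rfl huv
  · rw [Word.step_of_not_isBreak hb]
    have huv : ¬ (v.isDirect ≠ u.isDirect) := fun h => hb (hw.isBreak_iff.2 fun u' v' hu' hv' => by
      rw [hv] at hu'
      rw [hu] at hv'
      obtain rfl := Option.some.inj hu'
      obtain rfl := Option.some.inj hv'
      exact h)
    cases u <;> cases v <;> simp_all [Letter.isDirect]

theorem degree_eq {p : ℤ} (hp : w.cyclic.IsPeak p) (i : ℤ) :
    w.cyclic.degree p i = w.cyclicDegree i := by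
  rw [Word.degree_eq_sub (g := w.cyclicDegree) fun k _ _ => hw.cyclicDegree_succ k]
  have : w.cyclicDegree p = 0 := by
    rw [cyclicDegree, if_neg]
    rintro ⟨a, ha⟩
    cases hp.2.2 _ ha
  rw [this, sub_zero]

/-- In the closed walk of a band, there are as many direct as inverse homotopy letters: the degree
does not change along one period. -/
theorem numDirect_eq_numInverse :
    Word.numDirect Q w.start w.letters = Word.numInverse Q w.start w.letters := by
  classical
  have h1 : ∑ k ∈ Finset.Ico 0 (w.letters.length : ℤ), w.cyclic.step k = 0 := by
    have := w.cyclic.degree_eq_sub (p := 0) (q := w.letters.length)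
      fun k _ _ => hw.cyclicDegree_succ k
    have h2 := w.cyclicDegree_add 0 1
    rw [one_mul, zero_add] at h2
    rwa [h2, sub_self, Word.degree, Finset.Ico_eq_empty (a := (w.letters.length : ℤ)) (by omega),
      Finset.sum_empty, sub_zero] at this
  have h2 : ∀ k, w.cyclic.step k =
      (if w.cyclic.IsBreak k ∧ ∃ a, w.cyclic.letter k = some (.inverse a) then 1 else 0) -
        if w.cyclic.IsBreak k ∧ ∃ a, w.cyclic.letter k = some (.direct a) then 1 else 0 := by
    intro k
    by_cases hb : w.cyclic.IsBreak k
    · obtain ⟨u, hu⟩ := hw.exists_letter k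
      cases u with
      | direct a =>
        rw [Word.step_direct hb hu, if_neg (by simp [hu]), if_pos ⟨hb, a, hu⟩]
        rfl
      | inverse a =>
        rw [Word.step_inverse hb hu, if_pos ⟨hb, a, hu⟩, if_neg (by simp [hu])]
        rfl
    · rw [Word.step_of_not_isBreak hb, if_neg fun h => hb h.1, if_neg fun h => hb h.1, sub_zero]
  rw [Finset.sum_congr rfl fun k _ => h2 k, Finset.sum_sub_distrib, Finset.sum_boole,
    Finset.sum_boole, sub_eq_zero] at h1
  have h3 : ∀ P : ℤ → Prop, {i : ℤ | 0 ≤ i ∧ i < w.letters.length ∧ P i}.ncard =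
      ((Finset.Ico 0 (w.letters.length : ℤ)).filter P).card := by
    intro P
    rw [← Set.ncard_coe_finset]
    congr 1
    ext i
    simp [and_assoc]
  rw [Word.numDirect, Word.numInverse, h3, h3]
  convert (Nat.cast_injective (R := ℤ) h1).symm

theorem isHomotopyBand : Word.IsHomotopyBand Q w.start w.letters where
  ne_nil := hw.ne_nil
  closed := hw.square.imp fun _ _ h => h.1
  primitive := hw.primitive
  balanced := hw.numDirect_eq_numInverse

theorem exists_isDirectLetter {K : Type u} [Field K] [Fintype V] (hQ : Q.IsGentle K) {i : ℤ}
    {a : E} (hi : w.cyclic.IsBreak i) (ha : w.cyclic.letter (i - 1) = some (.direct a)) :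
    ∃ j, w.cyclic.IsDirectLetter j i :=
  hw.isWalk.exists_isDirectLetter hi ha (hw.exists_isBreak_lt hQ i)

theorem exists_isInverseLetter {K : Type u} [Field K] [Fintype V] (hQ : Q.IsGentle K) {i : ℤ}
    {a : E} (hi : w.cyclic.IsBreak i) (ha : w.cyclic.letter i = some (.inverse a)) :
    ∃ j, w.cyclic.IsInverseLetter i j :=
  hw.isWalk.exists_isInverseLetter hi ha (hw.exists_isBreak_gt hQ i)

omit hw in
theorem _root_.BoundQuiver.GString.cyclicDegree_eq_zero_iff {i : ℤ} :
    w.cyclicDegree i = 0 ↔ ∀ a, w.cyclic.letter (i - 1) ≠ some (.direct a) := by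
  rw [cyclicDegree]
  split_ifs with h
  · obtain ⟨a, ha⟩ := h
    exact ⟨fun h => absurd h (by norm_num), fun h => absurd ha (h a)⟩
  · push Not at h
    exact ⟨fun _ => h, fun _ => rfl⟩

/-- A break which follows a direct letter precedes an inverse letter. -/
theorem exists_inverse_of_deep {i : ℤ} (hi : w.cyclic.IsBreak i) {a : E}
    (ha : w.cyclic.letter (i - 1) = some (.direct a)) :
    ∃ b, w.cyclic.letter i = some (.inverse b) := by
  obtain ⟨u, hu⟩ := hw.exists_letter i
  have := hw.isBreak_iff.1 hi _ _ ha hu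
  cases u with
  | direct b => exact absurd rfl this
  | inverse b => exact ⟨b, hu⟩

/-- A direct homotopy letter is shorter than the band, so it contains at most one of the letters
with the scalar. -/
theorem length_isDirectLetter {K : Type u} [Field K] [Fintype V] (hQ : Q.IsGentle K) {i j : ℤ}
    (h : w.cyclic.IsDirectLetter j i) : i - j < w.letters.length := by
  by_contra hn
  obtain ⟨k, hk, hk'⟩ := hw.exists_inverse_window hQ i
  obtain ⟨a, ha⟩ := h.2 (i - k - 1) (by omega) (by omega)
  exact hk' a ha

end IsBand

end GString

end CyclicWords

section BandComplexes

variable {V E : Type u} {Q : BoundQuiver V E}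

/-! ### Weights along a band -/

theorem weights_add {K : Type*} [Field K] {f om : ℤ → K} (h : ∀ k, om (k + 1) = f k * om k)
    (j : ℤ) (m : ℕ) : om (j + m) = (∏ t ∈ Finset.range m, f (j + t)) * om j := by
  induction m with
  | zero => simp
  | succ m ih =>
    rw [Nat.cast_succ, ← add_assoc, h, ih, Finset.prod_range_succ]
    ring

/-- A product over at most one period of weights that differ from one only at the positions
congruent to `k`. -/
theorem prod_ite_modEq {K : Type*} [Field K] {n : ℕ} (k : ℤ) (x : K) (j : ℤ) (m : ℕ) (hm : m ≤ n)
    [∀ q : ℤ, Decidable (q ≡ k [ZMOD n])]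
    [Decidable (∃ q : ℤ, j ≤ q ∧ q < j + m ∧ q ≡ k [ZMOD n])] :
    ∏ t ∈ Finset.range m, (if j + (t : ℤ) ≡ k [ZMOD n] then x else 1) =
      if ∃ q : ℤ, j ≤ q ∧ q < j + m ∧ q ≡ k [ZMOD n] then x else 1 := by
  split_ifs with h
  · obtain ⟨q, hq, hq', hqk⟩ := h
    rw [Finset.prod_eq_single (q - j).toNat, if_pos]
    · rwa [show j + ((q - j).toNat : ℤ) = q by omega]
    · intro t ht htq
      rw [if_neg]
      intro htk
      have h1 := (hqk.trans htk.symm).dvd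
      rw [Finset.mem_range] at ht
      have h2 := Int.eq_zero_of_abs_lt_dvd h1 (by rw [abs_lt]; omega)
      omega
    · intro h
      exact absurd (Finset.mem_range.2 (by omega)) h
  · refine Finset.prod_eq_one fun t ht => if_neg fun htk => h ⟨j + t, by omega, ?_, htk⟩
    rw [Finset.mem_range] at ht
    omega

namespace GString.IsBand

variable {w : Q.GString} (hw : w.IsBand)

include hw

/-- The weights used for a band: the sign changes at every inverse homotopy letter, and the weight
is multiplied with `(-1)^r` at the letter with the scalar, where `r` is the number of direct
homotopy letters; as this is also the number of inverse homotopy letters, the weights are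
periodic. -/
theorem exists_weights {K : Type u} [Field K] [Fintype V] (hQ : Q.IsGentle K) {k : ℕ} {a : E}
    (hk : w.letters[k]? = some (.direct a)) {c : K} (hc : c ≠ 0) :
    ∃ lam om : ℤ → K, (∀ i, lam i ≠ 0) ∧ (∀ i, om i ≠ 0) ∧
      (∀ i, lam (i + w.letters.length) = lam i) ∧ (∀ i, om (i + w.letters.length) = om i) ∧
      (∀ i : ℕ, i < w.letters.length → lam i = if i = k then c else 1) ∧
      (∀ i j, w.cyclic.IsDirectLetter j i → Word.bandScalar w.letters.length k
        ((-1) ^ Word.numDirect Q w.start w.letters * c⁻¹) i j * om j *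
          ∏ t ∈ Finset.range (i - j).toNat, lam (j + t) = om i) ∧
      ∀ i j, w.cyclic.IsInverseLetter i j → Word.bandScalar w.letters.length k
        ((-1) ^ Word.numDirect Q w.start w.letters * c⁻¹) i j * om j = - om i := by
  classical
  obtain ⟨hkn, hk'⟩ := List.getElem?_eq_some_iff.1 hk
  set n := w.letters.length with hn
  set r := Word.numDirect Q w.start w.letters with hr
  have hkl : ∀ q : ℤ, q ≡ k [ZMOD n] → w.cyclic.letter q = some (.direct a) := by
    intro q hq
    rw [← cyclic_letter_emod, hq, cyclic_letter_emod, ← hk]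
    simp only [Word.periodic]
    rw [Int.emod_eq_of_lt (by omega) (by omega), Int.toNat_natCast]
  have hmod : ∀ q : ℤ, q + n ≡ k [ZMOD n] ↔ q ≡ k [ZMOD n] := by
    intro q
    simp [Int.ModEq]
  let lam : ℤ → K := fun q => if q ≡ k [ZMOD n] then c else 1
  -- `sgn` changes the sign at the inverse homotopy letters, and `crs` corrects the product of these
  -- signs over one period at the letter with the scalar
  let sgn : ℤ → K := fun q =>
    if w.cyclic.IsBreak q ∧ ∃ a, w.cyclic.letter q = some (.inverse a) then -1 else 1
  let crs : ℤ → K := fun q => if q ≡ k [ZMOD n] then (-1) ^ r else 1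
  have hsgn : ∀ q, sgn q ≠ 0 := by
    intro q
    simp only [sgn]
    split_ifs <;> simp
  have hcrs : ∀ q, crs q ≠ 0 := by
    intro q
    simp only [crs]
    split_ifs <;> simp
  obtain ⟨om, h0, h1⟩ := BoundQuiver.exists_weights (fun q => crs q * sgn q)
    fun q => mul_ne_zero (hcrs q) (hsgn q)
  have hadd := weights_add h1
  have hsgn_per : ∀ q, sgn (q + n) = sgn q := by
    intro q
    have e1 := isBreak_cyclic_add (w := w) q 1
    have e2 := cyclic_letter_add (w := w) q 1
    rw [one_mul] at e1 e2
    simp only [sgn, hn]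
    rw [e2]
    simp only [e1]
  have hcrs_per : ∀ q, crs (q + n) = crs q := by
    intro q
    simp only [crs, hmod]
  have hprod_sgn : ∏ t ∈ Finset.range n, sgn t = (-1) ^ r := by
    have e : ∏ t ∈ Finset.range n, sgn t = ∏ q ∈ Finset.Ico 0 (n : ℤ), sgn q := by
      refine Finset.prod_nbij' (fun t => (t : ℤ)) Int.toNat ?_ ?_ ?_ ?_ ?_
      · intro t ht
        simp only [Finset.mem_range, Finset.mem_Ico] at ht ⊢
        omega
      · intro t ht
        simp only [Finset.mem_range, Finset.mem_Ico] at ht ⊢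
        omega
      · intro t _
        exact Int.toNat_natCast t
      · intro t ht
        simp only [Finset.mem_Ico] at ht
        omega
      · exact fun _ _ => rfl
    rw [e, Finset.prod_ite, Finset.prod_const_one, mul_one, Finset.prod_const, hr,
      hw.numDirect_eq_numInverse, Word.numInverse, ← Set.ncard_coe_finset]
    congr 2
    ext i
    simp [and_assoc, hn]
  have hom_n : om n = om 0 := by
    have h2 := hadd 0 n
    simp only [zero_add] at h2
    have h3 := prod_ite_modEq k ((-1 : K) ^ r) 0 n le_rfl
    rw [if_pos ⟨k, by omega, by omega, rfl⟩] at h3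
    simp only [zero_add] at h3
    rw [h2, Finset.prod_mul_distrib, hprod_sgn, h3, ← mul_pow, neg_one_mul, neg_neg, one_pow,
      one_mul]
  have hom_per : ∀ q, om (q + n) = om q := by
    intro q
    induction q using Int.induction_on with
    | zero => rw [zero_add, hom_n]
    | succ q ih => rw [add_right_comm, h1, h1, ih, hsgn_per, hcrs_per]
    | pred q ih =>
      have h2 := h1 (-(q : ℤ) - 1)
      have h3 := h1 (-(q : ℤ) - 1 + n)
      rw [sub_add_cancel] at h2
      rw [show -(q : ℤ) - 1 + n + 1 = -q + n by ring, ih, hsgn_per, hcrs_per, h2] at h3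
      exact (mul_left_cancel₀ (mul_ne_zero (hcrs _) (hsgn _)) h3).symm
  refine ⟨lam, om, fun i => ?_, h0, fun i => ?_, hom_per, fun i hi => ?_, fun i j h => ?_,
    fun i j h => ?_⟩
  · simp only [lam]
    split_ifs
    · exact hc
    · exact one_ne_zero
  · simp only [lam, hmod]
  · have e : ((i : ℤ) ≡ k [ZMOD n]) ↔ i = k := by
      rw [Int.natCast_modEq_iff]
      exact ⟨fun h => Nat.ModEq.eq_of_lt_of_lt h hi hkn, fun h => by rw [h]⟩
    simp only [lam, e]
  · have hlt := h.1.1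
    have hlen := hw.length_isDirectLetter hQ h
    obtain ⟨m, hm⟩ : ∃ m : ℕ, i = j + m := ⟨(i - j).toNat, by omega⟩
    subst hm
    have h2 : ∏ t ∈ Finset.range m, sgn (j + t) = 1 := by
      refine Finset.prod_eq_one fun t ht => if_neg ?_
      rw [Finset.mem_range] at ht
      rintro ⟨-, b, hb⟩
      obtain ⟨d, hd⟩ := h.2 (j + t) (by omega) (by omega)
      rw [hb] at hd
      cases hd
    rw [hadd, Finset.prod_mul_distrib, h2, mul_one, add_sub_cancel_left, Int.toNat_natCast,
      prod_ite_modEq k c j m (by omega), prod_ite_modEq k ((-1 : K) ^ r) j m (by omega),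
      Word.bandScalar, min_eq_right (by omega), max_eq_left (by omega)]
    split_ifs
    · field_simp
    · ring
  · have hlt := h.1.1
    rw [Word.bandScalar, if_neg, one_mul]
    · obtain ⟨m, hm⟩ : ∃ m : ℕ, j = i + (m + 1 : ℕ) := ⟨(j - i).toNat - 1, by omega⟩
      subst hm
      rw [hadd, Finset.prod_mul_distrib, Finset.prod_eq_one (f := fun t : ℕ => crs (i + t)),
        Finset.prod_eq_single 0]
      · rw [Nat.cast_zero, add_zero, show sgn i = -1 from if_pos ⟨h.1.2.1, h.letter_left⟩]
        ring
      · intro t ht ht0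
        rw [Finset.mem_range] at ht
        exact if_neg fun hb => h.1.2.2.2 (i + t) (by omega) (by push_cast; omega) hb.1
      · exact fun h => absurd (Finset.mem_range.2 (Nat.succ_pos m)) h
      · intro t ht
        rw [Finset.mem_range] at ht
        refine if_neg fun hb => ?_
        obtain ⟨d, hd⟩ := h.2 (i + t) (by omega) (by push_cast; omega)
        rw [hkl _ hb] at hd
        cases hd
    · rintro ⟨q, hq, hq', hqk⟩
      rw [min_eq_left hlt.le] at hq
      rw [max_eq_right hlt.le] at hq'
      obtain ⟨d, hd⟩ := h.2 q hq hq'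
      rw [hkl _ hqk] at hd
      cases hd

end GString.IsBand

/-! ### The complex of a band -/

variable {K : Type u} [Field K] [Fintype V]

namespace GString

variable (w : Q.GString)

/-- The data defining the band complex. -/
noncomputable def bandSystem (k : ℕ) (c : K) (p : ℤ) : ProjSystem Q K where
  ι := {i : ℤ // 0 ≤ i ∧ i < w.letters.length ∧ w.cyclic.IsBreak i}
  vert i := w.cyclic.vert i
  deg i := w.cyclic.degree p i
  coef i j := ∑ᶠ m : ℤ, Word.bandScalar w.letters.length k c i (j + m * w.letters.length) •
    w.cyclic.component K i (j + m * w.letters.length)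
  sq i j j' := by
    refine finsum_induction (fun z => z * _ * _ = 0) (by rw [zero_mul, zero_mul])
      (fun y z hy hz => by rw [add_mul, add_mul, hy, hz, add_zero]) fun m => ?_
    refine finsum_induction (fun z => _ * z = 0) (mul_zero _)
      (fun y z hy hz => by rw [mul_add, hy, hz, add_zero]) fun m' => ?_
    rw [smul_mul_assoc, smul_mul_assoc, mul_smul_comm, Word.component_mul_component, smul_zero,
      smul_zero]
    · rw [cyclic_letter_add]
    · rw [cyclic_letter_sub_add]

theorem bandComplex_eq (k : ℕ) (c : K) (p : ℤ) :
    Word.bandComplex Q K w.start w.letters k c p = (w.bandSystem k c p).complex := rfl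

namespace IsBand

variable {w} (hw : w.IsBand)

theorem _root_.BoundQuiver.GString.emod_eq_iff {k j : ℤ} {n : ℕ} (h0 : 0 ≤ j) (h1 : j < n) :
    j = k % n ↔ ∃ m : ℤ, k = j + m * n := by
  constructor
  · intro h
    exact ⟨k / n, by rw [h, Int.emod_add_ediv_mul]⟩
  · rintro ⟨m, rfl⟩
    rw [Int.add_mul_emod_self_right, Int.emod_eq_of_lt h0 h1]

/-- In the complex of a band, the summands represent the breaks of the periodic word modulo its
period. -/
noncomputable def covering (k : ℕ) {μ : K} (hμ : μ ≠ 0) {p : ℤ} (hp : w.cyclic.IsPeak p) :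
    w.cyclic.Covering (w.bandSystem k μ p) where
  val i := i.1
  rep q j := j.1 = q % w.letters.length
  scal := Word.bandScalar w.letters.length k μ
  vert_eq _ := rfl
  exists_rep q hq := by
    have := hw.length_pos
    exact ⟨⟨q % w.letters.length, Int.emod_nonneg _ (by omega), Int.emod_lt_of_pos _ (by omega),
      isBreak_cyclic_emod.2 hq⟩, rfl⟩
  rep_unique h h' := Subtype.ext (h.trans h'.symm)
  rep_letter h := by rw [h, cyclic_letter_emod]
  rep_letter' {q j} h := by
    obtain ⟨m, rfl⟩ := (emod_eq_iff j.2.1 j.2.2.1).1 h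
    rw [cyclic_letter_sub_add]
  rep_deg {i j s} h hj := by
    obtain ⟨m, hm⟩ := (emod_eq_iff j.2.1 j.2.2.1).1 hj
    have h1 := h.degree_letterEnd p
    rw [hm, hw.degree_eq hp, cyclicDegree_add, ← hw.degree_eq hp] at h1
    exact h1
  rep_inj {i i' j s} h h' hj hj' := by
    obtain ⟨m, hm⟩ := (emod_eq_iff j.2.1 j.2.2.1).1 hj
    obtain ⟨m', hm'⟩ := (emod_eq_iff j.2.1 j.2.2.1).1 hj'
    obtain ⟨h1, h2⟩ := hasLetter_cyclic_add h (m' - m)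
    have h3 := h1.eq_of_letterEnd_eq h' (by rw [h2, hm, hm']; ring)
    have h4 := (emod_eq_iff i.2.1 i.2.2.1).2 ⟨_, h3.symm⟩
    have h5 := (emod_eq_iff i'.2.1 i'.2.2.1).2 ⟨0, show i'.1 = i'.1 + 0 * _ by ring⟩
    exact Subtype.ext (h4.trans h5.symm)
  scal_ne i j := by
    unfold Word.bandScalar
    split_ifs
    · exact hμ
    · exact one_ne_zero
  coef_eq i j := by
    classical
    have hn := hw.length_pos
    change (∑ᶠ m : ℤ, Word.bandScalar w.letters.length k μ i.1 (j.1 + m * w.letters.length) •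
      w.cyclic.component K i.1 (j.1 + m * w.letters.length)) * Q.idem K (w.cyclic.vert j.1) = _
    -- for each side, only the translate of `j` at the end of the homotopy letter contributes
    let f : Bool → ℤ → Q.BoundPathAlgebra K := fun s m =>
      if w.cyclic.HasLetter i.1 s ∧ w.cyclic.letterEnd i.1 s = j.1 + m * w.letters.length then
        Word.bandScalar w.letters.length k μ i.1 (w.cyclic.letterEnd i.1 s) •
          w.cyclic.letterPath K i.1 s else 0
    have hf : ∀ m : ℤ, Word.bandScalar w.letters.length k μ i.1 (j.1 + m * w.letters.length) •
        w.cyclic.component K i.1 (j.1 + m * w.letters.length) = ∑ s, f s m := by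
      intro m
      rw [Word.component_eq, Finset.smul_sum]
      refine Finset.sum_congr rfl fun s _ => ?_
      by_cases h : w.cyclic.HasLetter i.1 s ∧
          w.cyclic.letterEnd i.1 s = j.1 + m * w.letters.length
      · rw [if_pos h, show f s m = _ from if_pos h, h.2]
      · rw [if_neg h, show f s m = _ from if_neg h, smul_zero]
    have hsupp : ∀ s, (Function.support (f s)).Finite := by
      intro s
      refine Set.Subsingleton.finite fun m hm m' hm' => ?_
      have h1 : w.cyclic.letterEnd i.1 s = j.1 + m * w.letters.length := by
        by_contra h
        exact hm (if_neg fun h' => h h'.2)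
      have h2 : w.cyclic.letterEnd i.1 s = j.1 + m' * w.letters.length := by
        by_contra h
        exact hm' (if_neg fun h' => h h'.2)
      exact mul_right_cancel₀ (b := (w.letters.length : ℤ)) (by omega) (by omega)
    rw [finsum_congr hf, finsum_sum_comm _ _ fun s _ => hsupp s, Finset.sum_mul]
    refine Finset.sum_congr rfl fun s _ => ?_
    by_cases h : w.cyclic.HasLetter i.1 s ∧ j.1 = w.cyclic.letterEnd i.1 s % w.letters.length
    · rw [if_pos h]
      obtain ⟨m, hm⟩ := (emod_eq_iff j.2.1 j.2.2.1).1 h.2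
      rw [finsum_eq_single _ m, if_pos ⟨h.1, hm⟩, smul_mul_assoc]
      · congr 1
        have h1 := hw.isWalk.letterPath_mul_idem (K := K) h.1
        rw [hm, cyclic_vert_add] at h1
        exact h1
      · intro m' hm'
        refine if_neg fun h' => hm' ?_
        have h2 := hm.symm.trans h'.2
        exact (mul_right_cancel₀ (b := (w.letters.length : ℤ)) (by omega) (by omega)).symm
    · rw [if_neg h, finsum_eq_zero_of_forall_eq_zero, zero_mul]
      intro m
      refine if_neg fun h' => h ⟨h'.1, ?_⟩
      exact (emod_eq_iff j.2.1 j.2.2.1).2 ⟨m, h'.2⟩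

end IsBand

end GString

end BandComplexes

section BandModules

variable {V E : Type u} {Q : BoundQuiver V E} {K : Type u} [Field K] [Fintype V]

/-! ### The band module -/

namespace GString.IsBand

variable {w : Q.GString} (hw : w.IsBand)

variable {N : Type*} [AddCommGroup N] [Module (Q.BoundPathAlgebra K) N]

omit [Fintype V] in
theorem _root_.BoundQuiver.GString.cyclic_letter_coe {i : ℕ} (h : i < w.letters.length) :
    w.cyclic.letter i = w.letters[i]? := by
  simp only [Word.periodic]
  rw [Int.emod_eq_of_lt (by omega) (by omega), Int.toNat_natCast]

omit [Fintype V] in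
theorem letter_sub_one_ne {q : ℤ} {a : E} (hw : w.IsBand)
    (h : w.cyclic.letter q = some (.direct a)) : w.cyclic.letter (q - 1) ≠ some (.inverse a) :=
  fun h' => (hw.compatible h' (by rwa [sub_add_cancel])).1.2 rfl

open scoped Classical in
/-- The action of an arrow on the basis of the band module, in terms of the letters of the periodic
word and of a periodic family of vectors. -/
theorem sum_coef_smul {k : ℕ} {c : K} {lam : ℤ → K}
    (hlam : ∀ i : ℕ, i < w.letters.length → lam i = if i = k then c else 1) (Y : ℤ → N)
    (hY : ∀ i m : ℤ, Y (i + m * w.letters.length) = Y i) (a : E) (i : Fin w.letters.length) :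
    ∑ j, algebraMap K (Q.BoundPathAlgebra K) ((hw.rep K k c).coef a i j) • Y (j : ℕ) =
      (if w.cyclic.letter (i : ℕ) = some (.direct a) then
          algebraMap K (Q.BoundPathAlgebra K) (lam (i : ℕ)) • Y ((i : ℕ) + 1) else 0) +
        if w.cyclic.letter ((i : ℕ) - 1) = some (.inverse a) then Y ((i : ℕ) - 1) else 0 := by
  have hn := hw.length_pos
  have hi := i.2
  have key : ∀ j : Fin w.letters.length,
      algebraMap K (Q.BoundPathAlgebra K) ((hw.rep K k c).coef a i j) • Y (j : ℕ) =
        (if (j : ℕ) = (i + 1) % w.letters.length then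
          if w.cyclic.letter (i : ℕ) = some (.direct a) then
            algebraMap K (Q.BoundPathAlgebra K) (lam (i : ℕ)) • Y ((i : ℕ) + 1) else 0 else 0) +
        if (i : ℕ) = (j + 1) % w.letters.length then
          if w.cyclic.letter ((i : ℕ) - 1) = some (.inverse a) then Y ((i : ℕ) - 1) else 0
          else 0 := by
    intro j
    have hj := j.2
    simp only [rep]
    by_cases h1 : (j : ℕ) = (i + 1) % w.letters.length ∧ w.letters[(i : ℕ)]? = some (.direct a)
    · have h2 : w.cyclic.letter (i : ℕ) = some (.direct a) := (cyclic_letter_coe hi).trans h1.2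
      obtain ⟨m, hm⟩ := (emod_eq_iff (k := (i : ℕ) + 1) (j := (j : ℕ)) (by omega)
        (by omega : ((j : ℕ) : ℤ) < w.letters.length)).1 (by exact_mod_cast h1.1)
      rw [if_pos h1, if_pos h1.1, if_pos h2, if_neg (hw.letter_sub_one_ne h2), ite_self, add_zero,
        hlam i hi, hm, hY]
    · have h2 : (if (j : ℕ) = (i + 1) % w.letters.length then
          if w.cyclic.letter (i : ℕ) = some (.direct a) then
            algebraMap K (Q.BoundPathAlgebra K) (lam (i : ℕ)) • Y ((i : ℕ) + 1) else 0 else 0) =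
          0 := by
        split_ifs with h3 h4
        · exact absurd ⟨h3, (cyclic_letter_coe hi).symm.trans h4⟩ h1
        · rfl
        · rfl
      rw [if_neg h1, h2, zero_add]
      by_cases h3 : (i : ℕ) = (j + 1) % w.letters.length
      · obtain ⟨m, hm⟩ := (emod_eq_iff (k := (j : ℕ) + 1) (j := (i : ℕ)) (by omega)
          (by omega : ((i : ℕ) : ℤ) < w.letters.length)).1 (by exact_mod_cast h3)
        have hm' : ((j : ℕ) : ℤ) = (i : ℕ) - 1 + m * w.letters.length := by omega
        have h4 : w.letters[(j : ℕ)]? = w.cyclic.letter ((i : ℕ) - 1) := by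
          rw [← cyclic_letter_coe hj, hm', cyclic_letter_add]
        rw [if_pos h3, h4, hm', hY]
        by_cases h5 : w.cyclic.letter ((i : ℕ) - 1) = some (.inverse a)
        · rw [if_pos h5, if_pos ⟨h3, h5⟩, map_one, one_smul]
        · rw [if_neg h5, if_neg fun h => h5 h.2, map_zero, zero_smul]
      · rw [if_neg h3, if_neg fun h => h3 h.1, map_zero, zero_smul]
  rw [Finset.sum_congr rfl fun j _ => key j, Finset.sum_add_distrib]
  congr 1
  · rw [Finset.sum_eq_single ⟨(i + 1) % w.letters.length, Nat.mod_lt _ hn⟩, if_pos rfl]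
    · intro j _ hj
      exact if_neg fun h => hj (Fin.ext h)
    · exact fun h => absurd (Finset.mem_univ _) h
  · have e : (i : ℕ) = ((i + w.letters.length - 1) % w.letters.length + 1) % w.letters.length := by
      rw [Nat.mod_add_mod, show (i : ℕ) + w.letters.length - 1 + 1 = i + w.letters.length by omega,
        Nat.add_mod_right, Nat.mod_eq_of_lt hi]
    rw [Finset.sum_eq_single ⟨(i + w.letters.length - 1) % w.letters.length, Nat.mod_lt _ hn⟩,
      if_pos e]
    · intro j _ hj
      exact if_neg fun h => hj (Fin.ext (succ_injective j.2 (Nat.mod_lt _ hn) (h.symm.trans e)))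
    · exact fun h => absurd (Finset.mem_univ _) h

variable {k : ℕ} {c : K} {lam : ℤ → K}

variable (k c) in
/-- The basis vectors of the band module, repeated periodically. -/
noncomputable def bandBasis (q : ℤ) : (hw.rep K k c).toModule :=
  (hw.rep K k c).basisVec ⟨(q % w.letters.length).toNat, by
    have := hw.length_pos
    have h1 := Int.emod_nonneg q (b := w.letters.length) (by omega)
    have h2 := Int.emod_lt_of_pos q (b := w.letters.length) (by omega)
    omega⟩

theorem bandBasis_coe (i : Fin w.letters.length) :
    hw.bandBasis k c (i : ℕ) = (hw.rep K k c).basisVec i := by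
  have := i.2
  unfold bandBasis
  congr 1
  refine Fin.ext ?_
  simp only
  rw [Int.emod_eq_of_lt (by omega) (by omega), Int.toNat_natCast]

theorem bandBasis_add (q m : ℤ) :
    hw.bandBasis k c (q + m * w.letters.length) = hw.bandBasis k c q := by
  unfold bandBasis
  congr 2
  rw [Int.add_mul_emod_self_right]

omit [Fintype V] in
theorem exists_eq_add (q : ℤ) (hw : w.IsBand) :
    ∃ (i : Fin w.letters.length) (m : ℤ), q = (i : ℕ) + m * w.letters.length := by
  have := hw.length_pos
  have h1 := Int.emod_nonneg q (b := w.letters.length) (by omega)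
  have h2 := Int.emod_lt_of_pos q (b := w.letters.length) (by omega)
  refine ⟨⟨(q % w.letters.length).toNat, by omega⟩, q / w.letters.length, ?_⟩
  simp only
  rw [Int.toNat_of_nonneg h1, Int.emod_add_ediv_mul]

omit [Fintype V] in
theorem vert_coe (hw : w.IsBand) (i : Fin w.letters.length) :
    w.cyclic.vert (i : ℕ) = w.vertex i := by
  obtain ⟨u, hu⟩ := hw.exists_letter (i : ℕ)
  rw [← hw.isWalk.src_eq _ _ hu]
  rw [cyclic_letter_coe i.2] at hu
  exact w.src_getElem hu

theorem idem_smul_bandBasis (q : ℤ) :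
    Q.idem K (w.cyclic.vert q) • hw.bandBasis k c q = hw.bandBasis k c q := by
  obtain ⟨i, m, rfl⟩ := hw.exists_eq_add q
  rw [bandBasis_add, cyclic_vert_add, bandBasis_coe, hw.vert_coe]
  exact (hw.rep K k c).idem_smul_basisVec i

open scoped Classical in
theorem arrow_smul_bandBasis
    (hlam : ∀ i : ℕ, i < w.letters.length → lam i = if i = k then c else 1)
    (hper : ∀ i m : ℤ, lam (i + m * w.letters.length) = lam i) (a : E) (q : ℤ) :
    Q.arrow K a • hw.bandBasis k c q =
      (if w.cyclic.letter q = some (.direct a) then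
          algebraMap K (Q.BoundPathAlgebra K) (lam q) • hw.bandBasis k c (q + 1) else 0) +
        if w.cyclic.letter (q - 1) = some (.inverse a) then hw.bandBasis k c (q - 1) else 0 := by
  obtain ⟨i, m, rfl⟩ := hw.exists_eq_add q
  rw [bandBasis_add, cyclic_letter_add, cyclic_letter_sub_add, hper, add_right_comm, bandBasis_add,
    add_sub_right_comm, bandBasis_add,
    ← hw.sum_coef_smul hlam (hw.bandBasis k c) hw.bandBasis_add a i, bandBasis_coe]
  have := (hw.rep K k c).sum_coord (Q.arrow K a • (hw.rep K k c).basisVec i)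
  rw [← this]
  refine Finset.sum_congr rfl fun j _ => ?_
  rw [MatrixRep.coord_arrow_smul_basisVec, bandBasis_coe]

/-- The basis vectors at the summands of degree `0` generate the band module. -/
theorem eq_top_of_bandBasis_mem (hQ : Q.IsGentle K) (hlam0 : ∀ i, lam i ≠ 0)
    (hlam : ∀ i : ℕ, i < w.letters.length → lam i = if i = k then c else 1)
    (hper : ∀ i m : ℤ, lam (i + m * w.letters.length) = lam i)
    (W : Submodule (Q.BoundPathAlgebra K) (hw.rep K k c).toModule)
    (hW : ∀ q, w.cyclic.IsBreak q → w.cyclicDegree q = 0 → hw.bandBasis k c q ∈ W) : W = ⊤ := by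
  classical
  -- positions which are reached from a peak by direct letters
  have h1 : ∀ (r : ℕ) (q : ℤ), (∀ a, w.cyclic.letter (q - r - 1) ≠ some (.direct a)) →
      (∀ a, w.cyclic.letter q ≠ some (.inverse a)) → hw.bandBasis k c q ∈ W := by
    have hpeak : ∀ q : ℤ, (∀ a, w.cyclic.letter (q - 1) ≠ some (.direct a)) →
        (∀ a, w.cyclic.letter q ≠ some (.inverse a)) → hw.bandBasis k c q ∈ W := by
      intro q h h'
      refine hW q (hw.isBreak_iff.2 fun u v hu hv => ?_) (cyclicDegree_eq_zero_iff.2 h)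
      cases u with
      | direct a => exact absurd hu (h a)
      | inverse a =>
        cases v with
        | inverse b => exact absurd hv (h' b)
        | direct b => simp [Letter.isDirect]
    intro r
    induction r with
    | zero => exact fun q h h' => hpeak q (by simpa using h) h'
    | succ r ih =>
      intro q h h'
      by_cases hd : ∃ a, w.cyclic.letter (q - 1) = some (.direct a)
      · obtain ⟨a, ha⟩ := hd
        have h2 := ih (q - 1) (by
          rw [show q - 1 - (r : ℤ) - 1 = q - (r + 1 : ℕ) - 1 by push_cast; ring]
          exact h) fun b hb => by
            rw [ha] at hb
            cases hb
        have h3 := W.smul_mem (algebraMap K (Q.BoundPathAlgebra K) (lam (q - 1))⁻¹)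
          (W.smul_mem (Q.arrow K a) h2)
        rwa [hw.arrow_smul_bandBasis hlam hper, if_pos ha, if_neg (hw.letter_sub_one_ne ha),
          add_zero, ← mul_smul, ← map_mul, inv_mul_cancel₀ (hlam0 _), map_one, one_smul,
          sub_add_cancel] at h3
      · push Not at hd
        exact hpeak q hd h'
  -- positions which are reached by inverse letters
  have h2 : ∀ (r : ℕ) (q : ℤ), (∀ a, w.cyclic.letter (q + r) ≠ some (.inverse a)) →
      hw.bandBasis k c q ∈ W := by
    have hpeak : ∀ q : ℤ, (∀ a, w.cyclic.letter q ≠ some (.inverse a)) →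
        hw.bandBasis k c q ∈ W := by
      intro q h
      obtain ⟨r, -, hr⟩ := hw.exists_inverse_window hQ q
      exact h1 r q hr h
    intro r
    induction r with
    | zero => exact fun q h => hpeak q (by simpa using h)
    | succ r ih =>
      intro q h
      by_cases hd : ∃ a, w.cyclic.letter q = some (.inverse a)
      · obtain ⟨a, ha⟩ := hd
        have h2 := W.smul_mem (Q.arrow K a) (ih (q + 1) (by
          rw [show q + 1 + (r : ℤ) = q + (r + 1 : ℕ) by push_cast; ring]
          exact h))
        rwa [hw.arrow_smul_bandBasis hlam hper, add_sub_cancel_right, if_pos ha, if_neg, zero_add]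
          at h2
        intro h'
        have := hw.letter_sub_one_ne h'
        rw [add_sub_cancel_right] at this
        exact this ha
      · push Not at hd
        exact hpeak q hd
  refine (hw.rep K k c).eq_top_of_basisVec_mem W fun i => ?_
  rw [← bandBasis_coe]
  obtain ⟨r, -, hr⟩ := hw.exists_direct_window hQ (i : ℕ)
  exact h2 r _ hr

/-! ### The relations of the complex of a band -/

variable {μ : K} (hμ : μ ≠ 0) {p : ℤ} (hp : w.cyclic.IsPeak p) {om : ℤ → K}

/-- The contribution of the homotopy letter to the left of a summand. -/
theorem eval_false (hQ : Q.IsGentle K)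
    (hd : ∀ i j, w.cyclic.IsDirectLetter j i → Word.bandScalar w.letters.length k μ i j * om j *
      ∏ t ∈ Finset.range (i - j).toNat, lam (j + t) = om i)
    {F : (w.bandSystem k μ p).ι → N} {X : ℤ → N}
    (hF : ∀ j (q : ℤ), j.1 = q % w.letters.length → w.cyclic.IsBreak q → w.cyclicDegree q = 0 →
      F j = algebraMap K (Q.BoundPathAlgebra K) (om q) • X q)
    (hXe : ∀ q, Q.idem K (w.cyclic.vert q) • X q = X q) (i : (w.bandSystem k μ p).ι) {a : E}
    (hX : ∀ q a, w.cyclic.letter q = some (.direct a) →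
      Q.arrow K a • X q = algebraMap K (Q.BoundPathAlgebra K) (lam q) • X (q + 1))
    (ha : w.cyclic.letter (i.1 - 1) = some (.direct a)) :
    ((hw.covering k hμ hp).outgoing hw.isWalk hQ).eval F i false =
      algebraMap K (Q.BoundPathAlgebra K) (om i.1) • X i.1 := by
  obtain ⟨q, hq⟩ := hw.exists_isDirectLetter hQ i.2.2.2 ha
  obtain ⟨b, hb⟩ := hq.letter_left
  obtain ⟨j, hj⟩ := (hw.covering (K := K) k hμ hp).exists_rep q hq.1.2.1
  refine (hw.covering k hμ hp).eval_direct hw.isWalk hQ F X lam om hq hj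
    (hF j q hj hq.1.2.1 (cyclicDegree_eq_zero_iff.2 fun d hd' => ?_)) (hXe q)
    (fun l _ _ b hb => hX l b hb) (hd _ _ hq)
  exact hw.isBreak_iff.1 hq.1.2.1 _ _ hd' hb rfl

/-- The contribution of the homotopy letter to the right of a summand; the condition on the vectors
is not needed at positions which follow a direct letter, except for the summand itself. -/
theorem eval_true (hQ : Q.IsGentle K)
    (hi : ∀ i j, w.cyclic.IsInverseLetter i j →
      Word.bandScalar w.letters.length k μ i j * om j = - om i)
    {F : (w.bandSystem k μ p).ι → N} {X : ℤ → N} (i : (w.bandSystem k μ p).ι) {a : E}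
    (hF : ∀ j (q : ℤ), i.1 < q → j.1 = q % w.letters.length → w.cyclic.IsBreak q →
      w.cyclicDegree q = 0 → F j = algebraMap K (Q.BoundPathAlgebra K) (om q) • X q)
    (hXe : Q.idem K (w.cyclic.vert i.1) • X i.1 = X i.1)
    (hX : ∀ q a, i.1 ≤ q → w.cyclic.letter q = some (.inverse a) →
      (i.1 < q → ∀ b, w.cyclic.letter (q - 1) ≠ some (.direct b)) → Q.arrow K a • X (q + 1) = X q)
    (ha : w.cyclic.letter i.1 = some (.inverse a)) :
    ((hw.covering k hμ hp).outgoing hw.isWalk hQ).eval F i true =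
      - (algebraMap K (Q.BoundPathAlgebra K) (om i.1) • X i.1) := by
  obtain ⟨q, hq⟩ := hw.exists_isInverseLetter hQ i.2.2.2 ha
  obtain ⟨b, hb⟩ := hq.letter_right
  obtain ⟨j, hj⟩ := (hw.covering (K := K) k hμ hp).exists_rep q hq.1.2.2.1
  refine (hw.covering k hμ hp).eval_inverse hw.isWalk hQ F X om hq hj
    (hF j q hq.1.1 hj hq.1.2.2.1 (cyclicDegree_eq_zero_iff.2 (by simp [hb]))) hXe
    (fun l hl hl' b hb => ?_) (hi _ _ hq)
  refine hX l b hl hb fun hil d hd' => ?_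
  obtain ⟨e, he⟩ := hq.2 (l - 1) (by omega) (by omega)
  rw [hd'] at he
  cases he

/-- A periodic family of vectors along the band with prescribed values at the summands of degree `0`
that satisfy the relations of the complex: it is moved by the letters of the band. -/
theorem exists_family_of_relations (hQ : Q.IsGentle K) (hlam0 : ∀ i, lam i ≠ 0)
    (h0 : ∀ i, om i ≠ 0) (hlam : ∀ i, lam (i + w.letters.length) = lam i)
    (hom : ∀ i, om (i + w.letters.length) = om i)
    (hd : ∀ i j, w.cyclic.IsDirectLetter j i → Word.bandScalar w.letters.length k μ i j * om j *
      ∏ t ∈ Finset.range (i - j).toNat, lam (j + t) = om i)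
    (hi : ∀ i j, w.cyclic.IsInverseLetter i j →
      Word.bandScalar w.letters.length k μ i j * om j = - om i)
    {G : (w.bandSystem k μ p).ι → N} (hGe : ∀ i, Q.idem K (w.cyclic.vert i.1) • G i = G i)
    (hG : ((hw.covering k hμ hp).outgoing hw.isWalk hQ).Relations (-1) G) :
    ∃ Y : ℤ → N, (∀ q, Q.idem K (w.cyclic.vert q) • Y q = Y q) ∧
      (∀ j, w.cyclicDegree j.1 = 0 →
        G j = algebraMap K (Q.BoundPathAlgebra K) (om j.1) • Y j.1) ∧
      (∀ q a, w.cyclic.letter q = some (.direct a) →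
        Q.arrow K a • Y q = algebraMap K (Q.BoundPathAlgebra K) (lam q) • Y (q + 1)) ∧
      (∀ q a, w.cyclic.letter q = some (.inverse a) → Q.arrow K a • Y (q + 1) = Y q) ∧
      ∀ q m : ℤ, Y (q + m * w.letters.length) = Y q := by
  classical
  have hn := hw.length_pos
  have hex : ∀ q, w.cyclic.IsBreak q → ∃ j : (w.bandSystem (K := K) k μ p).ι,
      j.1 = q % w.letters.length := fun q hq => (hw.covering k hμ hp).exists_rep q hq
  -- the vectors at the breaks, of which only those at the summands of degree `0` matter
  let B : ℤ → N := fun q => if h : w.cyclic.IsBreak q then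
    algebraMap K (Q.BoundPathAlgebra K) (om q)⁻¹ • G (hex q h).choose else 0
  have hB : ∀ (q : ℤ) (j : (w.bandSystem (K := K) k μ p).ι), w.cyclic.IsBreak q →
      j.1 = q % w.letters.length → B q = algebraMap K (Q.BoundPathAlgebra K) (om q)⁻¹ • G j := by
    intro q j hq hj
    have e : (hex q hq).choose = j := Subtype.ext ((hex q hq).choose_spec.trans hj.symm)
    exact (dif_pos hq).trans (by rw [e])
  have hBe : ∀ q, Q.idem K (w.cyclic.vert q) • B q = B q := by
    intro q
    by_cases hq : w.cyclic.IsBreak q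
    · obtain ⟨j, hj⟩ := hex q hq
      obtain ⟨m, rfl⟩ := (emod_eq_iff j.2.1 j.2.2.1).1 hj
      rw [hB _ j hq hj, algebraMap_smul_comm, cyclic_vert_add, hGe]
    · rw [show B q = 0 from dif_neg hq, smul_zero]
  have hBn : ∀ q, B (q + w.letters.length) = B q := by
    intro q
    have e := isBreak_cyclic_add (w := w) q 1
    rw [one_mul] at e
    by_cases hq : w.cyclic.IsBreak q
    · obtain ⟨j, hj⟩ := hex q hq
      rw [hB q j hq hj, hB _ j (e.2 hq) (by rw [hj, Int.add_emod_right]), hom]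
    · rw [show B q = 0 from dif_neg hq]
      exact dif_neg fun h => hq (e.1 h)
  obtain ⟨Y, hYe, hYp, hYd, hYi, hYn⟩ := Word.exists_family (σ := w.cyclic) (K := K)
    hw.isWalk.src_eq hw.isWalk.tgt_eq w.letters.length (hw.exists_inverse_window hQ)
    (hw.exists_direct_window hQ) lam hlam0 B hBe w.letters.length
    (fun i => by
      have := cyclic_letter_add (w := w) i 1
      rwa [one_mul] at this) hlam hBn
  have hYper : ∀ q m : ℤ, Y (q + m * w.letters.length) = Y q := by
    intro q m
    have h := Function.Periodic.int_mul (f := Y) (c := (w.letters.length : ℤ)) hYn m q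
    rwa [Int.cast_id] at h
  have hYG : ∀ (j : (w.bandSystem (K := K) k μ p).ι) (q : ℤ), j.1 = q % w.letters.length →
      w.cyclic.IsBreak q → w.cyclicDegree q = 0 →
        G j = algebraMap K (Q.BoundPathAlgebra K) (om q) • Y q := by
    intro j q hj hq hqd
    have hnd := cyclicDegree_eq_zero_iff.1 hqd
    rw [hYp q hnd, hB q j hq hj, ← mul_smul, ← map_mul, mul_inv_cancel₀ (h0 q), map_one, one_smul]
    intro a ha
    obtain ⟨v, hv⟩ := hw.exists_letter (q - 1)
    cases v with
    | direct b => exact hnd b hv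
    | inverse b => exact hw.isBreak_iff.1 hq _ _ hv ha rfl
  -- where a direct letter is followed by an inverse one, the relation says that the vectors reached
  -- from the two sides agree
  have hdeep : ∀ (i : (w.bandSystem (K := K) k μ p).ι) a b,
      w.cyclic.letter i.1 = some (.inverse a) → w.cyclic.letter (i.1 - 1) = some (.direct b) →
      Q.arrow K a • Y (i.1 + 1) = Y i.1 := by
    intro i a b ha hb
    have hrel := hG i (by
      change w.cyclic.degree p i.1 = -1
      rw [hw.degree_eq hp, cyclicDegree, if_pos ⟨b, hb⟩])
    -- the vector at the position `i` is replaced by the one that is reached from the left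
    have h1 := hw.eval_true hμ hp hQ hi (F := G) (X := fun l => if l = i.1 then
      Q.arrow K a • Y (i.1 + 1) else Y l) i (a := a) ?_ ?_ ?_ ha
    · rw [hw.eval_false hμ hp hQ hd hYG hYe i hYd hb, h1, neg_add_eq_zero, if_pos rfl] at hrel
      exact algebraMap_smul_injective (h0 i.1) hrel
    · intro j q hq hj hqb hqd
      rw [if_neg (by omega)]
      exact hYG j q hj hqb hqd
    · rw [if_pos rfl, ← mul_smul, hw.isWalk.idem_mul_arrow_inverse ha]
    · intro l d hl hl' hlc
      rw [if_neg (by omega)]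
      rcases hl.eq_or_lt with h | h
      · rw [← h, if_pos rfl]
        rw [← h, ha] at hl'
        obtain rfl := Letter.inverse.inj (Option.some.inj hl')
        rfl
      · rw [if_neg (by omega)]
        exact hYi l d hl' (hlc h)
  refine ⟨Y, hYe, fun j hj => hYG j j.1 (Int.emod_eq_of_lt j.2.1 j.2.2.1).symm j.2.2.2 hj, hYd,
    fun q a ha => ?_, hYper⟩
  by_cases h : ∃ b, w.cyclic.letter (q - 1) = some (.direct b)
  · obtain ⟨b, hb⟩ := h
    have hq : w.cyclic.IsBreak q := hw.isBreak_iff.2 fun u v hu hv => by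
      rw [hb] at hu
      rw [ha] at hv
      obtain rfl := Option.some.inj hu
      obtain rfl := Option.some.inj hv
      simp [Letter.isDirect]
    obtain ⟨j, hj⟩ := hex q hq
    obtain ⟨m, rfl⟩ := (emod_eq_iff j.2.1 j.2.2.1).1 hj
    rw [cyclic_letter_add] at ha
    rw [cyclic_letter_sub_add] at hb
    rw [add_right_comm, hYper, hYper]
    exact hdeep j a b ha hb
  · push Not at h
    exact hYi q a ha h

theorem isExact (hQ : Q.IsGentle K) :
    ((hw.covering (K := K) k hμ hp).outgoing hw.isWalk hQ).IsExact := by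
  intro i hi
  left
  change w.cyclic.degree p i.1 < 0 at hi
  rw [hw.degree_eq hp] at hi
  obtain ⟨a, ha⟩ : ∃ a, w.cyclic.letter (i.1 - 1) = some (.direct a) := by
    by_contra h
    push Not at h
    rw [cyclicDegree_eq_zero_iff.2 h] at hi
    omega
  obtain ⟨b, hb⟩ := hw.exists_inverse_of_deep i.2.2.2 ha
  obtain ⟨q, hq⟩ := hw.exists_isInverseLetter hQ i.2.2.2 hb
  obtain ⟨q', hq'⟩ := hw.exists_isDirectLetter hQ i.2.2.2 ha
  obtain ⟨j, hj⟩ := (hw.covering (K := K) k hμ hp).exists_rep q hq.1.2.2.1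
  obtain ⟨j', hj'⟩ := (hw.covering (K := K) k hμ hp).exists_rep q' hq'.1.2.1
  refine ⟨j, j', ⟨Word.hasLetter_true.2 ⟨q, hq⟩, ?_⟩, ⟨Word.hasLetter_false.2 ⟨q', hq'⟩, ?_⟩⟩
  · change (hw.covering (K := K) k hμ hp).rep (w.cyclic.letterEnd i.1 true) j
    rwa [hq.letterEnd_eq]
  · change (hw.covering (K := K) k hμ hp).rep (w.cyclic.letterEnd i.1 false) j'
    rwa [hq'.letterEnd_eq]

/-- The band complex is a projective resolution of the band module. -/
theorem isProjectiveResolution (hQ : Q.IsGentle K) (hp : w.cyclic.IsPeak p) {a : E}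
    (hk : w.letters[k]? = some (.direct a)) (hc : c ≠ 0) :
    IsProjectiveResolution (Word.bandComplex Q K w.start w.letters k
      ((-1) ^ Word.numDirect Q w.start w.letters * c⁻¹) p) (hw.module K k c) := by
  classical
  obtain ⟨lam, om, hlam0, h0, hlamn, homn, hlam, hd, hi⟩ := hw.exists_weights hQ hk hc
  have hμ : (-1) ^ Word.numDirect Q w.start w.letters * c⁻¹ ≠ 0 :=
    mul_ne_zero (pow_ne_zero _ (neg_ne_zero.2 one_ne_zero)) (inv_ne_zero hc)
  have hlamper : ∀ q m : ℤ, lam (q + m * w.letters.length) = lam q := by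
    intro q m
    have h := Function.Periodic.int_mul (f := lam) (c := (w.letters.length : ℤ)) hlamn m q
    rwa [Int.cast_id] at h
  have homper : ∀ q m : ℤ, om (q + m * w.letters.length) = om q := by
    intro q m
    have h := Function.Periodic.int_mul (f := om) (c := (w.letters.length : ℤ)) homn m q
    rwa [Int.cast_id] at h
  set μ := (-1) ^ Word.numDirect Q w.start w.letters * c⁻¹ with hμ_def
  have hdeg : ∀ i : (w.bandSystem (K := K) k μ p).ι,
      (w.bandSystem (K := K) k μ p).deg i = w.cyclicDegree i.1 := fun i => hw.degree_eq hp i.1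
  have hZd : ∀ q a, w.cyclic.letter q = some (.direct a) → Q.arrow K a • hw.bandBasis k c q =
      algebraMap K (Q.BoundPathAlgebra K) (lam q) • hw.bandBasis k c (q + 1) := by
    intro q a ha
    rw [hw.arrow_smul_bandBasis hlam hlamper, if_pos ha, if_neg (hw.letter_sub_one_ne ha), add_zero]
  have hZi : ∀ q a, w.cyclic.letter q = some (.inverse a) →
      Q.arrow K a • hw.bandBasis k c (q + 1) = hw.bandBasis k c q := by
    intro q a ha
    rw [hw.arrow_smul_bandBasis hlam hlamper, add_sub_cancel_right, if_pos ha, if_neg, zero_add]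
    intro h'
    have := hw.letter_sub_one_ne h'
    rw [add_sub_cancel_right] at this
    exact this ha
  rw [bandComplex_eq]
  change IsProjectiveResolution _ (hw.rep K k c).toModule
  refine ((hw.covering k hμ hp).outgoing hw.isWalk hQ).isProjectiveResolution hQ (fun n => ?_)
    (fun i => ?_) (hw.isExact hμ hp hQ) _
    (fun j => algebraMap K (Q.BoundPathAlgebra K) (om j.1) • hw.bandBasis k c j.1) ?_ ?_ ?_ ?_
  · refine Finite.of_injective (β := Set.Ico (0 : ℤ) w.letters.length)
      (fun i => ⟨i.1.1, i.1.2.1, i.1.2.2.1⟩) fun i j h => ?_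
    exact Subtype.ext (Subtype.ext (congrArg (fun x => x.1) h))
  · rw [hdeg, cyclicDegree]
    split_ifs <;> omega
  · intro i _
    change Q.idem K (w.cyclic.vert i.1) • _ = _
    rw [algebraMap_smul_comm, hw.idem_smul_bandBasis]
  · have hF : ∀ (j : (w.bandSystem (K := K) k μ p).ι) (q : ℤ), j.1 = q % w.letters.length →
        algebraMap K (Q.BoundPathAlgebra K) (om j.1) • hw.bandBasis k c j.1 =
          algebraMap K (Q.BoundPathAlgebra K) (om q) • hw.bandBasis k c q := by
      intro j q hj
      obtain ⟨m, rfl⟩ := (emod_eq_iff j.2.1 j.2.2.1).1 hj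
      rw [homper, hw.bandBasis_add]
    intro i hi1
    rw [hdeg] at hi1
    obtain ⟨b, hb⟩ : ∃ a, w.cyclic.letter (i.1 - 1) = some (.direct a) := by
      by_contra h
      push Not at h
      rw [cyclicDegree_eq_zero_iff.2 h] at hi1
      omega
    obtain ⟨d, hd'⟩ := hw.exists_inverse_of_deep i.2.2.2 hb
    rw [hw.eval_true hμ hp hQ hi (X := hw.bandBasis k c) i (fun j q _ hj _ _ => hF j q hj)
        (hw.idem_smul_bandBasis _) (fun q a _ ha _ => hZi q a ha) hd',
      hw.eval_false hμ hp hQ hd (X := hw.bandBasis k c) (fun j q hj _ _ => hF j q hj)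
        hw.idem_smul_bandBasis i hZd hb, neg_add_cancel]
  · intro W hW
    refine hw.eq_top_of_bandBasis_mem hQ hlam0 hlam hlamper W fun q hq hqd => ?_
    obtain ⟨j, hj⟩ := (hw.covering (K := K) k hμ hp).exists_rep q hq
    obtain ⟨m, rfl⟩ := (emod_eq_iff j.2.1 j.2.2.1).1 hj
    rw [cyclicDegree_add] at hqd
    have h1 := hW j ((hdeg j).trans hqd)
    have h2 := W.smul_mem (algebraMap K (Q.BoundPathAlgebra K) (om j.1)⁻¹) h1
    rw [← mul_smul, ← map_mul, inv_mul_cancel₀ (h0 _), map_one, one_smul] at h2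
    rwa [hw.bandBasis_add]
  · intro N _ _ G hGe hG
    obtain ⟨Y, hYe, hYG, hYd, hYi, hYper⟩ :=
      hw.exists_family_of_relations hμ hp hQ hlam0 h0 hlamn homn hd hi hGe hG
    obtain ⟨f, hf⟩ := (hw.rep K k c).exists_linearMap (fun i => Y (i : ℕ)) (fun i => by
        have := hYe (i : ℕ)
        rwa [hw.vert_coe] at this) (fun a i => by
      rw [hw.sum_coef_smul hlam Y hYper]
      have hz : Q.idem K (w.cyclic.vert (i : ℕ)) • Y (i : ℕ) = Y (i : ℕ) := hYe _
      by_cases hd1 : w.cyclic.letter (i : ℕ) = some (.direct a)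
      · rw [if_pos hd1, if_neg (hw.letter_sub_one_ne hd1), add_zero, hYd _ a hd1]
      by_cases hd2 : w.cyclic.letter ((i : ℕ) - 1) = some (.inverse a)
      · have := hYi _ a hd2
        rw [sub_add_cancel] at this
        rw [if_neg hd1, if_pos hd2, zero_add, this]
      rw [if_neg hd1, if_neg hd2, add_zero]
      -- the arrows that are not letters annihilate the vector, since every vertex of the band lies
      -- between two letters
      by_cases hs : Q.s a = w.cyclic.vert (i : ℕ)
      · obtain ⟨u, hu⟩ := hw.exists_letter ((i : ℕ) - 1)
        obtain ⟨v, hv⟩ := hw.exists_letter (i : ℕ)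
        have htu := hw.isWalk.tgt_eq _ _ hu
        rw [sub_add_cancel] at htu
        rcases Letter.arrow_cases hQ (hw.compatible hu (by rwa [sub_add_cancel]))
          (hs.trans htu.symm) with rfl | rfl | ⟨b, rfl, hab⟩ | ⟨b, rfl, hab⟩
        · exact absurd hv hd1
        · exact absurd hu hd2
        · have := hYd _ b hu
          rw [sub_add_cancel] at this
          have h2 : Q.arrow K a • algebraMap K (Q.BoundPathAlgebra K) (lam ((i : ℕ) - 1)) •
              Y (i : ℕ) = 0 := by
            rw [← this, ← mul_smul, arrow_mul_arrow_of_rel K hab, zero_smul]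
          rw [algebraMap_smul_comm] at h2
          exact algebraMap_smul_injective (hlam0 _) (h2.trans (smul_zero _).symm)
        · rw [← hYi _ b hv, ← mul_smul, arrow_mul_arrow_of_rel K hab, zero_smul]
      · rw [← hz, ← mul_smul, arrow_mul_idem, if_neg (Ne.symm hs), zero_smul])
    refine ⟨f, fun j hj => ?_⟩
    rw [hdeg] at hj
    obtain ⟨i, hi'⟩ : ∃ i : Fin w.letters.length, j.1 = (i : ℕ) :=
      ⟨⟨j.1.toNat, by have := j.2.1; have := j.2.2.1; omega⟩, by
        have := j.2.1
        simp only
        omega⟩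
    rw [hYG j hj, map_smul, hi', hw.bandBasis_coe, hf]

end GString.IsBand

end BandModules

end BoundQuiver

theorem mainTheorem5 {K : Type u} [Field K] [IsAlgClosed K] {V E : Type u} [Fintype V] [Finite E]
    (Q : BoundQuiver V E) (hQ : Q.IsGentle K) :
    (∀ w : Q.GString,
      (∃ β γ : Option E, w.IsMaximalExtension β γ) ∧
      ∀ β γ : Option E, w.IsMaximalExtension β γ →
        (w.homotopyString β γ).IsHomotopyString ∧
        (∃ p, (w.homotopyString β γ).IsPeak p) ∧
        ∀ p, (w.homotopyString β γ).IsPeak p →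
          IsProjectiveResolution ((w.homotopyString β γ).stringComplex K p) (w.module K)) ∧
    (∀ (w : Q.GString) (hw : w.IsBand),
      Word.IsHomotopyBand Q w.start w.letters ∧
      (∃ p, (Word.periodic Q w.start w.letters).IsPeak p) ∧
      ∀ p, (Word.periodic Q w.start w.letters).IsPeak p →
        ∀ (k : ℕ) (a : E), w.letters[k]? = some (.direct a) → ∀ c : K, c ≠ 0 →
          IsProjectiveResolution
            (Word.bandComplex Q K w.start w.letters k
              ((-1) ^ Word.numDirect Q w.start w.letters * c⁻¹) p)
            (hw.module K k c)) := by
  refine ⟨fun w => ⟨w.exists_isMaximalExtension, fun β γ hm => ?_⟩, fun w hw =>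
    ⟨hw.isHomotopyBand, hw.exists_isPeak hQ,
      fun p hp k a hk c hc => hw.isProjectiveResolution hQ hp hk hc⟩⟩
  obtain ⟨o, L, T⟩ := w.exists_isTrim β γ
  exact ⟨T.isHomotopyString hm.1, T.exists_isPeak hm.1, fun p hp => hm.isProjectiveResolution hQ hp⟩
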